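/- Let $\Sigma\subset\mathbb R^3$ be a compact, closed, regular $C^2$-curve of length $L>0$ without self-intersections, with an $L$-periodic $C^2$ arc length parametrization $\sigma$, and let $\alpha\in\mathbb R\setminus\{0\}$. Let $-\Delta_{\rm free}$ be the Laplacian in $L^2(\mathbb R^3)$ with domain $H^2(\mathbb R^3)$. For $h\in L^2(\Sigma)$ let $h\delta_\Sigma$ be the distribution $\varphi\mapsto\int_\Sigma h\,\varphi\,d\sigma$, where $d\sigma$ is integration with respect to arc length. For $\mu<0$ let $\gamma_\mu h=(-\Delta-\mu)^{-1}(h\delta_\Sigma)\in L^2(\mathbb R^3)$, and let $\overline{B_\mu}$ be the closure in $L^2(\Sigma)$ of the operator $B_\mu$ defined on the complex-valued Lipschitz functions $h$ on $\Sigma$ by $$(B_\mu h)(x)=\lim_{\delta\searrow0}\Big[\int_{\Sigma\setminus I_\delta(x)}h(y)\frac{e^{-\sqrt{-\mu}|x-y|}}{4\pi|x-y|}\,d\sigma(y)+h(x)\frac{\ln\delta}{2\pi}\Big],\qquad x\in\Sigma,$$ where $I_\delta(\sigma(s_0))=\{\sigma(s):|s-s_0|<\delta\}$. For $u=u_c+\gamma_\mu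 h$ with $u_c\in H^2(\mathbb R^3)$ and $h\in\operatorname{dom}\overline{B_\mu}$, the generalized trace of $u$ is $u|_\Sigma=u_c|_\Sigma+\overline{B_\mu}h$, where $u_c|_\Sigma$ is the restriction of the continuous representative of $u_c$. The Schrödinger operator $-\Delta_{\Sigma,\alpha}$ with $\delta$-interaction of strength $1/\alpha$ on $\Sigma$ is the operator in $L^2(\mathbb R^3)$ given by $$-\Delta_{\Sigma,\alpha}u=-\Delta u-\tfrac1\alpha\,u|_\Sigma\cdot\delta_\Sigma$$ on the domain of all $u=u_c+\gamma_\mu h$ with $u_c\in H^2(\mathbb R^3)$ and $h\in\operatorname{dom}\overline{B_\mu}$ for which the right-hand side, taken in the sense of distributions, belongs to $L^2(\mathbb R^3)$; here $\mu<0$ is arbitrary. Then for every $\lambda\in\rho(-\Delta_{\Sigma,\alpha})\cap\rho(-\Delta_{\rm free})$ the resolvent difference $$(-\Delta_{\Sigma,\alpha}-\lambda)^{-1}-(-\Delta_{\rm free}-\lambda)^{-1}$$ is a compact operator in $L^2(\mathbb R^3)$ and its singular values $s_1(\lambda)\ge s_2(\lambda)\ge\dots$, counted with multiplicities, satisfy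 $$s_k(\lambda)=O\Big(\frac1{k^2\ln k}\Big)\qquad\text{as }k\to+\infty.$$ In particular, the resolvent difference belongs to the Schatten--von Neumann ideal $\mathfrak S_p(L^2(\mathbb R^3))$ for every $p>1/2$. -/

import Mathlib

open MeasureTheory Filter Topology Asymptotics
open scoped SchwartzMap Laplacian ENNReal InnerProduct

noncomputable section

namespace DeltaCurve

/-! ### The curve and the spaces -/

/-- Three-dimensional Euclidean space. -/
abbrev E3 : Type := EuclideanSpace ℝ (Fin 3)

/-- The Hilbert space `L²(ℝ³)` of complex-valued functions. -/
abbrev L2R3 : Type := Lp ℂ 2 (volume : Measure E3)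

/-- A compact, closed, regular `C²` curve in `ℝ³` without self-intersections, given by the
`L`-periodic extension `σ` of its arc length parametrization. -/
structure ClosedCurve where
  /-- the length -/
  L : ℝ
  L_pos : 0 < L
  /-- the arc length parametrization, extended periodically -/
  σ : ℝ → E3
  contDiff : ContDiff ℝ 2 σ
  unit_speed : ∀ s, ‖deriv σ s‖ = 1
  periodic : Function.Periodic σ L
  injOn : Set.InjOn σ (Set.Ico 0 L)

namespace ClosedCurve

variable (Γ : ClosedCurve)

/-- The set `Σ ⊆ ℝ³`. -/
def carrier : Set E3 := Set.range Γ.σ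

/-- The arc length measure of `Σ`, as a measure on `ℝ³` concentrated on `Σ`. -/
def arcLength : Measure E3 := (volume.restrict (Set.Ico 0 Γ.L)).map Γ.σ

instance : IsFiniteMeasure Γ.arcLength := by
  unfold arcLength
  infer_instance

/-- The Hilbert space `L²(Σ)`. -/
abbrev L2 : Type := Lp ℂ 2 Γ.arcLength

/-- The open interval `I_δ(x)` in `Σ` with centre `x` and length `2δ`. -/
def interval (x : E3) (δ : ℝ) : Set E3 :=
  {y | ∃ s₀ s : ℝ, Γ.σ s₀ = x ∧ s ∈ Set.Ioo (s₀ - δ) (s₀ + δ) ∧ Γ.σ s = y}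

/-- The distribution `h δ_Σ`, i.e. `φ ↦ ∫_Σ h φ dσ`. -/
def deltaDist (h : Γ.L2) : 𝓢'(E3, ℂ) := Lp.toTemperedDistribution h

end ClosedCurve

/-- The tempered distribution defined by an element of `L²(ℝ³)`. -/
def toDist (u : L2R3) : 𝓢'(E3, ℂ) := Lp.toTemperedDistribution u

/-- Membership in the Sobolev space `H²(ℝ³)`. -/
def MemH2 (u : L2R3) : Prop := TemperedDistribution.MemSobolev 2 2 (toDist u)

/-! ### Operators in a Hilbert space, given by their graphs -/

section Operators

variable {H : Type*} [NormedAddCommGroup H] [InnerProductSpace ℂ H]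

/-- `R` is the resolvent `(A - z)⁻¹` of the operator `A` with the graph `G`: the operator `A - z` is
a bijection of its domain onto `H`, and its inverse is the bounded operator `R`. Thus `z` belongs
to the resolvent set of `A` if and only if such an `R` exists; `R` is then unique. -/
def IsResolventAt (G : Set (H × H)) (z : ℂ) (R : H →L[ℂ] H) : Prop :=
  ∀ u v : H, (u, v + z • u) ∈ G ↔ u = R v

variable [CompleteSpace H]

/-- The number of singular values of `T` (square roots of eigenvalues of `T⋆T`) that are larger
than `t ≥ 0`, counted with multiplicities. -/
def singularCount (T : H →L[ℂ] H) (t : ℝ) : Cardinal :=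
  Module.rank ℂ
    (⨆ c ∈ Set.Ioi t, Module.End.eigenspace
      ((ContinuousLinearMap.adjoint T ∘L T : H →L[ℂ] H) : H →ₗ[ℂ] H) (((c ^ 2 : ℝ)) : ℂ) :
        Submodule ℂ H)

/-- For `k ≥ 1`, the `k`-th singular value `s_k` of a compact operator `T`, where the singular
values `s₁ ≥ s₂ ≥ …` are counted with multiplicities (and continued by zeros if there are only
finitely many positive ones): the least `t ≥ 0` such that fewer than `k` singular values are larger
than `t`. -/
def singularValue (T : H →L[ℂ] H) (k : ℕ) : ℝ :=
  sInf {t : ℝ | 0 ≤ t ∧ singularCount T t < (k : Cardinal)}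

/-- Membership in the Schatten--von Neumann ideal `𝔖_p(H)`. -/
def MemSchatten (p : ℝ) (T : H →L[ℂ] H) : Prop :=
  IsCompactOperator T ∧ Summable fun k : ℕ => singularValue T (k + 1) ^ p

end Operators

/-- The graph of the free Laplacian `-Δ` with domain `H²(ℝ³)`. -/
def freeGraph : Set (L2R3 × L2R3) :=
  {p | MemH2 p.1 ∧ -Δ (toDist p.1) = toDist p.2}

/-! ### The generalized trace and the operator with a δ-interaction -/

namespace ClosedCurve

variable (Γ : ClosedCurve)

/-- `v = γ_lam h = (-Δ - lam)⁻¹ (h δ_Σ)`, for `lam < 0`. -/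
def IsGamma (lam : ℝ) (h : Γ.L2) (v : L2R3) : Prop :=
  -Δ (toDist v) - (lam : ℂ) • toDist v = Γ.deltaDist h

/-- The expression in brackets in the definition of `(B_lam h)(x)`. -/
def regularized (lam : ℝ) (h : E3 → ℂ) (x : E3) (δ : ℝ) : ℂ :=
  (∫ y in (Γ.interval x δ)ᶜ,
      h y * ((Real.exp (-√(-lam) * ‖x - y‖) / (4 * Real.pi * ‖x - y‖) : ℝ) : ℂ) ∂Γ.arcLength)
    + h x * ((Real.log δ / (2 * Real.pi) : ℝ) : ℂ)

/-- The graph in `L²(Σ)` of `B_lam`, whose domain consists of the Lipschitz functions on `Σ`. -/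
def graphB (lam : ℝ) : Set (Γ.L2 × Γ.L2) :=
  {p | ∃ h g : E3 → ℂ, (∃ K, LipschitzOnWith K h Γ.carrier) ∧
    (∀ x ∈ Γ.carrier, Tendsto (Γ.regularized lam h x) (𝓝[>] 0) (𝓝 (g x))) ∧
    p.1 =ᵐ[Γ.arcLength] h ∧ p.2 =ᵐ[Γ.arcLength] g}

/-- The graph of the closure of `B_lam`. -/
def graphBClosure (lam : ℝ) : Set (Γ.L2 × Γ.L2) := closure (Γ.graphB lam)

/-- `g` is the restriction to `Σ` of the continuous representative of `u`. -/
def IsRestriction (u : L2R3) (g : Γ.L2) : Prop :=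
  ∃ w : E3 → ℂ, Continuous w ∧ u =ᵐ[volume] w ∧ g =ᵐ[Γ.arcLength] w

/-- `u = u_c + γ_lam h` with `u_c ∈ H²(ℝ³)` and `h` in the domain of the closure of `B_lam`, and
`τ` is the generalized trace of `u` on `Σ`, the sum of the restriction of `u_c` and of the image
`b` of `h` under the closure of `B_lam`. -/
def IsGenTrace (lam : ℝ) (u : L2R3) (τ : Γ.L2) : Prop :=
  ∃ (uc v : L2R3) (h g b : Γ.L2), MemH2 uc ∧ Γ.IsGamma lam h v ∧ u = uc + v ∧
    (h, b) ∈ Γ.graphBClosure lam ∧ Γ.IsRestriction uc g ∧ τ = g + b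

/-- The graph of the Schrödinger operator with δ-interaction of strength `1/α` on `Σ`: the pairs
`(u, f)` with `u = u_c + γ_lam h` as above and `-Δu - α⁻¹ u|_Σ δ_Σ = f ∈ L²(ℝ³)`. The auxiliary
number `lam < 0` may be chosen arbitrarily. -/
def schrodingerGraph (lam α : ℝ) : Set (L2R3 × L2R3) :=
  {p | ∃ τ : Γ.L2, Γ.IsGenTrace lam p.1 τ ∧
    -Δ (toDist p.1) - ((1 / α : ℝ) : ℂ) • Γ.deltaDist τ = toDist p.2}

end ClosedCurve

end DeltaCurve

end

/-! By a min-max argument, an operator with norm at most `t` on a subspace of codimension `2n` has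
`s_k ≤ t` for every `k > 2n`. So it suffices to find, for large `n`, a subspace of codimension at
most `2n` on which the resolvent difference `D = R - R₀` is `O(1 / (n² log n))`.

For given `f` write `R f = u_c + γ h`. An `L²` function cannot carry a nonzero density on the null
set `Σ`. Comparing the singular parts in the eigenvalue-type equation therefore forces the
generalized trace to be `α h`, that is `α h = u_c|_Σ + B h`. It also gives `D f = γ h + (z - lam) R₀
γ h`, and shows that `h` depends linearly on `f`. Divide `Σ` into `n` arcs of equal length and
require that the moments of order zero and one of `h` over each arc vanish. These are `2n` linear
conditions on `f`, and they have three consequences.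

(1) `‖γ h‖ ≤ C ‖h‖ / n`. The norm of `γ h` is a weighted `L²` norm of the Fourier transform of `h
δ_Σ` with weight of order `|ξ|⁻⁴`. The Gaussian averages of `|(h δ_Σ)^|²` at scale `t` are `O(‖h‖² /
t)`, because `Σ` has codimension two. Directly, this controls the frequencies `|ξ| > n`. For `|ξ| ≤
n` two integrations by parts on each arc replace `h` by a second primitive of norm `O(n⁻²) ‖h‖`, at
the cost of a factor of size `|ξ|² + |ξ|`, which the symbol absorbs.

(2) `|⟨h, u_c|_Σ⟩| ≤ C ‖h‖ ‖f‖ / n`, the dual form of the same estimate.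

(3) `Re ⟨h, B h⟩ ≤ (C - c log n) ‖h‖²`. On Lipschitz functions the form of `B` is at most a bounded
potential minus the energy of the Green kernel. That energy dominates a logarithmic energy truncated
at the arc length `L / n`, which is at least `2 log n ‖h‖²` up to `O(‖h‖²)` and terms in the
averages over the arcs.

Pairing `α h = u_c|_Σ + B h` with `h` gives `(c log n - C + α) ‖h‖² ≤ C' ‖h‖ ‖f‖ / n`, hence `‖h‖ =
O(‖f‖ / (n log n))`. One more factor `1 / n` comes from (1). The main carriers are
`exists_linearMap`, `exists_norm_le_of_isGamma`, `exists_norm_inner_le_of_isRestriction`,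
`exists_re_inner_le` and `exists_norm_resolvent_sub_le`. -/

namespace DeltaCurve

/-! ### Singular values and subspaces of finite codimension -/

section MinMax

variable {H : Type*} [NormedAddCommGroup H] [InnerProductSpace ℂ H] [CompleteSpace H]

/-- On the span of the eigenvectors of `T⋆T` with eigenvalues larger than `t ^ 2`, the operator `T`
is bounded below by `t`. -/
theorem norm_lt_norm_apply_of_mem_iSup_eigenspace (T : H →L[ℂ] H) {t : ℝ} (ht : 0 ≤ t) {w : H}
    (hw : w ∈ (⨆ c ∈ Set.Ioi t, Module.End.eigenspace
      ((ContinuousLinearMap.adjoint T ∘L T : H →L[ℂ] H) : H →ₗ[ℂ] H) (((c ^ 2 : ℝ)) : ℂ) :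
        Submodule ℂ H)) (hw0 : w ≠ 0) :
    t * ‖w‖ < ‖T w‖ := by
  set A : H →L[ℂ] H := ContinuousLinearMap.adjoint T ∘L T with hA
  have hsymm : (A : H →ₗ[ℂ] H).IsSymmetric := by
    intro x y
    simp [hA, ContinuousLinearMap.adjoint_inner_left, ContinuousLinearMap.adjoint_inner_right]
  -- Since `t ≥ 0`, distinct `c > t` give distinct eigenvalues `c²`, so the eigenspaces are mutually
  -- orthogonal and both norms can be computed by Pythagoras.
  have hinj : Function.Injective (fun c : Set.Ioi t => (((c : ℝ) ^ 2 : ℝ) : ℂ)) := by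
    rintro ⟨a, ha⟩ ⟨b, hb⟩ hab
    have ha' : (0 : ℝ) ≤ a := ht.trans (le_of_lt ha)
    have hb' : (0 : ℝ) ≤ b := ht.trans (le_of_lt hb)
    have : a ^ 2 = b ^ 2 := by simpa using (Complex.ofReal_injective hab)
    exact Subtype.ext ((pow_left_inj₀ ha' hb' two_ne_zero).1 this)
  have horth := hsymm.orthogonalFamily_eigenspaces.comp hinj
  rw [iSup_subtype', Submodule.mem_iSup_iff_exists_finsupp] at hw
  obtain ⟨f, hf, rfl⟩ := hw
  let l : ∀ c : Set.Ioi t, Module.End.eigenspace (A : H →ₗ[ℂ] H) (((c : ℝ) ^ 2 : ℝ) : ℂ) :=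
    fun c => ⟨f c, hf c⟩
  have hsum : (f.sum fun _ x => x) = ∑ c ∈ f.support, (f c) := rfl
  have hnorm : ‖f.sum fun _ x => x‖ ^ 2 = ∑ c ∈ f.support, ‖f c‖ ^ 2 :=
    horth.norm_sum l f.support
  have hTnorm : ‖T (f.sum fun _ x => x)‖ ^ 2 = ∑ c ∈ f.support, (c : ℝ) ^ 2 * ‖f c‖ ^ 2 := by
    have h1 : ‖T (f.sum fun _ x => x)‖ ^ 2
        = RCLike.re (inner ℂ (A (f.sum fun _ x => x)) (f.sum fun _ x => x)) := by
      simp [hA, ContinuousLinearMap.adjoint_inner_left, inner_self_eq_norm_sq_to_K]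
      norm_cast
    have h2 : A (f.sum fun _ x => x)
        = ∑ c ∈ f.support, ((((c : ℝ) ^ 2 : ℝ) : ℂ) • l c : H) := by
      rw [hsum, map_sum]
      refine Finset.sum_congr rfl fun c _ => ?_
      exact Module.End.mem_eigenspace_iff.1 (hf c)
    have h3 := horth.inner_sum (fun c => (((c : ℝ) ^ 2 : ℝ) : ℂ) • l c) l f.support
    rw [h1, h2, hsum]
    have h4 : inner ℂ (∑ c ∈ f.support, ((((c : ℝ) ^ 2 : ℝ) : ℂ) • l c : H))
        (∑ c ∈ f.support, f c)
        = ∑ c ∈ f.support, inner ℂ ((((c : ℝ) ^ 2 : ℝ) : ℂ) • l c) (l c) := h3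
    rw [h4, map_sum]
    refine Finset.sum_congr rfl fun c _ => ?_
    rw [inner_smul_left, Complex.conj_ofReal, inner_self_eq_norm_sq_to_K]
    have : ‖l c‖ = ‖f c‖ := rfl
    rw [this]
    simp [← Complex.ofReal_pow]
  refine lt_of_pow_lt_pow_left₀ 2 (norm_nonneg _) ?_
  rw [mul_pow, hnorm, hTnorm, Finset.mul_sum]
  have hne : f.support.Nonempty := by
    rw [Finsupp.support_nonempty_iff]
    rintro rfl
    simp at hw0
  refine Finset.sum_lt_sum_of_nonempty hne fun c hc => ?_
  have h0 : 0 < ‖f c‖ := norm_pos_iff.2 (Finsupp.mem_support_iff.1 hc)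
  have : t < c := c.2
  gcongr

/-- The span of the eigenvectors above `t` meets `ker Φ` only in zero, since `T` is bounded by `t`
on one and exceeds `t` on the other. Hence `Φ` embeds that span into `ℂ^m`. Neither compactness of
`T` nor continuity of `Φ` is needed. -/
theorem singularCount_le (T : H →L[ℂ] H) {t : ℝ} (ht : 0 ≤ t) {m : ℕ}
    (Φ : H →ₗ[ℂ] (Fin m → ℂ)) (h : ∀ f, Φ f = 0 → ‖T f‖ ≤ t * ‖f‖) :
    singularCount T t ≤ m := by
  unfold singularCount
  set W : Submodule ℂ H := (⨆ c ∈ Set.Ioi t, Module.End.eigenspace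
      ((ContinuousLinearMap.adjoint T ∘L T : H →L[ℂ] H) : H →ₗ[ℂ] H) (((c ^ 2 : ℝ)) : ℂ)) with hW
  have hinj : Function.Injective (Φ ∘ₗ W.subtype) := by
    rw [← LinearMap.ker_eq_bot, LinearMap.ker_eq_bot']
    rintro ⟨w, hw⟩ hΦ
    by_contra hne
    have hw0 : w ≠ 0 := fun h0 => hne (Subtype.ext h0)
    exact absurd (h w hΦ) (not_le.2 (norm_lt_norm_apply_of_mem_iSup_eigenspace T ht hw hw0))
  have := LinearMap.lift_rank_le_of_injective _ hinj
  simpa using this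

theorem singularValue_nonneg (T : H →L[ℂ] H) (k : ℕ) : 0 ≤ singularValue T k :=
  Real.sInf_nonneg fun _ ht => ht.1

theorem singularValue_le (T : H →L[ℂ] H) {t : ℝ} (ht : 0 ≤ t) {m k : ℕ} (hmk : m < k)
    (Φ : H →ₗ[ℂ] (Fin m → ℂ)) (h : ∀ f, Φ f = 0 → ‖T f‖ ≤ t * ‖f‖) :
    singularValue T k ≤ t :=
  csInf_le ⟨0, fun _ hs => hs.1⟩
    ⟨ht, (singularCount_le T ht Φ h).trans_lt (by exact_mod_cast hmk)⟩

/-- An operator that is arbitrarily small on subspaces of finite codimension is compact. -/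
theorem isCompactOperator_of_small_on_ker (T : H →L[ℂ] H)
    (h : ∀ ε > 0, ∃ (m : ℕ) (Φ : H →ₗ[ℂ] (Fin m → ℂ)), ∀ f, Φ f = 0 → ‖T f‖ ≤ ε * ‖f‖) :
    IsCompactOperator T := by
  have key : T ∈ closure {S : H →L[ℂ] H | IsCompactOperator S} := by
    rw [Metric.mem_closure_iff]
    intro ε hε
    obtain ⟨m, Φ, hΦ⟩ := h (ε / 2) (half_pos hε)
    -- `Φ` need not be continuous, so its kernel is replaced by the closure, to which the bound
    -- extends. The orthogonal complement is finite-dimensional because `Φ` is injective on it.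
    set K : Submodule ℂ H := (LinearMap.ker Φ).topologicalClosure with hK
    have hKT : ∀ f ∈ K, ‖T f‖ ≤ ε / 2 * ‖f‖ := by
      intro f hf
      have hcl : IsClosed {f : H | ‖T f‖ ≤ ε / 2 * ‖f‖} :=
        isClosed_le (by fun_prop) (by fun_prop)
      exact closure_minimal (fun g hg => hΦ g hg) hcl hf
    have : CompleteSpace K := (Submodule.isClosed_topologicalClosure _).completeSpace_coe
    have hfin : FiniteDimensional ℂ Kᗮ := by
      refine FiniteDimensional.of_injective (Φ ∘ₗ Kᗮ.subtype) ?_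
      rw [← LinearMap.ker_eq_bot, LinearMap.ker_eq_bot']
      rintro ⟨w, hw⟩ hw'
      have h1 : w ∈ K := Submodule.le_topologicalClosure _ hw'
      have := Submodule.inner_right_of_mem_orthogonal h1 hw
      exact Subtype.ext (inner_self_eq_zero.1 this)
    -- This finite rank operator differs from `T` by `T` composed with the projection onto `K`,
    -- where `T` is small.
    refine ⟨T ∘L Kᗮ.starProjection, ?_, ?_⟩
    · have h1 : IsCompactOperator (Kᗮ.subtypeL : Kᗮ →L[ℂ] H) := by
        have : IsCompactOperator (ContinuousLinearMap.id ℂ Kᗮ) :=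
          ⟨Metric.closedBall 0 1, isCompact_closedBall _ _, by
            simpa using Metric.closedBall_mem_nhds (0 : Kᗮ) one_pos⟩
        simpa using this.clm_comp (Kᗮ.subtypeL)
      exact (h1.comp_clm (Kᗮ.orthogonalProjectionOnto)).clm_comp T
    · rw [dist_eq_norm]
      refine lt_of_le_of_lt (ContinuousLinearMap.opNorm_le_bound _ (half_pos hε).le fun f => ?_)
        (half_lt_self hε)
      have h2 : (T - T ∘L Kᗮ.starProjection) f = T (K.starProjection f) := by
        rw [Submodule.starProjection_orthogonal]
        simp
      rw [h2]
      refine (hKT _ (Submodule.starProjection_apply_mem _ _)).trans ?_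
      gcongr
      exact K.norm_starProjection_apply_le f
  rwa [(isClosed_setOfPred_isCompactOperator).closure_eq] at key

theorem isCompactOperator_and_isBigO_and_memSchatten (T : H →L[ℂ] H) {C : ℝ} {N : ℕ} (hC : 0 ≤ C)
    (h : ∀ n : ℕ, N ≤ n → ∃ Φ : H →ₗ[ℂ] (Fin (2 * n) → ℂ), ∀ f, Φ f = 0 →
      ‖T f‖ ≤ C / ((n : ℝ) ^ 2 * Real.log n) * ‖f‖) :
    IsCompactOperator T ∧
    (fun k : ℕ => singularValue T k) =O[atTop] (fun k : ℕ => 1 / ((k : ℝ) ^ 2 * Real.log k)) ∧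
    ∀ p : ℝ, 1 / 2 < p → MemSchatten p T := by
  have hcomp : IsCompactOperator T := by
    refine isCompactOperator_of_small_on_ker T fun ε hε => ?_
    have hlim : Tendsto (fun n : ℕ => C / ((n : ℝ) ^ 2 * Real.log n)) atTop (𝓝 0) := by
      refine Tendsto.const_div_atTop ?_ _
      exact ((tendsto_pow_atTop two_ne_zero).comp tendsto_natCast_atTop_atTop).atTop_mul_atTop₀
        (Real.tendsto_log_atTop.comp tendsto_natCast_atTop_atTop)
    obtain ⟨n, hn, hn'⟩ := ((hlim.eventually_lt_const hε).and (eventually_ge_atTop N)).exists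
    obtain ⟨Φ, hΦ⟩ := h n hn'
    exact ⟨_, Φ, fun f hf => (hΦ f hf).trans (by gcongr)⟩
  have hO : (fun k : ℕ => singularValue T k)
      =O[atTop] (fun k : ℕ => 1 / ((k : ℝ) ^ 2 * Real.log k)) := by
    -- The factor is `4² · 2`, from `k ≤ 4n` and `log k ≤ 2 log n`.
    refine IsBigO.of_bound (32 * C) ?_
    filter_upwards [eventually_ge_atTop (4 * N + 16)] with k hk
    rw [Real.norm_of_nonneg (singularValue_nonneg T k)]
    -- The largest `n` with `2n < k`, as the `2n` conditions control `s_k` only for `k > 2n`. The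
    -- lower bound on `k` gives `n ≥ N` and `n ≥ 4`, whence `k ≤ 4n ≤ n²`.
    obtain ⟨n, hn⟩ : ∃ n : ℕ, k = 2 * n + 1 ∨ k = 2 * n + 2 := ⟨(k - 1) / 2, by omega⟩
    have hnN : N ≤ n := by omega
    obtain ⟨Φ, hΦ⟩ := h n hnN
    have hn4 : (4 : ℝ) ≤ n := by exact_mod_cast (by omega : 4 ≤ n)
    have hkn : (k : ℝ) ≤ 4 * n := by exact_mod_cast (by omega : k ≤ 4 * n)
    have hk1 : (1 : ℝ) < k := by exact_mod_cast (by omega : 1 < k)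
    have hlogn : 0 < Real.log n := Real.log_pos (by linarith)
    have hlogk : 0 < Real.log k := Real.log_pos hk1
    have hlog : Real.log k ≤ 2 * Real.log n := by
      rw [← Real.log_rpow (by linarith)]
      refine Real.log_le_log (by linarith) ?_
      norm_num
      nlinarith
    refine (singularValue_le T (by positivity) (by omega) Φ hΦ).trans ?_
    rw [Real.norm_of_nonneg (by positivity), ← mul_div_assoc, mul_one,
      div_le_div_iff₀ (by positivity) (by positivity)]
    have : (k : ℝ) ^ 2 * Real.log k ≤ (4 * n) ^ 2 * (2 * Real.log n) := by gcongr
    nlinarith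
  refine ⟨hcomp, hO, fun p hp => ⟨hcomp, ?_⟩⟩
  rw [summable_nat_add_iff (f := fun k : ℕ => singularValue T k ^ p) 1]
  -- For summability the logarithm is not needed and is dropped, since `log k ≥ 1` for `k ≥ 3`. Then
  -- `p > 1/2` makes the sum of `k^(-2p)` finite.
  have hO2 : (fun k : ℕ => singularValue T k) =O[atTop] (fun k : ℕ => (k : ℝ) ^ (-2 : ℝ)) := by
    refine hO.trans (IsBigO.of_bound 1 ?_)
    filter_upwards [eventually_ge_atTop 3] with k hk
    have hk3 : (3 : ℝ) ≤ k := by exact_mod_cast hk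
    have hlog : 1 ≤ Real.log k := by
      rw [Real.le_log_iff_exp_le (by linarith)]
      exact (Real.exp_one_lt_d9.le.trans (by norm_num)).trans hk3
    rw [Real.rpow_neg (by positivity), Real.norm_of_nonneg (by positivity),
      Real.norm_of_nonneg (by positivity), one_mul, one_div,
      Real.rpow_two]
    exact inv_anti₀ (by positivity) (le_mul_of_one_le_right (by positivity) hlog)
  have hp0 : 0 ≤ p := by linarith
  have hpos : 0 ≤ᶠ[atTop] fun k : ℕ => (k : ℝ) ^ (-2 : ℝ) :=
    Eventually.of_forall fun k => by
      show (0 : ℝ) ≤ (k : ℝ) ^ (-2 : ℝ)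
      positivity
  have := hO2.rpow hp0 hpos
  refine summable_of_isBigO_nat (g := fun k : ℕ => (k : ℝ) ^ (-2 * p)) ?_ ?_
  · exact Real.summable_nat_rpow.2 (by linarith)
  · refine this.congr_right fun k => ?_
    rw [← Real.rpow_mul (by positivity)]

end MinMax

namespace ClosedCurve

variable (Γ : ClosedCurve)

/-! ### Regularity and measure-theoretic properties of the curve -/

theorem continuous_σ : Continuous Γ.σ := Γ.contDiff.continuous

theorem differentiable_σ : Differentiable ℝ Γ.σ := Γ.contDiff.differentiable two_ne_zero

theorem measurable_σ : Measurable Γ.σ := Γ.continuous_σ.measurable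

theorem contDiff_deriv_σ : ContDiff ℝ 1 (deriv Γ.σ) :=
  (contDiff_succ_iff_deriv.1 (by simpa [one_add_one_eq_two] using Γ.contDiff)).2.2

theorem continuous_deriv_σ : Continuous (deriv Γ.σ) := Γ.contDiff_deriv_σ.continuous

theorem continuous_deriv_deriv_σ : Continuous (deriv (deriv Γ.σ)) :=
  (contDiff_one_iff_deriv.1 Γ.contDiff_deriv_σ).2

theorem periodic_deriv {f : ℝ → E3} {c : ℝ} (hf : Function.Periodic f c) :
    Function.Periodic (deriv f) c := fun x => by
  rw [← deriv_comp_add_const, hf.funext]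

theorem norm_σ_sub_le (s t : ℝ) : ‖Γ.σ s - Γ.σ t‖ ≤ |s - t| := by
  simpa using convex_univ.norm_image_sub_le_of_norm_deriv_le (f := Γ.σ) (C := 1)
    (fun x _ => Γ.differentiable_σ x) (fun x _ => (Γ.unit_speed x).le) (Set.mem_univ t)
    (Set.mem_univ s)

theorem exists_norm_deriv_deriv_le : ∃ K : ℝ, 1 ≤ K ∧ ∀ s, ‖deriv (deriv Γ.σ) s‖ ≤ K := by
  obtain ⟨K, hK⟩ := (isCompact_Icc (a := 0) (b := Γ.L)).exists_bound_of_continuousOn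
    Γ.continuous_deriv_deriv_σ.continuousOn
  refine ⟨max K 1, le_max_right _ _, fun s => ?_⟩
  obtain ⟨y, hy, hsy⟩ := (periodic_deriv (periodic_deriv Γ.periodic)).exists_mem_Ico₀ Γ.L_pos s
  rw [hsy]
  exact (hK y (Set.Ico_subset_Icc_self hy)).trans (le_max_left _ _)

theorem σ_ne {s t : ℝ} (hst : s ≠ t) (h : |s - t| < Γ.L) : Γ.σ s ≠ Γ.σ t := by
  intro heq
  have hL := Γ.L_pos
  obtain ⟨m, hm, -⟩ := existsUnique_sub_zsmul_mem_Ico hL s 0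
  obtain ⟨k, hk, -⟩ := existsUnique_sub_zsmul_mem_Ico hL t 0
  rw [zero_add] at hm hk
  have h1 : s - m • Γ.L = t - k • Γ.L := by
    refine Γ.injOn hm hk ?_
    rw [Γ.periodic.sub_zsmul_eq, Γ.periodic.sub_zsmul_eq, heq]
  have h2 : s - t = ((m - k : ℤ) : ℝ) * Γ.L := by
    simp only [zsmul_eq_mul] at h1
    push_cast
    linarith
  rw [h2, abs_mul, abs_of_pos hL] at h
  have h3 : |((m - k : ℤ) : ℝ)| < 1 := by
    by_contra hcon
    nlinarith
  have h4 : m - k = 0 := by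
    rw [← Int.abs_lt_one_iff]
    exact_mod_cast h3
  rw [h4] at h2
  simp at h2
  exact hst (by linarith)

/-- Near the diagonal, the chord is as long as the arc up to a term of third order. -/
theorem mul_sub_le_norm_σ_sub {K : ℝ} (hK0 : 0 ≤ K) (hK : ∀ s, ‖deriv (deriv Γ.σ) s‖ ≤ K)
    {s t : ℝ} (hst : s ≤ t) :
    (1 - K ^ 2 * (t - s) ^ 2 / 2) * (t - s) ≤ ‖Γ.σ t - Γ.σ s‖ := by
  have hlip : ∀ x y, ‖deriv Γ.σ y - deriv Γ.σ x‖ ≤ K * ‖y - x‖ := fun x y =>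
    convex_univ.norm_image_sub_le_of_norm_deriv_le (f := deriv Γ.σ) (C := K)
      (fun x _ => (Γ.contDiff_deriv_σ.differentiable one_ne_zero) x) (fun x _ => hK x)
      (Set.mem_univ x) (Set.mem_univ y)
  have hd : ∀ x, HasDerivAt (fun x => inner ℝ (Γ.σ x) (deriv Γ.σ s))
      (inner ℝ (deriv Γ.σ x) (deriv Γ.σ s)) x := fun x => by
    simpa using (Γ.differentiable_σ x).hasDerivAt.inner ℝ (hasDerivAt_const x (deriv Γ.σ s))
  -- The chord is projected onto the tangent at `s`. For unit vectors, `⟨σ'(x), σ'(s)⟩ = 1 - ‖σ'(x)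
  -- - σ'(s)‖² / 2`, and `σ'` is `K`-Lipschitz.
  have key := (convex_Icc s t).mul_sub_le_image_sub_of_le_deriv
    (f := fun x => inner ℝ (Γ.σ x) (deriv Γ.σ s)) (C := 1 - K ^ 2 * (t - s) ^ 2 / 2)
    (fun x _ => (hd x).continuousAt.continuousWithinAt)
    (fun x _ => (hd x).differentiableAt.differentiableWithinAt)
    (fun x hx => by
      rw [interior_Icc] at hx
      rw [(hd x).deriv]
      have h1 := norm_sub_sq_real (deriv Γ.σ x) (deriv Γ.σ s)
      rw [Γ.unit_speed, Γ.unit_speed] at h1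
      have h2 : ‖deriv Γ.σ x - deriv Γ.σ s‖ ≤ K * (t - s) := by
        refine (hlip s x).trans ?_
        rw [Real.norm_of_nonneg (by linarith [hx.1])]
        gcongr
        exact hx.2.le
      have h3 : ‖deriv Γ.σ x - deriv Γ.σ s‖ ^ 2 ≤ (K * (t - s)) ^ 2 := by gcongr
      nlinarith) s (Set.left_mem_Icc.2 hst) t (Set.right_mem_Icc.2 hst) hst
  refine key.trans ?_
  rw [← inner_sub_left]
  refine (real_inner_le_norm _ _).trans ?_
  rw [Γ.unit_speed, mul_one]

/-- Comparison of the reciprocals of the chord and of the arc. -/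
theorem exists_inv_norm_σ_sub_le : ∃ C : ℝ, 0 ≤ C ∧ ∀ s t : ℝ, s ≠ t → |s - t| ≤ Γ.L / 2 →
    ‖Γ.σ s - Γ.σ t‖⁻¹ ≤ |s - t|⁻¹ + C := by
  obtain ⟨K, hK1, hK⟩ := Γ.exists_norm_deriv_deriv_le
  have hL := Γ.L_pos
  have hK0 : 0 < K := by linarith
  -- Away from the diagonal, at arc distances in `[1/K, L/2]`, compactness and the absence of
  -- self-intersections bound the chord below by some `c > 0`.
  obtain ⟨c, hc0, hc⟩ := ((isCompact_Icc (a := (0 : ℝ)) (b := Γ.L)).prod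
    (isCompact_Icc (a := K⁻¹) (b := Γ.L / 2))).exists_forall_le'
    (f := fun p : ℝ × ℝ => ‖Γ.σ (p.1 + p.2) - Γ.σ p.1‖) (a := 0)
    (by have := Γ.continuous_σ; fun_prop)
    (by
      rintro ⟨s, r⟩ ⟨-, hr⟩
      have hr0 : 0 < r := (inv_pos.2 hK0).trans_le hr.1
      have hrL : r ≤ Γ.L / 2 := hr.2
      refine norm_pos_iff.2 (sub_ne_zero.2 (Γ.σ_ne ?_ ?_))
      · dsimp only
        linarith
      · simp only [add_sub_cancel_left]
        rw [abs_of_pos hr0]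
        linarith)
  have main : ∀ s t : ℝ, s < t → t - s ≤ Γ.L / 2 →
      ‖Γ.σ t - Γ.σ s‖⁻¹ ≤ (t - s)⁻¹ + (K + c⁻¹) := by
    intro s t hst hle
    have hd : 0 < t - s := by linarith
    by_cases hnear : K * (t - s) ≤ 1
    · have h1 := Γ.mul_sub_le_norm_σ_sub hK0.le hK hst.le
      have h2 : K ^ 2 * (t - s) ^ 2 ≤ K * (t - s) := by
        rw [← mul_pow, sq]
        exact mul_le_of_le_one_left (by positivity) hnear
      have h3 : 0 < (1 - K ^ 2 * (t - s) ^ 2 / 2) * (t - s) := mul_pos (by linarith) hd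
      refine (inv_anti₀ h3 h1).trans ?_
      have h4 : ((1 - K ^ 2 * (t - s) ^ 2 / 2) * (t - s))⁻¹ ≤ (t - s)⁻¹ + K := by
        rw [inv_le_iff_one_le_mul₀ h3]
        have h5 : (t - s)⁻¹ * (t - s) = 1 := inv_mul_cancel₀ hd.ne'
        have h6 : ((t - s)⁻¹ + K) * ((1 - K ^ 2 * (t - s) ^ 2 / 2) * (t - s))
            = (1 + K * (t - s)) * (1 - K ^ 2 * (t - s) ^ 2 / 2) := by
          linear_combination (1 - K ^ 2 * (t - s) ^ 2 / 2) * h5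
        rw [h6]
        -- What remains is `(1 + x)(1 - x²/2) ≥ 1` for `0 ≤ x ≤ 1`; the excess over one is `x (1 -
        -- x)(2 + x) / 2`.
        set x := K * (t - s) with hx
        have hx0 : 0 ≤ x := by positivity
        have : K ^ 2 * (t - s) ^ 2 = x ^ 2 := by rw [hx, mul_pow]
        rw [this]
        nlinarith [mul_nonneg hx0 (sub_nonneg.2 hnear), mul_nonneg hx0 hx0,
          mul_nonneg (mul_nonneg hx0 hx0) (sub_nonneg.2 hnear)]
      linarith [inv_pos.2 hc0]
    -- A shift by whole periods brings the base point into the compact set on which `c` was chosen.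
    · obtain ⟨m, hm, -⟩ := existsUnique_sub_zsmul_mem_Ico hL s 0
      rw [zero_add] at hm
      have h1 := hc (s - m • Γ.L, t - s) ⟨Set.Ico_subset_Icc_self hm, ?_, hle⟩
      · have h2 : s - m • Γ.L + (t - s) = t - m • Γ.L := by ring
        simp only [h2, Γ.periodic.sub_zsmul_eq] at h1
        have := inv_anti₀ hc0 h1
        linarith [inv_pos.2 hd]
      · rw [inv_le_iff_one_le_mul₀ hK0]
        linarith
  refine ⟨K + c⁻¹, by positivity, fun s t hst hle => ?_⟩
  rcases lt_or_gt_of_ne hst with h | h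
  · rw [norm_sub_rev, abs_sub_comm, abs_of_pos (by linarith)]
    rw [abs_sub_comm, abs_of_pos (by linarith)] at hle
    exact main s t h hle
  · rw [abs_of_pos (by linarith)]
    rw [abs_of_pos (by linarith)] at hle
    exact main t s h hle

/-- The curve is bi-Lipschitz to the circle. -/
theorem exists_mul_abs_le_norm_σ_sub : ∃ c : ℝ, 0 < c ∧ ∀ s t : ℝ, |s - t| ≤ Γ.L / 2 →
    c * |s - t| ≤ ‖Γ.σ s - Γ.σ t‖ := by
  obtain ⟨C, hC0, hC⟩ := Γ.exists_inv_norm_σ_sub_le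
  have hL := Γ.L_pos
  have hpos : 0 < 1 + C * Γ.L := by positivity
  refine ⟨(1 + C * Γ.L)⁻¹, by positivity, fun s t hle => ?_⟩
  by_cases hst : s = t
  · simp [hst]
  have hd : 0 < |s - t| := abs_pos.2 (sub_ne_zero.2 hst)
  have hn : 0 < ‖Γ.σ s - Γ.σ t‖ := norm_pos_iff.2 (sub_ne_zero.2 (Γ.σ_ne hst (by linarith)))
  have h := hC s t hst hle
  rw [inv_le_iff_one_le_mul₀ hn] at h
  rw [inv_mul_le_iff₀ hpos]
  have h1 : (|s - t|⁻¹ + C) * |s - t| = 1 + C * |s - t| := by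
    rw [add_mul, inv_mul_cancel₀ hd.ne']
  have h2 : |s - t| * 1 ≤ |s - t| * ((|s - t|⁻¹ + C) * ‖Γ.σ s - Γ.σ t‖) := by gcongr
  have h3 : |s - t| * ((|s - t|⁻¹ + C) * ‖Γ.σ s - Γ.σ t‖)
      = (1 + C * |s - t|) * ‖Γ.σ s - Γ.σ t‖ := by rw [← h1]; ring
  have h4 : (1 + C * |s - t|) * ‖Γ.σ s - Γ.σ t‖ ≤ (1 + C * Γ.L) * ‖Γ.σ s - Γ.σ t‖ := by
    gcongr
    linarith
  linarith

theorem measurePreserving_σ :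
    MeasurePreserving Γ.σ (volume.restrict (Set.Ico 0 Γ.L)) Γ.arcLength :=
  ⟨Γ.measurable_σ, rfl⟩

/-- Any half-open interval of length `L` is a fundamental domain for the period group. This allows a
period to be centred at a given point, where chord and arc are comparable throughout. -/
theorem measurePreserving_σ_Ioc (a : ℝ) :
    MeasurePreserving Γ.σ (volume.restrict (Set.Ioc a (a + Γ.L))) Γ.arcLength := by
  refine ⟨Γ.measurable_σ, ?_⟩
  unfold arcLength
  rw [restrict_Ico_eq_restrict_Ioc]
  ext S hS
  rw [Measure.map_apply Γ.measurable_σ hS, Measure.map_apply Γ.measurable_σ hS,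
    Measure.restrict_apply (Γ.measurable_σ hS), Measure.restrict_apply (Γ.measurable_σ hS)]
  have h2 := isAddFundamentalDomain_Ioc Γ.L_pos 0
  rw [zero_add] at h2
  refine (isAddFundamentalDomain_Ioc Γ.L_pos a).measure_set_eq h2 (Γ.measurable_σ hS) fun g => ?_
  ext x
  simp only [Set.mem_preimage]
  rw [Γ.periodic.map_vadd_zmultiples]

theorem isCompact_carrier : IsCompact Γ.carrier := by
  have : Γ.carrier = Γ.σ '' Set.Icc 0 Γ.L := by
    rw [carrier, ← Γ.periodic.image_Icc Γ.L_pos 0, zero_add]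
  rw [this]
  exact isCompact_Icc.image Γ.continuous_σ

theorem measurableSet_carrier : MeasurableSet Γ.carrier :=
  Γ.isCompact_carrier.isClosed.measurableSet

/-- A `C¹` image of the line has Hausdorff dimension at most one, less than three. This makes `δ_Σ`
densities and `L²` functions mutually singular. -/
theorem volume_carrier : volume Γ.carrier = 0 := by
  have h1 : dimH Γ.carrier < ((3 : NNReal) : ℝ≥0∞) := by
    refine (ContDiff.dimH_range_le (Γ.contDiff.of_le (by norm_num))).trans_lt ?_
    rw [Module.finrank_self]
    norm_num
  have h2 := hausdorffMeasure_of_dimH_lt h1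
  have h3 : Measure.IsAddHaarMeasure (μH[((3 : NNReal) : ℝ)] : Measure E3) := by
    have := isAddHaarMeasure_hausdorffMeasure (E := E3)
    simpa using this
  exact Measure.absolutelyContinuous_isAddHaarMeasure volume (μH[((3 : NNReal) : ℝ)]) h2

theorem ae_mem_carrier : ∀ᵐ x ∂Γ.arcLength, x ∈ Γ.carrier := by
  rw [← Γ.measurePreserving_σ.map_eq]
  exact (ae_map_iff (p := fun x => x ∈ Γ.carrier) Γ.measurable_σ.aemeasurable
    Γ.measurableSet_carrier).2 (Eventually.of_forall fun s => ⟨s, rfl⟩)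

/-! ### Densities on the curve -/

theorem deltaDist_apply (h : Γ.L2) (φ : 𝓢(E3, ℂ)) :
    Γ.deltaDist h φ = ∫ x, φ x • h x ∂Γ.arcLength :=
  Lp.toTemperedDistribution_apply h φ

theorem _root_.DeltaCurve.toDist_apply (u : L2R3) (φ : 𝓢(E3, ℂ)) :
    toDist u φ = ∫ x, φ x • u x :=
  Lp.toTemperedDistribution_apply u φ

/-- A density on the curve and a locally integrable function that define the same functional on
smooth functions with compact support vanish. -/
theorem ae_eq_zero_of_integral_smul_eq {h F : E3 → ℂ} (hhint : Integrable h Γ.arcLength)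
    (hFloc : LocallyIntegrable F volume)
    (htest : ∀ g : E3 → ℝ, ContDiff ℝ (↑(⊤ : ℕ∞)) g → HasCompactSupport g →
      ∫ x, g x • h x ∂Γ.arcLength = ∫ x, g x • F x) :
    ∀ᵐ x ∂Γ.arcLength, h x = 0 := by
  classical
  -- A single function represents both data: `Σ` is null for volume and has full arc length measure,
  -- so `f` is `F` for the first and `-h` for the second. The fundamental lemma of the calculus of
  -- variations is then applied to the sum of the two measures.
  set f : E3 → ℂ := Γ.carrier.piecewise (fun x => -h x) F with hf
  have hf1 : f =ᵐ[volume] F := by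
    have : ∀ᵐ x : E3, x ∉ Γ.carrier := measure_eq_zero_iff_ae_notMem.1 Γ.volume_carrier
    filter_upwards [this] with x hx
    simp [hf, hx]
  have hf2 : f =ᵐ[Γ.arcLength] fun x => -h x := by
    filter_upwards [Γ.ae_mem_carrier] with x hx
    simp [hf, hx]
  have hInt : Integrable f Γ.arcLength := hhint.neg.congr hf2.symm
  have hloc1 : LocallyIntegrable f volume := by
    intro x
    obtain ⟨U, hU, hUF⟩ := hFloc x
    exact ⟨U, hU, Integrable.congr hUF (ae_restrict_of_ae hf1.symm)⟩
  have hloc : LocallyIntegrable f (volume + Γ.arcLength) := by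
    intro x
    obtain ⟨U, hU, hUF⟩ := hloc1 x
    refine ⟨U, hU, ?_⟩
    rw [IntegrableOn, Measure.restrict_add]
    exact Integrable.add_measure hUF (hInt.mono_measure Measure.restrict_le_self)
  have hzero := ae_eq_zero_of_integral_contDiff_smul_eq_zero hloc fun g hg hgs => by
    rw [integral_add_measure
      (hloc1.integrable_smul_left_of_hasCompactSupport hg.continuous hgs)
      (hInt.locallyIntegrable.integrable_smul_left_of_hasCompactSupport hg.continuous hgs)]
    have e1 : ∫ x, g x • f x = ∫ x, g x • F x := by
      refine integral_congr_ae ?_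
      filter_upwards [hf1] with x hx
      rw [hx]
    have e2 : ∫ x, g x • f x ∂Γ.arcLength = -∫ x, g x • h x ∂Γ.arcLength := by
      rw [← integral_neg]
      refine integral_congr_ae ?_
      filter_upwards [hf2] with x hx
      rw [hx, smul_neg]
    rw [e1, e2, htest g hg hgs, add_neg_cancel]
  have hz2 : ∀ᵐ x ∂Γ.arcLength, f x = 0 :=
    (Measure.absolutelyContinuous_of_le (Measure.le_add_left le_rfl)).ae_le hzero
  filter_upwards [hz2, hf2] with x h1 h2
  rw [h2] at h1
  simpa using h1

/-- A distribution `h δ_Σ` that is given by a square integrable function vanishes. -/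
theorem eq_zero_of_deltaDist_eq_toDist {h : Γ.L2} {F : L2R3} (hF : Γ.deltaDist h = toDist F) :
    h = 0 := by
  have hz := Γ.ae_eq_zero_of_integral_smul_eq (h := h) (F := F)
    ((Lp.memLp h).integrable (by norm_num)) ((Lp.memLp F).locallyIntegrable (by norm_num))
    (by
      intro g hg hgs
      have hgs' : HasCompactSupport (fun x => (g x : ℂ)) :=
        hgs.comp_left (g := fun y : ℝ => (y : ℂ)) Complex.ofReal_zero
      have hg' : ContDiff ℝ (↑(⊤ : ℕ∞)) (fun x => (g x : ℂ)) :=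
        Complex.ofRealCLM.contDiff.comp hg
      have h1 : Γ.deltaDist h (hgs'.toSchwartzMap hg') = toDist F (hgs'.toSchwartzMap hg') := by
        rw [hF]
      rw [deltaDist_apply, toDist_apply] at h1
      exact h1)
  refine Lp.ext ?_
  filter_upwards [hz, Lp.coeFn_zero ℂ 2 Γ.arcLength] with x h1 h3
  rw [h3, Pi.zero_apply, h1]

end ClosedCurve

/-! ### Cells of an interval and a logarithmic energy inequality -/

section Cells

/-- The index of the cell of mesh `a` that contains `t`. -/
noncomputable def cellIndex (a t : ℝ) : ℤ := ⌊t / a⌋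

/-- The left end point of the cell of mesh `a` that contains `t`. -/
noncomputable def cellLeft (a t : ℝ) : ℝ := cellIndex a t * a

/-- The `i`-th cell of mesh `a`. -/
def cell (a : ℝ) (i : ℕ) : Set ℝ := Set.Ico (i * a) ((i + 1) * a)

theorem measurableSet_cell (a : ℝ) (i : ℕ) : MeasurableSet (cell a i) := measurableSet_Ico

theorem mem_cell_iff {a : ℝ} (ha : 0 < a) (i : ℕ) (t : ℝ) :
    t ∈ cell a i ↔ cellIndex a t = i := by
  rw [cell, cellIndex, Int.floor_eq_iff, Set.mem_Ico, le_div_iff₀ ha, div_lt_iff₀ ha]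
  simp

theorem measurable_cellIndex (a : ℝ) : Measurable (cellIndex a) :=
  Int.measurable_floor.comp (measurable_id.div_const a)

theorem measurable_cellLeft (a : ℝ) : Measurable (cellLeft a) :=
  ((measurable_from_top (f := fun k : ℤ => (k : ℝ))).comp (measurable_cellIndex a)).mul_const a

theorem cellLeft_le {a : ℝ} (ha : 0 < a) (t : ℝ) : cellLeft a t ≤ t := by
  rw [cellLeft, ← le_div_iff₀ ha]
  exact Int.floor_le _

theorem lt_cellLeft_add {a : ℝ} (ha : 0 < a) (t : ℝ) : t < cellLeft a t + a := by
  have := Int.lt_floor_add_one (t / a)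
  rw [div_lt_iff₀ ha] at this
  rw [cellLeft, cellIndex]
  linarith

theorem iUnion_cell {a : ℝ} (ha : 0 < a) (n : ℕ) :
    ⋃ i : Fin n, cell a i = Set.Ico 0 (n * a) := by
  ext t
  simp only [Set.mem_iUnion, mem_cell_iff ha, Set.mem_Ico]
  constructor
  · rintro ⟨i, hi⟩
    rw [← mem_cell_iff ha] at hi
    refine ⟨(by positivity : (0 : ℝ) ≤ i * a).trans hi.1, hi.2.trans_le ?_⟩
    gcongr
    exact_mod_cast i.2
  · rintro ⟨h0, h1⟩
    have hk : 0 ≤ cellIndex a t := Int.floor_nonneg.2 (by positivity)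
    obtain ⟨k, hk'⟩ := Int.eq_ofNat_of_zero_le hk
    have hkn : k < n := by
      have h2 : (cellIndex a t : ℝ) ≤ t / a := Int.floor_le _
      rw [hk', le_div_iff₀ ha] at h2
      have h3 : (k : ℝ) * a < n * a := by
        push_cast at h2
        linarith
      exact_mod_cast lt_of_mul_lt_mul_right h3 ha.le
    exact ⟨⟨k, hkn⟩, hk'⟩

theorem pairwise_disjoint_cell {a : ℝ} (ha : 0 < a) (n : ℕ) :
    Pairwise (Function.onFun Disjoint fun i : Fin n => cell a i) := by
  intro i j hij
  refine Set.disjoint_left.2 fun t hi hj => hij ?_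
  rw [mem_cell_iff ha] at hi hj
  exact Fin.ext (by exact_mod_cast hi.symm.trans hj)

theorem integral_Ico_eq_sum_cell {E : Type*} [NormedAddCommGroup E] [NormedSpace ℝ E] {a L : ℝ}
    (ha : 0 < a) {n : ℕ} (hL : n * a = L) {f : ℝ → E}
    (hf : IntegrableOn f (Set.Ico 0 L)) :
    ∫ t in Set.Ico 0 L, f t = ∑ i : Fin n, ∫ t in cell a i, f t := by
  rw [← hL, ← iUnion_cell ha n] at hf ⊢
  exact integral_iUnion_fintype (fun i => measurableSet_cell a i) (pairwise_disjoint_cell ha n)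
    (fun i => hf.mono_set (Set.subset_iUnion (fun i : Fin n => cell a i) i))

theorem integral_comp_abs_sub {φ : ℝ → ℝ} (hφ : Continuous φ) (s x y : ℝ) (hx : x ≤ s)
    (hy : s ≤ y) :
    ∫ t in x..y, φ |t - s| = (∫ r in (0 : ℝ)..(s - x), φ r) + ∫ r in (0 : ℝ)..(y - s), φ r := by
  have hcont : Continuous fun t => φ |t - s| := by fun_prop
  rw [← intervalIntegral.integral_add_adjacent_intervals (hcont.intervalIntegrable x s)
    (hcont.intervalIntegrable s y)]
  congr 1
  · have h1 : ∫ t in x..s, φ |t - s| = ∫ t in x..s, φ (s - t) := by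
      refine intervalIntegral.integral_congr fun t ht => ?_
      rw [Set.uIcc_of_le hx] at ht
      rw [abs_sub_comm, abs_of_nonneg (by linarith [ht.2])]
    rw [h1, intervalIntegral.integral_comp_sub_left (fun r => φ r) s, sub_self]
  · have h1 : ∫ t in s..y, φ |t - s| = ∫ t in s..y, φ (t - s) := by
      refine intervalIntegral.integral_congr fun t ht => ?_
      rw [Set.uIcc_of_le hy] at ht
      rw [abs_of_nonneg (by linarith [ht.1])]
    rw [h1, intervalIntegral.integral_comp_sub_right (fun r => φ r) s, sub_self]

theorem integral_inv_add {a y : ℝ} (ha : 0 < a) (hy : 0 ≤ y) :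
    ∫ r in (0 : ℝ)..y, (|r| + a)⁻¹ = Real.log ((y + a) / a) := by
  have h1 : ∫ r in (0 : ℝ)..y, (|r| + a)⁻¹ = ∫ r in (0 : ℝ)..y, (r + a)⁻¹ := by
    refine intervalIntegral.integral_congr fun t ht => ?_
    rw [Set.uIcc_of_le hy] at ht
    rw [abs_of_nonneg ht.1]
  rw [h1, intervalIntegral.integral_comp_add_right (fun r => r⁻¹) a, zero_add,
    integral_inv_of_pos ha (by linarith)]

theorem integral_inv_add_sq_le {a y : ℝ} (ha : 0 < a) (hy : 0 ≤ y) :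
    ∫ r in (0 : ℝ)..y, ((|r| + a) ^ 2)⁻¹ ≤ a⁻¹ := by
  have h1 : ∫ r in (0 : ℝ)..y, ((|r| + a) ^ 2)⁻¹ = -(y + a)⁻¹ - -(0 + a)⁻¹ := by
    refine intervalIntegral.integral_eq_sub_of_hasDerivAt (f := fun r => -(r + a)⁻¹) ?_ ?_
    · intro t ht
      rw [Set.uIcc_of_le hy] at ht
      have h0 : t + a ≠ 0 := by linarith [ht.1]
      refine HasDerivAt.congr_deriv (f := fun r => -(r + a)⁻¹)
        (((hasDerivAt_id' t).add_const a).inv h0).neg ?_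
      rw [abs_of_nonneg ht.1, neg_div, neg_neg, one_div]
    · refine Continuous.intervalIntegrable ?_ _ _
      refine Continuous.inv₀ (by fun_prop) fun r => ?_
      positivity
  rw [h1, zero_add]
  have : 0 < (y + a)⁻¹ := by positivity
  linarith

theorem integrable_prod_of_continuous {E : Type*} [NormedAddCommGroup E] {L : ℝ}
    {F : ℝ × ℝ → E} (hF : Continuous F) :
    Integrable F ((volume.restrict (Set.Ico 0 L)).prod (volume.restrict (Set.Ico 0 L))) := by
  rw [Measure.prod_restrict]
  exact (hF.continuousOn.integrableOn_compact (isCompact_Icc.prod isCompact_Icc)).mono_set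
    (Set.prod_mono Set.Ico_subset_Icc_self Set.Ico_subset_Icc_self)

theorem integrable_Ico_of_continuous {E : Type*} [NormedAddCommGroup E] {L : ℝ}
    {F : ℝ → E} (hF : Continuous F) : Integrable F (volume.restrict (Set.Ico 0 L)) :=
  (hF.continuousOn.integrableOn_compact isCompact_Icc).mono_set Set.Ico_subset_Icc_self

/-- The kernel of the truncated logarithmic energy varies little inside a cell. -/
theorem abs_inv_sub_inv_cellLeft_le {a : ℝ} (ha : 0 < a) (s t : ℝ) :
    |(|s - t| + a)⁻¹ - (|s - cellLeft a t| + a)⁻¹| ≤ 2 * a * ((|s - t| + a) ^ 2)⁻¹ := by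
  have h1 := cellLeft_le ha t
  have h2 := lt_cellLeft_add ha t
  set u := |s - t| + a with hu
  set v := |s - cellLeft a t| + a with hv
  have hu0 : 0 < u := by positivity
  have hv0 : 0 < v := by positivity
  -- Moving `t` to the left end of its cell changes the distance by at most `a`. Since `v ≥ a`, this
  -- also gives `u ≤ 2v`, so the two kernels are comparable.
  have huv : |v - u| ≤ a := by
    have := abs_abs_sub_abs_le_abs_sub (s - cellLeft a t) (s - t)
    rw [hu, hv, add_sub_add_right_eq_sub]
    refine this.trans ?_
    rw [abs_le]
    constructor <;> linarith
  have hu2 : u ≤ 2 * v := by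
    have := (abs_le.1 huv).1
    have : a ≤ v := by rw [hv]; linarith [abs_nonneg (s - cellLeft a t)]
    linarith
  rw [inv_sub_inv hu0.ne' hv0.ne', abs_div, abs_of_pos (mul_pos hu0 hv0), ← div_eq_mul_inv,
    div_le_div_iff₀ (by positivity) (by positivity)]
  calc |v - u| * u ^ 2 ≤ a * (u * (2 * v)) := by
        rw [sq]
        gcongr
    _ = 2 * a * (u * v) := by ring

/-- At least one of the two sides of `s` has length `≥ L/2`, and it alone contributes `log (n/2 +
1)` or more. The other side contributes a nonnegative amount. -/
theorem log_le_integral_inv {L s : ℝ} (hs : s ∈ Set.Ico 0 L) {n : ℕ} (hn : 0 < n) :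
    Real.log n - Real.log 2 ≤ ∫ t in Set.Ico 0 L, (|s - t| + L / n)⁻¹ := by
  have hL : 0 < L := hs.1.trans_lt hs.2
  have hn0 : (0 : ℝ) < n := by exact_mod_cast hn
  have ha : 0 < L / n := by positivity
  have hcont : Continuous fun r : ℝ => (|r| + L / n)⁻¹ :=
    Continuous.inv₀ (by fun_prop) fun r => by positivity
  have h1 : ∫ t in Set.Ico 0 L, (|s - t| + L / n)⁻¹
      = ∫ t in (0 : ℝ)..L, (fun r : ℝ => (|r| + L / n)⁻¹) |t - s| := by
    rw [intervalIntegral.integral_of_le hL.le, integral_Ico_eq_integral_Ioc]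
    refine integral_congr_ae (Eventually.of_forall fun t => ?_)
    simp only [abs_abs, abs_sub_comm]
  rw [h1, integral_comp_abs_sub hcont s 0 L hs.1 hs.2.le, integral_inv_add ha (by linarith [hs.1]),
    integral_inv_add ha (by linarith [hs.2])]
  have key : ∀ y, L / 2 ≤ y → Real.log n - Real.log 2 ≤ Real.log ((y + L / n) / (L / n)) := by
    intro y hy
    rw [← Real.log_div hn0.ne' two_ne_zero]
    refine Real.log_le_log (by positivity) ?_
    rw [le_div_iff₀ ha]
    have : (n : ℝ) / 2 * (L / n) = L / 2 := by field_simp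
    linarith
  have hpos : ∀ y, 0 ≤ y → 0 ≤ Real.log ((y + L / n) / (L / n)) := by
    intro y hy
    refine Real.log_nonneg ?_
    rw [le_div_iff₀ ha]
    linarith
  rcases le_total (L / 2) s with h | h
  · have := key (s - 0) (by linarith)
    have := hpos (L - s) (by linarith [hs.2])
    linarith
  · have := key (L - s) (by linarith)
    have := hpos (s - 0) (by linarith [hs.1])
    linarith

/-- Each side of `s` contributes at most `2a · a⁻¹`. This is the row bound for the error made by
freezing the logarithmic kernel on cells. -/
theorem integral_mul_inv_sq_le {L s a : ℝ} (hs : s ∈ Set.Ico 0 L) (ha : 0 < a) :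
    ∫ t in Set.Ico 0 L, 2 * a * ((|s - t| + a) ^ 2)⁻¹ ≤ 4 := by
  have hL : 0 < L := hs.1.trans_lt hs.2
  have hcont : Continuous fun r : ℝ => ((|r| + a) ^ 2)⁻¹ :=
    Continuous.inv₀ (by fun_prop) fun r => by positivity
  have h1 : ∫ t in Set.Ico 0 L, ((|s - t| + a) ^ 2)⁻¹
      = ∫ t in (0 : ℝ)..L, (fun r : ℝ => ((|r| + a) ^ 2)⁻¹) |t - s| := by
    rw [intervalIntegral.integral_of_le hL.le, integral_Ico_eq_integral_Ioc]
    refine integral_congr_ae (Eventually.of_forall fun t => ?_)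
    simp only [abs_abs, abs_sub_comm]
  rw [integral_const_mul, h1, integral_comp_abs_sub hcont s 0 L hs.1 hs.2.le]
  have h2 := integral_inv_add_sq_le ha (by linarith [hs.1] : 0 ≤ s - 0)
  have h3 := integral_inv_add_sq_le ha (by linarith [hs.2] : 0 ≤ L - s)
  calc _ ≤ 2 * a * (a⁻¹ + a⁻¹) := by gcongr
    _ = 4 := by field_simp; norm_num

/-- A symmetric kernel with bounded row integrals acts boundedly. -/
theorem integral_norm_mul_norm_mul_le {L C : ℝ} {f : ℝ → ℂ}
    (hf : MemLp f 2 (volume.restrict (Set.Ico 0 L)))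
    {q : ℝ × ℝ → ℝ} (hq : Continuous q) (hq0 : ∀ p, 0 ≤ q p) (hsymm : ∀ s t, q (s, t) = q (t, s))
    (hC : ∀ s ∈ Set.Ico 0 L, ∫ t in Set.Ico 0 L, q (s, t) ≤ C) :
    Integrable (fun p => ‖f p.1‖ * ‖f p.2‖ * q p)
      ((volume.restrict (Set.Ico 0 L)).prod (volume.restrict (Set.Ico 0 L))) ∧
    ∫ p, ‖f p.1‖ * ‖f p.2‖ * q p
      ∂((volume.restrict (Set.Ico 0 L)).prod (volume.restrict (Set.Ico 0 L)))
      ≤ C * ∫ s in Set.Ico 0 L, ‖f s‖ ^ 2 := by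
  set ν : Measure ℝ := volume.restrict (Set.Ico 0 L) with hν
  have hf2 : Integrable (fun s => ‖f s‖ ^ 2) ν :=
    (memLp_two_iff_integrable_sq_norm hf.aestronglyMeasurable).1 hf
  have hf1 : Integrable (fun s => ‖f s‖) ν := (hf.integrable (by norm_num)).norm
  obtain ⟨B, hB⟩ := ((isCompact_Icc (a := 0) (b := L)).prod
    (isCompact_Icc (a := 0) (b := L))).exists_bound_of_continuousOn hq.continuousOn
  have hqB : ∀ᵐ p ∂(ν.prod ν), ‖q p‖ ≤ B := by
    rw [hν, Measure.prod_restrict]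
    filter_upwards [ae_restrict_mem (measurableSet_Ico.prod measurableSet_Ico)] with p hp
    exact hB p ⟨Set.Ico_subset_Icc_self hp.1, Set.Ico_subset_Icc_self hp.2⟩
  have hInt : Integrable (fun p : ℝ × ℝ => ‖f p.1‖ ^ 2 * q p) (ν.prod ν) :=
    (hf2.comp_fst ν).mul_bdd hq.aestronglyMeasurable hqB
  have hInt2 : Integrable (fun p : ℝ × ℝ => ‖f p.2‖ ^ 2 * q p) (ν.prod ν) :=
    (hf2.comp_snd ν).mul_bdd hq.aestronglyMeasurable hqB
  have hInt3 : Integrable (fun p : ℝ × ℝ => ‖f p.1‖ * ‖f p.2‖ * q p) (ν.prod ν) :=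
    (hf1.mul_prod hf1).mul_bdd hq.aestronglyMeasurable hqB
  have h1 : ∫ p, ‖f p.1‖ ^ 2 * q p ∂(ν.prod ν) ≤ C * ∫ s, ‖f s‖ ^ 2 ∂ν := by
    rw [integral_prod _ hInt, ← integral_const_mul]
    refine integral_mono_ae hInt.integral_prod_left (hf2.const_mul C) ?_
    filter_upwards [ae_restrict_mem measurableSet_Ico] with s hs
    rw [integral_const_mul, mul_comm]
    gcongr
    exact hC s hs
  have h2 : ∫ p, ‖f p.2‖ ^ 2 * q p ∂(ν.prod ν) = ∫ p, ‖f p.1‖ ^ 2 * q p ∂(ν.prod ν) := by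
    rw [← integral_prod_swap]
    refine integral_congr_ae (Eventually.of_forall fun p => ?_)
    exact congrArg (fun x => ‖f p.1‖ ^ 2 * x) (hsymm p.2 p.1)
  -- Schur's test: the product is split by the arithmetic-geometric mean inequality, and the two
  -- halves have equal integrals by symmetry of the kernel.
  have h3 : ∫ p, ‖f p.1‖ * ‖f p.2‖ * q p ∂(ν.prod ν)
      ≤ ∫ p, (1 / 2 * (‖f p.1‖ ^ 2 * q p) + 1 / 2 * (‖f p.2‖ ^ 2 * q p)) ∂(ν.prod ν) := by
    refine integral_mono hInt3 ((hInt.const_mul _).add (hInt2.const_mul _)) fun p => ?_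
    have := mul_nonneg (sq_nonneg (‖f p.1‖ - ‖f p.2‖)) (hq0 p)
    simp only
    nlinarith
  refine ⟨hInt3, h3.trans ?_⟩
  rw [integral_add (hInt.const_mul _) (hInt2.const_mul _), integral_const_mul, integral_const_mul,
    h2]
  linarith

theorem memLp_Ico_of_continuous {L : ℝ} {f : ℝ → ℂ} (hf : Continuous f) :
    MemLp f 2 (volume.restrict (Set.Ico 0 L)) :=
  (memLp_two_iff_integrable_sq_norm hf.aestronglyMeasurable).2
    (integrable_Ico_of_continuous (by fun_prop))

/-- The logarithmic energy at scale `L / n` controls `log n` times the square of the norm, up to the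
averages over the `n` cells. -/
theorem log_energy_le {L : ℝ} (hL : 0 < L) {n : ℕ} (hn : 0 < n) {f : ℝ → ℂ} (hf : Continuous f) :
    (2 * Real.log n - 2 * Real.log 2 - 8) * (∫ s in Set.Ico 0 L, ‖f s‖ ^ 2)
      - 2 * (L / n)⁻¹ * (∑ i : Fin n, ‖∫ t in cell (L / n) i, f t‖) * (∫ s in Set.Ico 0 L, ‖f s‖)
    ≤ ∫ p, ‖f p.1 - f p.2‖ ^ 2 * (|p.1 - p.2| + L / n)⁻¹
      ∂((volume.restrict (Set.Ico 0 L)).prod (volume.restrict (Set.Ico 0 L))) := by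
  set ν : Measure ℝ := volume.restrict (Set.Ico 0 L) with hν
  set a : ℝ := L / n with ha'
  have hn0 : (0 : ℝ) < n := by exact_mod_cast hn
  have ha : 0 < a := by positivity
  have hna : n * a = L := by rw [ha']; field_simp
  have hk : Continuous fun p : ℝ × ℝ => (|p.1 - p.2| + a)⁻¹ :=
    Continuous.inv₀ (by fun_prop) fun r => by positivity
  have hq : Continuous fun p : ℝ × ℝ => 2 * a * ((|p.1 - p.2| + a) ^ 2)⁻¹ :=
    continuous_const.mul (Continuous.inv₀ (by fun_prop) fun r => by positivity)
  -- the diagonal part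
  have hdiag : (Real.log n - Real.log 2) * (∫ s, ‖f s‖ ^ 2 ∂ν)
      ≤ ∫ p, ‖f p.1‖ ^ 2 * (|p.1 - p.2| + a)⁻¹ ∂(ν.prod ν) := by
    have hInt : Integrable (fun p : ℝ × ℝ => ‖f p.1‖ ^ 2 * (|p.1 - p.2| + a)⁻¹) (ν.prod ν) :=
      integrable_prod_of_continuous (by fun_prop)
    rw [integral_prod _ hInt, ← integral_const_mul]
    refine integral_mono_ae ((integrable_Ico_of_continuous (by fun_prop)).const_mul _)
      hInt.integral_prod_left ?_
    filter_upwards [ae_restrict_mem measurableSet_Ico] with s hs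
    rw [integral_const_mul, mul_comm]
    gcongr
    exact log_le_integral_inv hs hn
  have hdiag' : ∫ p, ‖f p.2‖ ^ 2 * (|p.1 - p.2| + a)⁻¹ ∂(ν.prod ν)
      = ∫ p, ‖f p.1‖ ^ 2 * (|p.1 - p.2| + a)⁻¹ ∂(ν.prod ν) := by
    rw [← integral_prod_swap]
    refine integral_congr_ae (Eventually.of_forall fun p => ?_)
    simp only [Prod.fst_swap, Prod.snd_swap]
    rw [abs_sub_comm]
  -- the off-diagonal part
  have hmeas : Measurable fun p : ℝ × ℝ => (|p.1 - cellLeft a p.2| + a)⁻¹ := by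
    have := measurable_cellLeft a
    fun_prop
  have hInt1 : Integrable (fun p : ℝ × ℝ => f p.1 * starRingEnd ℂ (f p.2)
      * (((|p.1 - p.2| + a)⁻¹ : ℝ) : ℂ)) (ν.prod ν) := by
    refine integrable_prod_of_continuous ?_
    have h1 : Continuous fun p : ℝ × ℝ => (((|p.1 - p.2| + a)⁻¹ : ℝ) : ℂ) :=
      Complex.continuous_ofReal.comp hk
    have h2 : Continuous fun p : ℝ × ℝ => starRingEnd ℂ (f p.2) :=
      Complex.continuous_conj.comp (hf.comp continuous_snd)
    fun_prop
  have hInt2 : Integrable (fun p : ℝ × ℝ => f p.1 * starRingEnd ℂ (f p.2)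
      * (((|p.1 - cellLeft a p.2| + a)⁻¹ : ℝ) : ℂ)) (ν.prod ν) := by
    refine Integrable.mul_bdd (c := a⁻¹) ?_ ?_ ?_
    · refine integrable_prod_of_continuous ?_
      have h2 : Continuous fun p : ℝ × ℝ => starRingEnd ℂ (f p.2) :=
        Complex.continuous_conj.comp (hf.comp continuous_snd)
      fun_prop
    · exact (Complex.measurable_ofReal.comp hmeas).aestronglyMeasurable
    · refine Eventually.of_forall fun p => ?_
      rw [Complex.norm_real, Real.norm_of_nonneg (by positivity)]
      exact inv_anti₀ ha (by linarith [abs_nonneg (p.1 - cellLeft a p.2)])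
  -- Freezing the kernel at the left end of the cell of `t` costs only `4 ‖f‖²`, uniformly in `n`,
  -- by Schur's test.
  have hA : ‖∫ p, (f p.1 * starRingEnd ℂ (f p.2) * (((|p.1 - p.2| + a)⁻¹ : ℝ) : ℂ)
      - f p.1 * starRingEnd ℂ (f p.2) * (((|p.1 - cellLeft a p.2| + a)⁻¹ : ℝ) : ℂ)) ∂(ν.prod ν)‖
      ≤ 4 * ∫ s, ‖f s‖ ^ 2 ∂ν := by
    refine (norm_integral_le_integral_norm _).trans ?_
    refine (integral_mono (hInt1.sub hInt2).norm
      (integrable_prod_of_continuous (F := fun p => ‖f p.1‖ * ‖f p.2‖ *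
        (2 * a * ((|p.1 - p.2| + a) ^ 2)⁻¹)) (by fun_prop)) fun p => ?_).trans
      (integral_norm_mul_norm_mul_le (memLp_Ico_of_continuous hf) hq (fun p => by positivity)
        (fun s t => by simp only [abs_sub_comm]) (fun s hs => integral_mul_inv_sq_le hs ha)).2
    simp only [Pi.sub_apply]
    rw [← mul_sub, ← Complex.ofReal_sub, norm_mul, norm_mul, RCLike.norm_conj, Complex.norm_real]
    gcongr
    exact abs_inv_sub_inv_cellLeft_le ha _ _
  -- The frozen kernel is constant in `t` on each cell, so `f` enters in `t` only through its cell
  -- integrals; the kernel itself is at most `a⁻¹`.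
  have hB : ‖∫ p, f p.1 * starRingEnd ℂ (f p.2)
      * (((|p.1 - cellLeft a p.2| + a)⁻¹ : ℝ) : ℂ) ∂(ν.prod ν)‖
      ≤ a⁻¹ * (∑ i : Fin n, ‖∫ t in cell a i, f t‖) * ∫ s, ‖f s‖ ∂ν := by
    rw [integral_prod _ hInt2, mul_comm, ← integral_mul_const]
    refine norm_integral_le_of_norm_le
      ((integrable_Ico_of_continuous (by fun_prop)).mul_const _) ?_
    refine Eventually.of_forall fun s => ?_
    simp only [mul_assoc]
    rw [integral_const_mul, norm_mul]
    gcongr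
    have hinner : IntegrableOn (fun t => starRingEnd ℂ (f t)
        * (((|s - cellLeft a t| + a)⁻¹ : ℝ) : ℂ)) (Set.Ico 0 L) := by
      refine Integrable.mul_bdd (c := a⁻¹) ?_ ?_ ?_
      · exact integrable_Ico_of_continuous (Complex.continuous_conj.comp hf)
      · exact (Complex.measurable_ofReal.comp
          (hmeas.comp (measurable_const.prodMk measurable_id))).aestronglyMeasurable
      · refine Eventually.of_forall fun t => ?_
        rw [Complex.norm_real, Real.norm_of_nonneg (by positivity)]
        exact inv_anti₀ ha (by linarith [abs_nonneg (s - cellLeft a t)])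
    rw [hν, integral_Ico_eq_sum_cell ha hna hinner, Finset.mul_sum]
    refine norm_sum_le_of_le _ fun i _ => ?_
    have hcongr : ∫ t in cell a i, starRingEnd ℂ (f t) * (((|s - cellLeft a t| + a)⁻¹ : ℝ) : ℂ)
        = ∫ t in cell a i, starRingEnd ℂ (f t) * (((|s - i * a| + a)⁻¹ : ℝ) : ℂ) := by
      refine setIntegral_congr_fun (measurableSet_cell a i) fun t ht => ?_
      rw [mem_cell_iff ha] at ht
      simp only [cellLeft, ht, Int.cast_natCast]
    rw [hcongr, integral_mul_const, norm_mul, Complex.norm_real, integral_conj, RCLike.norm_conj,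
      Real.norm_of_nonneg (by positivity), mul_comm]
    gcongr
    linarith [abs_nonneg (s - i * a)]
  rw [integral_sub hInt1 hInt2] at hA
  have hcross : (∫ p, f p.1 * starRingEnd ℂ (f p.2)
      * (((|p.1 - p.2| + a)⁻¹ : ℝ) : ℂ) ∂(ν.prod ν)).re
      ≤ 4 * (∫ s, ‖f s‖ ^ 2 ∂ν)
        + a⁻¹ * (∑ i : Fin n, ‖∫ t in cell a i, f t‖) * ∫ s, ‖f s‖ ∂ν := by
    refine (Complex.re_le_norm _).trans ?_
    refine (norm_le_norm_sub_add _ (∫ p, f p.1 * starRingEnd ℂ (f p.2)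
      * (((|p.1 - cellLeft a p.2| + a)⁻¹ : ℝ) : ℂ) ∂(ν.prod ν))).trans ?_
    exact add_le_add hA hB
  have hre : (∫ p, f p.1 * starRingEnd ℂ (f p.2) * (((|p.1 - p.2| + a)⁻¹ : ℝ) : ℂ) ∂(ν.prod ν)).re
      = ∫ p, (f p.1 * starRingEnd ℂ (f p.2) * (((|p.1 - p.2| + a)⁻¹ : ℝ) : ℂ)).re ∂(ν.prod ν) :=
    (integral_re hInt1).symm
  -- Expansion of the square: the two diagonal terms supply `2 log n - 2 log 2`, and twice the cross
  -- term costs `8` together with the cell integrals.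
  have hexp : ∫ p, ‖f p.1 - f p.2‖ ^ 2 * (|p.1 - p.2| + a)⁻¹ ∂(ν.prod ν)
      = ∫ p, ‖f p.1‖ ^ 2 * (|p.1 - p.2| + a)⁻¹ ∂(ν.prod ν)
        + ∫ p, ‖f p.2‖ ^ 2 * (|p.1 - p.2| + a)⁻¹ ∂(ν.prod ν)
        - 2 * ∫ p, (f p.1 * starRingEnd ℂ (f p.2)
          * (((|p.1 - p.2| + a)⁻¹ : ℝ) : ℂ)).re ∂(ν.prod ν) := by
    have i1 : Integrable (fun p : ℝ × ℝ => ‖f p.1‖ ^ 2 * (|p.1 - p.2| + a)⁻¹) (ν.prod ν) :=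
      integrable_prod_of_continuous (by fun_prop)
    have i2 : Integrable (fun p : ℝ × ℝ => ‖f p.2‖ ^ 2 * (|p.1 - p.2| + a)⁻¹) (ν.prod ν) :=
      integrable_prod_of_continuous (by fun_prop)
    have i12 : Integrable (fun p : ℝ × ℝ => ‖f p.1‖ ^ 2 * (|p.1 - p.2| + a)⁻¹
        + ‖f p.2‖ ^ 2 * (|p.1 - p.2| + a)⁻¹) (ν.prod ν) := i1.add i2
    have i3 : Integrable (fun p : ℝ × ℝ => 2 * (f p.1 * starRingEnd ℂ (f p.2)
        * (((|p.1 - p.2| + a)⁻¹ : ℝ) : ℂ)).re) (ν.prod ν) := hInt1.re.const_mul 2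
    rw [← integral_add i1 i2, ← integral_const_mul, ← integral_sub i12 i3]
    refine integral_congr_ae (Eventually.of_forall fun p => ?_)
    simp only
    rw [Complex.re_mul_ofReal, ← Complex.normSq_eq_norm_sq, ← Complex.normSq_eq_norm_sq,
      ← Complex.normSq_eq_norm_sq, Complex.normSq_sub]
    ring
  rw [hexp, hdiag', ← hre]
  linarith

end Cells

namespace ClosedCurve

variable (Γ : ClosedCurve)

/-! ### The logarithmically singular operator on the curve -/

/-- The kernel of the free resolvent. -/
noncomputable def green (lam : ℝ) (x y : E3) : ℝ :=
  Real.exp (-√(-lam) * ‖x - y‖) / (4 * Real.pi * ‖x - y‖)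

theorem green_nonneg (lam : ℝ) (x y : E3) : 0 ≤ green lam x y := by
  unfold green
  have := Real.pi_pos
  positivity

theorem green_comm (lam : ℝ) (x y : E3) : green lam x y = green lam y x := by
  unfold green
  rw [norm_sub_rev]

theorem green_le (lam : ℝ) (x y : E3) : green lam x y ≤ (4 * Real.pi)⁻¹ * ‖x - y‖⁻¹ := by
  unfold green
  rw [← mul_inv, div_eq_mul_inv]
  have hpi := Real.pi_pos
  refine mul_le_of_le_one_left (by positivity) (Real.exp_le_one_iff.2 ?_)
  have : 0 ≤ √(-lam) * ‖x - y‖ := by positivity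
  linarith

theorem measurable_green (lam : ℝ) : Measurable fun p : E3 × E3 => green lam p.1 p.2 := by
  unfold green
  fun_prop

theorem interval_subset_ball (x : E3) (δ : ℝ) : Γ.interval x δ ⊆ Metric.ball x δ := by
  rintro y ⟨s₀, s, rfl, hs, rfl⟩
  rw [Metric.mem_ball, dist_eq_norm]
  refine (Γ.norm_σ_sub_le s s₀).trans_lt ?_
  rw [abs_lt]
  constructor <;> linarith [hs.1, hs.2]

/-- The set is the image under `σ` of an open subset of the line. Open sets there are countable
unions of compact sets, and compactness survives continuous images. -/
theorem measurableSet_interval (x : E3) (δ : ℝ) : MeasurableSet (Γ.interval x δ) := by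
  have h1 : Γ.interval x δ = Γ.σ '' (⋃ s₀ ∈ Γ.σ ⁻¹' {x}, Set.Ioo (s₀ - δ) (s₀ + δ)) := by
    ext y
    simp only [interval, Set.mem_ofPred_eq, Set.mem_image, Set.mem_iUnion, Set.mem_preimage,
      Set.mem_singleton_iff]
    constructor
    · rintro ⟨s₀, s, h, hs, hy⟩
      exact ⟨s, ⟨s₀, h, hs⟩, hy⟩
    · rintro ⟨s, ⟨s₀, h, hs⟩, hy⟩
      exact ⟨s₀, s, h, hs, hy⟩
  have hopen : IsOpen (⋃ s₀ ∈ Γ.σ ⁻¹' {x}, Set.Ioo (s₀ - δ) (s₀ + δ)) :=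
    isOpen_biUnion fun _ _ => isOpen_Ioo
  obtain ⟨F, hF, -, hFU, -⟩ := hopen.exists_iUnion_isClosed
  have hsc : IsSigmaCompact (⋃ s₀ ∈ Γ.σ ⁻¹' {x}, Set.Ioo (s₀ - δ) (s₀ + δ)) := by
    rw [← hFU]
    exact isSigmaCompact_iUnion _ fun n =>
      isSigmaCompact_univ.of_isClosed_subset (hF n) (Set.subset_univ _)
  rw [h1]
  obtain ⟨K, hK, hKU⟩ := hsc.image Γ.continuous_σ
  rw [← hKU]
  exact MeasurableSet.iUnion fun n => (hK n).isClosed.measurableSet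

theorem arcLength_singleton (x : E3) : Γ.arcLength {x} = 0 := by
  by_cases hx : x ∈ Γ.carrier
  · obtain ⟨s, rfl⟩ := hx
    have hL := Γ.L_pos
    rw [← (Γ.measurePreserving_σ_Ioc (s - Γ.L / 2)).measure_preimage
      (measurableSet_singleton _).nullMeasurableSet, Measure.restrict_apply'
      measurableSet_Ioc]
    refine measure_mono_null (t := {s}) ?_ (by simp)
    rintro t ⟨ht, ht'⟩
    by_contra hne
    refine Γ.σ_ne hne ?_ ht
    rw [abs_lt]
    constructor <;> linarith [ht'.1, ht'.2]
  · refine measure_mono_null ?_ Γ.ae_mem_carrier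
    rintro y rfl
    exact hx

/-- Truncating `1/r` as `1 / max r δ` keeps the majorant continuous and costs just the additive
constant `1`. -/
theorem integral_inv_max {δ y : ℝ} (hδ : 0 < δ) (hy : δ ≤ y) :
    ∫ r in (0 : ℝ)..y, (max r δ)⁻¹ = 1 + Real.log (y / δ) := by
  have hcont : Continuous fun r : ℝ => (max r δ)⁻¹ :=
    Continuous.inv₀ (by fun_prop) fun r => (hδ.trans_le (le_max_right _ _)).ne'
  rw [← intervalIntegral.integral_add_adjacent_intervals (hcont.intervalIntegrable 0 δ)
    (hcont.intervalIntegrable δ y)]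
  congr 1
  · have : ∫ r in (0 : ℝ)..δ, (max r δ)⁻¹ = ∫ r in (0 : ℝ)..δ, δ⁻¹ := by
      refine intervalIntegral.integral_congr fun t ht => ?_
      rw [Set.uIcc_of_le hδ.le] at ht
      rw [max_eq_right ht.2]
    rw [this, intervalIntegral.integral_const, sub_zero, smul_eq_mul, mul_inv_cancel₀ hδ.ne']
  · have : ∫ r in δ..y, (max r δ)⁻¹ = ∫ r in δ..y, r⁻¹ := by
      refine intervalIntegral.integral_congr fun t ht => ?_
      rw [Set.uIcc_of_le hy] at ht
      rw [max_eq_left ht.1]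
    rw [this, integral_inv_of_pos hδ (hδ.trans_le hy)]

/-- The regularized integral of the kernel is bounded from above. -/
theorem exists_integral_green_le (lam : ℝ) : ∃ M : ℝ, ∀ x ∈ Γ.carrier, ∀ δ, 0 < δ → δ ≤ Γ.L / 2 →
    IntegrableOn (green lam x) (Γ.interval x δ)ᶜ Γ.arcLength ∧
    (∫ y in (Γ.interval x δ)ᶜ, green lam x y ∂Γ.arcLength) + Real.log δ / (2 * Real.pi) ≤ M := by
  obtain ⟨C, hC0, hC⟩ := Γ.exists_inv_norm_σ_sub_le
  have hL := Γ.L_pos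
  have hpi := Real.pi_pos
  -- Both sides of `x` contribute `log (L / 2δ) + 1`, divided by `4π`; the resulting `-log δ / (2π)`
  -- cancels the counterterm exactly. The rest is the bounded chord-arc error `C` integrated over
  -- length `L`.
  refine ⟨(4 * Real.pi)⁻¹ * (2 * (1 + Real.log (Γ.L / 2)) + C * Γ.L), ?_⟩
  rintro x ⟨s, rfl⟩ δ hδ hδL
  set S := (Γ.interval (Γ.σ s) δ)ᶜ with hS
  have hSm : MeasurableSet S := (Γ.measurableSet_interval _ _).compl
  have hmp := Γ.measurePreserving_σ_Ioc (s - Γ.L / 2)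
  have hend : s - Γ.L / 2 + Γ.L = s + Γ.L / 2 := by ring
  rw [hend] at hmp
  set φ : ℝ → ℝ := fun r => (max r δ)⁻¹ with hφ
  have hφc : Continuous φ :=
    Continuous.inv₀ (by fun_prop) fun r => (hδ.trans_le (le_max_right _ _)).ne'
  set b : ℝ → ℝ := fun t => (4 * Real.pi)⁻¹ * (φ |t - s| + C) with hb
  have hbc : Continuous b := by fun_prop
  have hbound : ∀ t ∈ Set.Ioc (s - Γ.L / 2) (s + Γ.L / 2),
      S.indicator (green lam (Γ.σ s)) (Γ.σ t) ≤ b t := by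
    intro t ht
    by_cases htS : Γ.σ t ∈ S
    · rw [Set.indicator_of_mem htS]
      have hd : δ ≤ |t - s| := by
        by_contra hlt
        rw [not_le, abs_lt] at hlt
        exact htS ⟨s, t, rfl, ⟨by linarith [hlt.1], by linarith [hlt.2]⟩, rfl⟩
      have hts : |t - s| ≤ Γ.L / 2 := abs_le.2 ⟨by linarith [ht.1], by linarith [ht.2]⟩
      have hne : s ≠ t := by
        rintro rfl
        simp at hd
        linarith
      refine (green_le _ _ _).trans ?_
      rw [hb, hφ]
      simp only
      rw [max_eq_left hd, abs_sub_comm]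
      gcongr
      exact hC s t hne (by rwa [abs_sub_comm])
    · rw [Set.indicator_of_notMem htS]
      have : 0 ≤ φ |t - s| := inv_nonneg.2 (hδ.le.trans (le_max_right _ _))
      rw [hb]
      positivity
  have hbint : IntegrableOn b (Set.Ioc (s - Γ.L / 2) (s + Γ.L / 2)) :=
    (hbc.continuousOn.integrableOn_compact isCompact_Icc).mono_set Set.Ioc_subset_Icc_self
  have hgm : Measurable (S.indicator (green lam (Γ.σ s))) :=
    ((measurable_green lam).comp (measurable_const.prodMk measurable_id)).indicator hSm
  have hind0 : ∀ y, 0 ≤ S.indicator (green lam (Γ.σ s)) y :=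
    fun y => Set.indicator_nonneg (fun _ _ => green_nonneg _ _ _) y
  have hInt' : Integrable (S.indicator (green lam (Γ.σ s)) ∘ Γ.σ)
      (volume.restrict (Set.Ioc (s - Γ.L / 2) (s + Γ.L / 2))) := by
    refine Integrable.mono' hbint (hgm.comp Γ.measurable_σ).aestronglyMeasurable ?_
    filter_upwards [ae_restrict_mem measurableSet_Ioc] with t ht
    rw [Function.comp_apply, Real.norm_of_nonneg (hind0 _)]
    exact hbound t ht
  have hInt : Integrable (S.indicator (green lam (Γ.σ s))) Γ.arcLength :=
    (hmp.integrable_comp hgm.aestronglyMeasurable).1 hInt'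
  refine ⟨(integrable_indicator_iff hSm).1 hInt, ?_⟩
  have h1 : ∫ y in S, green lam (Γ.σ s) y ∂Γ.arcLength
      = ∫ t in Set.Ioc (s - Γ.L / 2) (s + Γ.L / 2), S.indicator (green lam (Γ.σ s)) (Γ.σ t) := by
    rw [← integral_indicator hSm, ← hmp.map_eq, integral_map hmp.aemeasurable]
    exact hgm.aestronglyMeasurable
  have h2 : ∫ t in Set.Ioc (s - Γ.L / 2) (s + Γ.L / 2), S.indicator (green lam (Γ.σ s)) (Γ.σ t)
      ≤ ∫ t in Set.Ioc (s - Γ.L / 2) (s + Γ.L / 2), b t :=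
    setIntegral_mono_on hInt' hbint measurableSet_Ioc hbound
  have h3 : ∫ t in Set.Ioc (s - Γ.L / 2) (s + Γ.L / 2), b t
      = (4 * Real.pi)⁻¹ * (2 * (1 + Real.log (Γ.L / 2 / δ)) + C * Γ.L) := by
    rw [← intervalIntegral.integral_of_le (by linarith), hb,
      intervalIntegral.integral_const_mul, intervalIntegral.integral_add
      ((show Continuous fun t => φ |t - s| by fun_prop).intervalIntegrable _ _)
      (intervalIntegrable_const), integral_comp_abs_sub hφc s _ _ (by linarith) (by linarith),
      intervalIntegral.integral_const]
    have e1 : s - (s - Γ.L / 2) = Γ.L / 2 := by ring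
    have e2 : s + Γ.L / 2 - s = Γ.L / 2 := by ring
    rw [e1, e2, integral_inv_max hδ hδL, smul_eq_mul]
    ring
  rw [h1]
  have h4 : Real.log (Γ.L / 2 / δ) = Real.log (Γ.L / 2) - Real.log δ :=
    Real.log_div (by positivity) hδ.ne'
  rw [h4] at h3
  have h5 : (4 * Real.pi)⁻¹ * (2 * (1 + (Real.log (Γ.L / 2) - Real.log δ)) + C * Γ.L)
      + Real.log δ / (2 * Real.pi)
      = (4 * Real.pi)⁻¹ * (2 * (1 + Real.log (Γ.L / 2)) + C * Γ.L) := by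
    field_simp
    ring
  linarith

/-! ### The quadratic form on Lipschitz densities -/

section Lipschitz

variable {Γ} {h : E3 → ℂ} {K : NNReal}

theorem aestronglyMeasurable_of_lipschitzOn (hh : LipschitzOnWith K h Γ.carrier) :
    AEStronglyMeasurable h Γ.arcLength := by
  have := hh.continuousOn.aestronglyMeasurable (μ := Γ.arcLength) Γ.measurableSet_carrier
  rwa [Measure.restrict_eq_self_of_ae_mem Γ.ae_mem_carrier] at this

theorem continuous_comp_σ_of_lipschitzOn (hh : LipschitzOnWith K h Γ.carrier) :
    Continuous fun s => h (Γ.σ s) :=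
  hh.continuousOn.comp_continuous Γ.continuous_σ fun s => ⟨s, rfl⟩

/-- The Lipschitz bound cancels the singularity `1 / |x - y|`, so the energy integrals below
converge absolutely. -/
theorem norm_sub_mul_green_le (hh : LipschitzOnWith K h Γ.carrier) (lam : ℝ) {x y : E3}
    (hx : x ∈ Γ.carrier) (hy : y ∈ Γ.carrier) :
    ‖h x - h y‖ * green lam x y ≤ K * (4 * Real.pi)⁻¹ := by
  have hpi := Real.pi_pos
  have h1 := hh.norm_sub_le hx hy
  have h2 : ‖x - y‖ * ‖x - y‖⁻¹ ≤ 1 := mul_inv_le_one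
  calc ‖h x - h y‖ * green lam x y
      ≤ (K * ‖x - y‖) * ((4 * Real.pi)⁻¹ * ‖x - y‖⁻¹) := by
        gcongr
        · exact green_nonneg _ _ _
        · exact green_le _ _ _
    _ = K * (4 * Real.pi)⁻¹ * (‖x - y‖ * ‖x - y‖⁻¹) := by ring
    _ ≤ K * (4 * Real.pi)⁻¹ * 1 := by gcongr
    _ = K * (4 * Real.pi)⁻¹ := mul_one _

theorem abs_re_mul_green_le (hh : LipschitzOnWith K h Γ.carrier) (lam : ℝ) {x y : E3}
    (hx : x ∈ Γ.carrier) (hy : y ∈ Γ.carrier) :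
    ‖((h x - h y) * starRingEnd ℂ (h x)).re * green lam x y‖
      ≤ K * (4 * Real.pi)⁻¹ * ‖h x‖ := by
  rw [norm_mul, Real.norm_of_nonneg (green_nonneg _ _ _)]
  have h1 : ‖((h x - h y) * starRingEnd ℂ (h x)).re‖ ≤ ‖h x - h y‖ * ‖h x‖ := by
    refine (Complex.abs_re_le_norm _).trans ?_
    rw [norm_mul, RCLike.norm_conj]
  calc _ ≤ ‖h x - h y‖ * ‖h x‖ * green lam x y := by
        gcongr
        exact green_nonneg _ _ _
    _ = ‖h x - h y‖ * green lam x y * ‖h x‖ := by ring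
    _ ≤ _ := by
        exact mul_le_mul_of_nonneg_right (norm_sub_mul_green_le hh lam hx hy) (norm_nonneg _)

theorem integrable_re_mul_green (hh : LipschitzOnWith K h Γ.carrier) (lam : ℝ) {x : E3}
    (hx : x ∈ Γ.carrier) :
    Integrable (fun y => ((h x - h y) * starRingEnd ℂ (h x)).re * green lam x y) Γ.arcLength := by
  have hm := aestronglyMeasurable_of_lipschitzOn hh
  refine Integrable.of_bound ?_ (K * (4 * Real.pi)⁻¹ * ‖h x‖) ?_
  · refine AEStronglyMeasurable.mul ?_
      ((measurable_green lam).comp (measurable_const.prodMk measurable_id)).aestronglyMeasurable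
    exact Complex.continuous_re.comp_aestronglyMeasurable
      ((aestronglyMeasurable_const.sub hm).mul aestronglyMeasurable_const)
  · filter_upwards [Γ.ae_mem_carrier] with y hy
    exact abs_re_mul_green_le hh lam hx hy

/-- Substituting `h y = h x - (h x - h y)` isolates the whole divergence in the factor of `|h x|²`,
where the counterterm compensates it. The remainder has a limit as `δ → 0`. -/
theorem re_conj_mul_regularized (hh : LipschitzOnWith K h Γ.carrier) {lam : ℝ} {x : E3}
    (hx : x ∈ Γ.carrier) {δ : ℝ}
    (hInt : IntegrableOn (green lam x) (Γ.interval x δ)ᶜ Γ.arcLength) :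
    (starRingEnd ℂ (h x) * Γ.regularized lam h x δ).re
      = ‖h x‖ ^ 2 * ((∫ y in (Γ.interval x δ)ᶜ, green lam x y ∂Γ.arcLength)
          + Real.log δ / (2 * Real.pi))
        - ∫ y in (Γ.interval x δ)ᶜ,
          ((h x - h y) * starRingEnd ℂ (h x)).re * green lam x y ∂Γ.arcLength := by
  have hreg : Γ.regularized lam h x δ
      = (∫ y in (Γ.interval x δ)ᶜ, h y * ((green lam x y : ℝ) : ℂ) ∂Γ.arcLength)
        + h x * ((Real.log δ / (2 * Real.pi) : ℝ) : ℂ) := rfl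
  obtain ⟨B, hB⟩ := Γ.isCompact_carrier.exists_bound_of_continuousOn hh.continuousOn
  have hI : IntegrableOn (fun y => starRingEnd ℂ (h x) * (h y * ((green lam x y : ℝ) : ℂ)))
      (Γ.interval x δ)ᶜ Γ.arcLength := by
    refine Integrable.const_mul ?_ _
    refine Integrable.bdd_mul (c := B) hInt.ofReal
      (aestronglyMeasurable_of_lipschitzOn hh).restrict ?_
    filter_upwards [ae_restrict_of_ae Γ.ae_mem_carrier] with y hy
    exact hB y hy
  have hI2 := (integrable_re_mul_green hh lam hx).integrableOn (s := (Γ.interval x δ)ᶜ)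
  have hre : (∫ y in (Γ.interval x δ)ᶜ,
      starRingEnd ℂ (h x) * (h y * ((green lam x y : ℝ) : ℂ)) ∂Γ.arcLength).re
      = ∫ y in (Γ.interval x δ)ᶜ,
        (starRingEnd ℂ (h x) * (h y * ((green lam x y : ℝ) : ℂ))).re ∂Γ.arcLength :=
    (integral_re hI).symm
  have hsq : (starRingEnd ℂ (h x) * h x).re = ‖h x‖ ^ 2 := by
    rw [Complex.conj_mul']
    norm_cast
  rw [hreg, mul_add, Complex.add_re, ← integral_const_mul, hre, ← mul_assoc,
    Complex.re_mul_ofReal, hsq, mul_add, ← integral_const_mul, add_sub_right_comm,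
    ← integral_sub (hInt.const_mul _) hI2]
  congr 1
  refine integral_congr_ae (Eventually.of_forall fun y => ?_)
  simp only
  rw [← mul_assoc, Complex.re_mul_ofReal, ← sub_mul, ← hsq]
  congr 1
  simp only [Complex.mul_re, Complex.sub_re, Complex.sub_im, Complex.conj_re, Complex.conj_im]
  ring

/-- The quadratic form of the singular operator is bounded from above by a bounded potential minus
the density of the energy. -/
theorem re_conj_mul_le (hh : LipschitzOnWith K h Γ.carrier) {lam M : ℝ}
    (hM : ∀ x ∈ Γ.carrier, ∀ δ, 0 < δ → δ ≤ Γ.L / 2 →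
      IntegrableOn (green lam x) (Γ.interval x δ)ᶜ Γ.arcLength ∧
      (∫ y in (Γ.interval x δ)ᶜ, green lam x y ∂Γ.arcLength) + Real.log δ / (2 * Real.pi) ≤ M)
    {x : E3} (hx : x ∈ Γ.carrier) {w : ℂ}
    (hw : Tendsto (Γ.regularized lam h x) (𝓝[>] 0) (𝓝 w)) :
    (starRingEnd ℂ (h x) * w).re ≤ ‖h x‖ ^ 2 * M
      - ∫ y, ((h x - h y) * starRingEnd ℂ (h x)).re * green lam x y ∂Γ.arcLength := by
  have hL := Γ.L_pos
  have hI := integrable_re_mul_green hh lam hx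
  have h1 : Tendsto (fun δ => (starRingEnd ℂ (h x) * Γ.regularized lam h x δ).re) (𝓝[>] 0)
      (𝓝 (starRingEnd ℂ (h x) * w).re) :=
    (Complex.continuous_re.tendsto _).comp (hw.const_mul _)
  -- Dominated convergence: the excluded intervals lie in balls shrinking to `{x}`, which has arc
  -- length zero.
  have h2 : Tendsto (fun δ => ∫ y in (Γ.interval x δ)ᶜ,
      ((h x - h y) * starRingEnd ℂ (h x)).re * green lam x y ∂Γ.arcLength) (𝓝[>] 0)
      (𝓝 (∫ y, ((h x - h y) * starRingEnd ℂ (h x)).re * green lam x y ∂Γ.arcLength)) := by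
    simp_rw [← integral_indicator (Γ.measurableSet_interval x _).compl]
    refine tendsto_integral_filter_of_dominated_convergence
      (fun y => ‖((h x - h y) * starRingEnd ℂ (h x)).re * green lam x y‖) ?_ ?_ hI.norm ?_
    · exact Eventually.of_forall fun δ =>
        hI.aestronglyMeasurable.indicator (Γ.measurableSet_interval x _).compl
    · exact Eventually.of_forall fun δ => Eventually.of_forall fun y =>
        norm_indicator_le_norm_self _ _
    · have hne : ∀ᵐ y ∂Γ.arcLength, y ∉ ({x} : Set E3) :=
        measure_eq_zero_iff_ae_notMem.1 (Γ.arcLength_singleton x)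
      filter_upwards [hne] with y hy
      refine tendsto_const_nhds.congr' ?_
      have hpos : 0 < dist y x := dist_pos.2 hy
      filter_upwards [nhdsWithin_le_nhds (Iio_mem_nhds hpos)] with δ hδ
      rw [Set.indicator_of_mem]
      intro hmem
      exact absurd (Γ.interval_subset_ball x δ hmem) (by
        rw [Metric.mem_ball]
        exact not_lt.2 (le_of_lt hδ))
  refine le_of_tendsto_of_tendsto h1 (tendsto_const_nhds.sub h2) ?_
  have hev : ∀ᶠ δ in 𝓝[>] (0 : ℝ), δ ∈ Set.Ioc 0 (Γ.L / 2) :=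
    Ioc_mem_nhdsGT (by positivity)
  filter_upwards [hev] with δ hδ
  obtain ⟨hInt, hle⟩ := hM x hx δ hδ.1 hδ.2
  rw [re_conj_mul_regularized hh hx hInt]
  gcongr

/-- The energy of a Lipschitz function dominates its logarithmic energy at each positive scale. -/
theorem energy_le (hh : LipschitzOnWith K h Γ.carrier) (lam : ℝ) {a : ℝ} (ha : 0 < a) :
    Integrable (fun s => ∫ y, ((h (Γ.σ s) - h y) * starRingEnd ℂ (h (Γ.σ s))).re
        * green lam (Γ.σ s) y ∂Γ.arcLength) (volume.restrict (Set.Ico 0 Γ.L)) ∧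
    Real.exp (-√(-lam) * Γ.L) / (8 * Real.pi) *
      ∫ p, ‖h (Γ.σ p.1) - h (Γ.σ p.2)‖ ^ 2 * (|p.1 - p.2| + a)⁻¹
        ∂((volume.restrict (Set.Ico 0 Γ.L)).prod (volume.restrict (Set.Ico 0 Γ.L)))
    ≤ ∫ s in Set.Ico 0 Γ.L, ∫ y, ((h (Γ.σ s) - h y) * starRingEnd ℂ (h (Γ.σ s))).re
        * green lam (Γ.σ s) y ∂Γ.arcLength := by
  set ν : Measure ℝ := volume.restrict (Set.Ico 0 Γ.L) with hν
  have hpi := Real.pi_pos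
  have hf := continuous_comp_σ_of_lipschitzOn hh
  set f : ℝ → ℂ := fun s => h (Γ.σ s) with hfdef
  have hσ := Γ.continuous_σ
  have hgm : Measurable fun p : ℝ × ℝ => green lam (Γ.σ p.1) (Γ.σ p.2) :=
    Measurable.comp (g := fun p : E3 × E3 => green lam p.1 p.2)
      (f := fun p : ℝ × ℝ => (Γ.σ p.1, Γ.σ p.2)) (measurable_green lam)
      ((Γ.measurable_σ.comp measurable_fst).prodMk (Γ.measurable_σ.comp measurable_snd))
  obtain ⟨B, hB⟩ := Γ.isCompact_carrier.exists_bound_of_continuousOn hh.continuousOn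
  have hK0 : 0 ≤ (K : ℝ) * (4 * Real.pi)⁻¹ := by positivity
  set Φ : ℝ × ℝ → ℝ := fun p => ((f p.1 - f p.2) * starRingEnd ℂ (f p.1)).re
    * green lam (Γ.σ p.1) (Γ.σ p.2) with hΦ
  have hΦint : Integrable Φ (ν.prod ν) := by
    refine Integrable.of_bound ?_ (K * (4 * Real.pi)⁻¹ * B) (Eventually.of_forall fun p => ?_)
    · refine AEStronglyMeasurable.mul ?_ hgm.aestronglyMeasurable
      have h2 : Continuous fun p : ℝ × ℝ => starRingEnd ℂ (f p.1) :=
        Complex.continuous_conj.comp (hf.comp continuous_fst)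
      exact (Complex.continuous_re.comp (by fun_prop)).aestronglyMeasurable
    · refine (abs_re_mul_green_le hh lam ⟨_, rfl⟩ ⟨_, rfl⟩).trans ?_
      gcongr
      exact hB _ ⟨_, rfl⟩
  have h0 : (fun s => ∫ y, ((h (Γ.σ s) - h y) * starRingEnd ℂ (h (Γ.σ s))).re
      * green lam (Γ.σ s) y ∂Γ.arcLength) = fun s => ∫ t, Φ (s, t) ∂ν := by
    funext s
    have hI := (integrable_re_mul_green hh lam (x := Γ.σ s) ⟨s, rfl⟩).aestronglyMeasurable
    rw [← Γ.measurePreserving_σ.map_eq] at hI ⊢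
    rw [integral_map Γ.measurable_σ.aemeasurable hI]
  rw [h0]
  refine ⟨hΦint.integral_prod_left, ?_⟩
  rw [← integral_prod _ hΦint]
  have h2 : ∫ p, Φ p.swap ∂(ν.prod ν) = ∫ p, Φ p ∂(ν.prod ν) := integral_prod_swap Φ
  have hΦswap : Integrable (fun p : ℝ × ℝ => Φ p.swap) (ν.prod ν) := hΦint.swap
  -- Symmetrization in the two variables turns the energy density into half of `|f s - f t|²` times
  -- the Green kernel; hence `8π` in place of `4π`.
  have h3 : ∫ p, Φ p ∂(ν.prod ν) = ∫ p, (1 / 2) * (Φ p + Φ p.swap) ∂(ν.prod ν) := by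
    rw [integral_const_mul, integral_add hΦint hΦswap, h2]
    ring
  rw [h3, ← integral_const_mul]
  refine integral_mono_ae (Integrable.const_mul (integrable_prod_of_continuous ?_) _)
    ((hΦint.add hΦswap).const_mul _) ?_
  · have : Continuous fun p : ℝ × ℝ => (|p.1 - p.2| + a)⁻¹ :=
      Continuous.inv₀ (by fun_prop) fun r => by positivity
    change Continuous fun p : ℝ × ℝ => ‖f p.1 - f p.2‖ ^ 2 * (|p.1 - p.2| + a)⁻¹
    fun_prop
  have hae : ∀ᵐ p ∂(ν.prod ν), p ∈ Set.Ico 0 Γ.L ×ˢ Set.Ico 0 Γ.L := by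
    rw [hν, Measure.prod_restrict]
    exact ae_restrict_mem (measurableSet_Ico.prod measurableSet_Ico)
  filter_upwards [hae] with p hp
  have hsum : Φ p + Φ p.swap = ‖f p.1 - f p.2‖ ^ 2 * green lam (Γ.σ p.1) (Γ.σ p.2) := by
    simp only [hΦ, Prod.fst_swap, Prod.snd_swap]
    rw [green_comm lam (Γ.σ p.2), ← add_mul, ← Complex.normSq_eq_norm_sq]
    congr 1
    simp only [Complex.mul_re, Complex.sub_re, Complex.sub_im, Complex.conj_re, Complex.conj_im,
      Complex.normSq_apply]
    ring
  rw [hsum]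
  by_cases hσeq : Γ.σ p.1 = Γ.σ p.2
  · simp [hfdef, hσeq]
  · have hnorm : 0 < ‖Γ.σ p.1 - Γ.σ p.2‖ := norm_pos_iff.2 (sub_ne_zero.2 hσeq)
    have hle := Γ.norm_σ_sub_le p.1 p.2
    have hleL : |p.1 - p.2| ≤ Γ.L := by
      rw [abs_le]
      constructor <;> linarith [hp.1.1, hp.1.2, hp.2.1, hp.2.2]
    -- The chord is at most `|s - t|`, hence at most `|s - t| + a`, and also at most `L`. The first
    -- bounds the reciprocal, the second the exponential.
    have hg : Real.exp (-√(-lam) * Γ.L) / (4 * Real.pi) * (|p.1 - p.2| + a)⁻¹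
        ≤ green lam (Γ.σ p.1) (Γ.σ p.2) := by
      have e : green lam (Γ.σ p.1) (Γ.σ p.2) = Real.exp (-√(-lam) * ‖Γ.σ p.1 - Γ.σ p.2‖)
          / (4 * Real.pi) * ‖Γ.σ p.1 - Γ.σ p.2‖⁻¹ := by
        rw [green, div_mul_eq_div_div _ _ ‖Γ.σ p.1 - Γ.σ p.2‖, ← div_eq_mul_inv]
      rw [e]
      have h0 := Real.sqrt_nonneg (-lam)
      gcongr ?_ / _ * ?_
      · refine Real.exp_le_exp.2 ?_
        nlinarith
      · exact inv_anti₀ hnorm (by linarith)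
    calc Real.exp (-√(-lam) * Γ.L) / (8 * Real.pi) * (‖f p.1 - f p.2‖ ^ 2 * (|p.1 - p.2| + a)⁻¹)
        = 1 / 2 * (‖f p.1 - f p.2‖ ^ 2 *
          (Real.exp (-√(-lam) * Γ.L) / (4 * Real.pi) * (|p.1 - p.2| + a)⁻¹)) := by ring
      _ ≤ _ := by gcongr

end Lipschitz

end ClosedCurve

theorem norm_sq_eq_integral {X : Type*} [MeasurableSpace X] {μ : Measure X} (h : Lp ℂ 2 μ) :
    ‖h‖ ^ 2 = ∫ x, ‖h x‖ ^ 2 ∂μ := by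
  have h1 : ((‖h‖ ^ 2 : ℝ) : ℂ) = ((∫ x, ‖h x‖ ^ 2 ∂μ : ℝ) : ℂ) := by
    have := inner_self_eq_norm_sq_to_K (𝕜 := ℂ) h
    rw [L2.inner_def] at this
    push_cast
    rw [← integral_complex_ofReal]
    refine this.symm.trans (integral_congr_ae (Eventually.of_forall fun x => ?_))
    simp only [inner_self_eq_norm_sq_to_K]
    norm_cast
  exact_mod_cast h1

namespace ClosedCurve

variable (Γ : ClosedCurve)

/-! ### Moments over cells -/

/-- Pull-back of square integrable functions along the parametrization. -/
noncomputable def pull : Γ.L2 →ₗᵢ[ℂ] Lp ℂ 2 (volume.restrict (Set.Ico 0 Γ.L)) :=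
  Lp.compMeasurePreservingₗᵢ ℂ Γ.σ Γ.measurePreserving_σ

theorem coeFn_pull (h : Γ.L2) :
    Γ.pull h =ᵐ[volume.restrict (Set.Ico 0 Γ.L)] fun s => h (Γ.σ s) :=
  Lp.coeFn_compMeasurePreserving h Γ.measurePreserving_σ

theorem memLp_cell_indicator (a : ℝ) (j i : ℕ) :
    MemLp ((cell a i).indicator fun t : ℝ => (t : ℂ) ^ j) 2
      (volume.restrict (Set.Ico 0 Γ.L)) := by
  have hc : Continuous fun t : ℝ => (t : ℂ) ^ j := by fun_prop
  obtain ⟨B, hB⟩ := (isCompact_Icc (a := 0) (b := Γ.L)).exists_bound_of_continuousOn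
    hc.continuousOn
  refine MemLp.indicator (measurableSet_cell a i) (MemLp.of_bound hc.aestronglyMeasurable B ?_)
  filter_upwards [ae_restrict_mem measurableSet_Ico] with t ht
  exact hB t (Set.Ico_subset_Icc_self ht)

/-- The `j`-th moment of a function over the `i`-th cell of mesh `a`. -/
noncomputable def cellMoment (a : ℝ) (j i : ℕ) : Γ.L2 →L[ℂ] ℂ :=
  innerSL ℂ ((Γ.memLp_cell_indicator a j i).toLp _) ∘L Γ.pull.toContinuousLinearMap

theorem cell_subset {n : ℕ} (i : Fin n) : cell (Γ.L / n) i ⊆ Set.Ico 0 Γ.L := by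
  have hn : 0 < n := i.pos
  have hn0 : (0 : ℝ) < n := by exact_mod_cast hn
  have hL := Γ.L_pos
  have h := iUnion_cell (a := Γ.L / n) (by positivity) n
  rw [mul_div_cancel₀ _ hn0.ne'] at h
  rw [← h]
  exact Set.subset_iUnion (fun i : Fin n => cell (Γ.L / n) i) i

theorem cellMoment_apply {n : ℕ} (j : ℕ) (i : Fin n) (h : Γ.L2) {f : ℝ → ℂ}
    (hf : (fun s => h (Γ.σ s)) =ᵐ[volume.restrict (Set.Ico 0 Γ.L)] f) :
    Γ.cellMoment (Γ.L / n) j i h = ∫ t in cell (Γ.L / n) i, (t : ℂ) ^ j * f t := by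
  have h1 : Γ.cellMoment (Γ.L / n) j i h
      = inner ℂ ((Γ.memLp_cell_indicator (Γ.L / n) j i).toLp _) (Γ.pull h) := rfl
  rw [h1, L2.inner_def]
  have h2 : ∫ t in cell (Γ.L / n) i, (t : ℂ) ^ j * f t
      = ∫ t in Set.Ico 0 Γ.L, (cell (Γ.L / n) i).indicator (fun t => (t : ℂ) ^ j * f t) t := by
    rw [integral_indicator (measurableSet_cell _ _),
      Measure.restrict_restrict (measurableSet_cell _ _),
      Set.inter_eq_left.2 (Γ.cell_subset i)]
  rw [h2]
  refine integral_congr_ae ?_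
  filter_upwards [hf, Γ.coeFn_pull h, (Γ.memLp_cell_indicator (Γ.L / n) j i).coeFn_toLp]
    with t ht1 ht2 ht3
  rw [ht2, ht1, ht3]
  by_cases ht : t ∈ cell (Γ.L / n) i
  · simp [ht, mul_comm]
  · simp [ht]

theorem ae_comp_σ {h g : E3 → ℂ} (hg : h =ᵐ[Γ.arcLength] g) :
    (fun s => h (Γ.σ s)) =ᵐ[volume.restrict (Set.Ico 0 Γ.L)] fun s => g (Γ.σ s) :=
  Γ.measurePreserving_σ.quasiMeasurePreserving.ae_eq_comp hg

theorem norm_sq_eq_integral_Ico (h : Γ.L2) {f : ℝ → ℂ}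
    (hf : (fun s => h (Γ.σ s)) =ᵐ[volume.restrict (Set.Ico 0 Γ.L)] f) :
    ‖h‖ ^ 2 = ∫ s in Set.Ico 0 Γ.L, ‖f s‖ ^ 2 := by
  rw [← Γ.pull.norm_map h, norm_sq_eq_integral]
  refine integral_congr_ae ?_
  filter_upwards [hf, Γ.coeFn_pull h] with s h1 h2
  rw [h2, h1]

theorem re_inner_eq_integral_Ico (h b : Γ.L2) {f g : ℝ → ℂ}
    (hf : (fun s => h (Γ.σ s)) =ᵐ[volume.restrict (Set.Ico 0 Γ.L)] f)
    (hg : (fun s => b (Γ.σ s)) =ᵐ[volume.restrict (Set.Ico 0 Γ.L)] g) :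
    Integrable (fun s => (starRingEnd ℂ (f s) * g s).re) (volume.restrict (Set.Ico 0 Γ.L)) ∧
    (inner ℂ h b).re = ∫ s in Set.Ico 0 Γ.L, (starRingEnd ℂ (f s) * g s).re := by
  have hae : (fun s => inner ℂ (Γ.pull h s) (Γ.pull b s))
      =ᵐ[volume.restrict (Set.Ico 0 Γ.L)] fun s => starRingEnd ℂ (f s) * g s := by
    filter_upwards [hf, hg, Γ.coeFn_pull h, Γ.coeFn_pull b] with s h1 h2 h3 h4
    rw [h3, h4, h1, h2, RCLike.inner_apply, mul_comm]
  have hInt := (L2.integrable_inner (𝕜 := ℂ) (Γ.pull h) (Γ.pull b)).congr hae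
  refine ⟨hInt.re, ?_⟩
  rw [← Γ.pull.inner_map_map, L2.inner_def, integral_congr_ae hae]
  exact (integral_re hInt).symm

/-- The closure of the singular operator is bounded from above by `C - c log n` on functions with
vanishing averages over the `n` cells. -/
theorem exists_re_inner_le (lam : ℝ) : ∃ c C : ℝ, 0 < c ∧ ∀ n : ℕ, 0 < n →
    ∀ h b : Γ.L2, (h, b) ∈ Γ.graphBClosure lam →
    (∀ i : Fin n, Γ.cellMoment (Γ.L / n) 0 i h = 0) →
    (inner ℂ h b).re ≤ (C - c * Real.log n) * ‖h‖ ^ 2 := by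
  obtain ⟨M, hM⟩ := Γ.exists_integral_green_le lam
  have hpi := Real.pi_pos
  have hL := Γ.L_pos
  set e : ℝ := Real.exp (-√(-lam) * Γ.L) / (8 * Real.pi) with he
  have he0 : 0 < e := by positivity
  -- `M` bounds the regularized potential; the other terms are the lower bound of `log_energy_le`
  -- multiplied by the comparison constant `e`.
  refine ⟨2 * e, M + e * (2 * Real.log 2 + 8), by positivity, fun n hn h b hb hmom => ?_⟩
  have hn0 : (0 : ℝ) < n := by exact_mod_cast hn
  have ha : 0 < Γ.L / n := by positivity
  -- Lipschitz approximants of `h` need not have vanishing averages. The inequality is therefore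
  -- proved on the whole graph with an error term in the moments, which is a closed condition; the
  -- error vanishes only at the limit. The factor `L + ‖h‖²` comes from `‖f‖ ≤ (1 + ‖f‖²) / 2`.
  set S : Set (Γ.L2 × Γ.L2) := {p | (inner ℂ p.1 p.2).re
    ≤ (M + e * (2 * Real.log 2 + 8) - 2 * e * Real.log n) * ‖p.1‖ ^ 2
      + e * (Γ.L / n)⁻¹ * (∑ i : Fin n, ‖Γ.cellMoment (Γ.L / n) 0 i p.1‖)
        * (Γ.L + ‖p.1‖ ^ 2)} with hS
  have hSclosed : IsClosed S := by
    refine isClosed_le (Complex.continuous_re.comp (continuous_fst.inner continuous_snd)) ?_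
    fun_prop
  have hsub : Γ.graphB lam ⊆ S := by
    rintro ⟨h, b⟩ ⟨h', g, ⟨K, hK⟩, hlim, hh, hg⟩
    have hf := Γ.ae_comp_σ hh
    have hg' := Γ.ae_comp_σ hg
    have hcont := continuous_comp_σ_of_lipschitzOn hK
    obtain ⟨hInt, hre⟩ := Γ.re_inner_eq_integral_Ico h b hf hg'
    have hnorm := Γ.norm_sq_eq_integral_Ico h hf
    obtain ⟨hIint, henergy⟩ := energy_le hK lam ha
    have hlog := log_energy_le hL hn hcont
    have hcont2 : Continuous fun s => ‖h' (Γ.σ s)‖ ^ 2 := hcont.norm.pow 2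
    set I : ℝ → ℝ := fun s => ∫ y, ((h' (Γ.σ s) - h' y) * starRingEnd ℂ (h' (Γ.σ s))).re
        * green lam (Γ.σ s) y ∂Γ.arcLength with hI
    have hInt2 : Integrable (fun s => ‖h' (Γ.σ s)‖ ^ 2 * M) (volume.restrict (Set.Ico 0 Γ.L)) :=
      integrable_Ico_of_continuous (hcont2.mul_const M)
    have hle : ∫ s in Set.Ico 0 Γ.L, (starRingEnd ℂ (h' (Γ.σ s)) * g (Γ.σ s)).re
        ≤ ∫ s in Set.Ico 0 Γ.L, (‖h' (Γ.σ s)‖ ^ 2 * M - I s) :=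
      integral_mono hInt (hInt2.sub hIint) fun s =>
        re_conj_mul_le hK hM ⟨s, rfl⟩ (hlim _ ⟨s, rfl⟩)
    rw [integral_sub hInt2 hIint, integral_mul_const] at hle
    have hL1 : ∫ s in Set.Ico 0 Γ.L, ‖h' (Γ.σ s)‖ ≤ (Γ.L + ‖h‖ ^ 2) / 2 := by
      have h1 : ∫ s in Set.Ico 0 Γ.L, ‖h' (Γ.σ s)‖
          ≤ ∫ s in Set.Ico 0 Γ.L, (1 / 2 + 1 / 2 * ‖h' (Γ.σ s)‖ ^ 2) := by
        refine integral_mono (integrable_Ico_of_continuous hcont.norm)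
          (integrable_Ico_of_continuous (continuous_const.add (hcont2.const_mul _))) fun s => ?_
        nlinarith [sq_nonneg (‖h' (Γ.σ s)‖ - 1)]
      rw [integral_add (integrable_Ico_of_continuous continuous_const)
        (integrable_Ico_of_continuous (hcont2.const_mul _)), integral_const_mul, ← hnorm] at h1
      simp [hL.le] at h1
      linarith
    have hmomeq : ∀ i : Fin n, ∫ t in cell (Γ.L / n) i, h' (Γ.σ t)
        = Γ.cellMoment (Γ.L / n) 0 i h := by
      intro i
      rw [Γ.cellMoment_apply 0 i h hf]
      simp
    simp only [hmomeq] at hlog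
    rw [← hnorm] at hlog hle
    simp only [hS, Set.mem_ofPred_eq]
    rw [hre]
    set m : ℝ := ∑ i : Fin n, ‖Γ.cellMoment (Γ.L / n) 0 i h‖ with hm
    have hm0 : 0 ≤ m := Finset.sum_nonneg fun i _ => norm_nonneg _
    have h5 : 2 * (Γ.L / n)⁻¹ * m * (∫ s in Set.Ico 0 Γ.L, ‖h' (Γ.σ s)‖)
        ≤ 2 * (Γ.L / n)⁻¹ * m * ((Γ.L + ‖h‖ ^ 2) / 2) := by gcongr
    have h6 := mul_le_mul_of_nonneg_left (hlog.trans' (sub_le_sub_left h5 _)) he0.le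
    nlinarith [h6, henergy, hle]
  have hmem : (h, b) ∈ S := closure_minimal hsub hSclosed hb
  simp only [hS, Set.mem_ofPred_eq, hmom, norm_zero, Finset.sum_const_zero, mul_zero, zero_mul,
    add_zero] at hmem
  exact hmem

end ClosedCurve

namespace ClosedCurve

variable (Γ : ClosedCurve)

/-! ### Fourier transforms of densities on the curve -/

/-- The character `s ↦ exp (2πi ⟨ξ, σ s⟩)`. -/
noncomputable def character (ξ : E3) (s : ℝ) : ℂ :=
  Complex.exp (2 * Real.pi * Complex.I * ((inner ℝ ξ (Γ.σ s) : ℝ) : ℂ))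

/-- The inverse Fourier transform of the density `f` on the curve. -/
noncomputable def curveFourier (f : ℝ → ℂ) (ξ : E3) : ℂ :=
  ∫ s in Set.Ico 0 Γ.L, f s * Γ.character ξ s

theorem norm_character (ξ : E3) (s : ℝ) : ‖Γ.character ξ s‖ = 1 := by
  rw [character, Complex.norm_exp]
  simp

theorem continuous_character : Continuous fun p : E3 × ℝ => Γ.character p.1 p.2 := by
  unfold character
  have := Γ.continuous_σ
  fun_prop

theorem continuous_curveFourier {f : ℝ → ℂ}
    (hf : Integrable f (volume.restrict (Set.Ico 0 Γ.L))) : Continuous (Γ.curveFourier f) := by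
  refine continuous_of_dominated (bound := fun s => ‖f s‖) (fun ξ => ?_) (fun ξ => ?_) hf.norm ?_
  · exact hf.aestronglyMeasurable.mul
      (Γ.continuous_character.comp (by fun_prop : Continuous fun s : ℝ => (ξ, s))).aestronglyMeasurable
  · exact Eventually.of_forall fun s => by rw [norm_mul, norm_character, mul_one]
  · exact Eventually.of_forall fun s => continuous_const.mul
      (Γ.continuous_character.comp (by fun_prop : Continuous fun ξ : E3 => (ξ, s)))

/-- Only the modulus matters, because the result serves as a kernel in Schur's test. -/
theorem norm_integral_gaussian_mul {t : ℝ} (ht : 0 < t) (w : E3) :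
    ‖∫ ξ : E3, Complex.exp (-(t : ℂ) * (‖ξ‖ : ℂ) ^ 2
      + 2 * Real.pi * Complex.I * ((inner ℝ w ξ : ℝ) : ℂ))‖
      = (Real.pi / t) ^ (3 / 2 : ℝ) * Real.exp (-(Real.pi ^ 2 / t) * ‖w‖ ^ 2) := by
  have hpi := Real.pi_pos
  rw [GaussianFourier.integral_cexp_neg_mul_sq_norm_add (by simpa using ht), norm_mul,
    Complex.norm_exp]
  congr 1
  · have : (Real.pi / t : ℂ) ^ ((Module.finrank ℝ E3 : ℂ) / 2)
        = (((Real.pi / t) ^ (3 / 2 : ℝ) : ℝ) : ℂ) := by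
      rw [Complex.ofReal_cpow (by positivity)]
      simp
    rw [this, Complex.norm_real, Real.norm_of_nonneg (by positivity)]
  · congr 1
    have : (2 * Real.pi * Complex.I) ^ 2 * (‖w‖ : ℂ) ^ 2 / (4 * t)
        = ((-(Real.pi ^ 2 / t) * ‖w‖ ^ 2 : ℝ) : ℂ) := by
      have ht' : (t : ℂ) ≠ 0 := by exact_mod_cast ht.ne'
      push_cast
      rw [mul_pow, Complex.I_sq]
      field_simp
      ring
    rw [this, Complex.ofReal_re]

/-- Row integrals of Gaussian kernels on the curve. -/
theorem exists_integral_gaussian_le : ∃ C : ℝ, 0 < C ∧ ∀ t : ℝ, 0 < t → ∀ s : ℝ,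
    (Real.pi / t) ^ (3 / 2 : ℝ) * ∫ r in Set.Ico 0 Γ.L,
      Real.exp (-(Real.pi ^ 2 / t) * ‖Γ.σ s - Γ.σ r‖ ^ 2) ≤ C / t := by
  obtain ⟨c, hc0, hc⟩ := Γ.exists_mul_abs_le_norm_σ_sub
  have hpi := Real.pi_pos
  have hL := Γ.L_pos
  refine ⟨Real.pi / c, by positivity, fun t ht s => ?_⟩
  have hσ := Γ.continuous_σ
  have hmeas : AEStronglyMeasurable
      (fun y => Real.exp (-(Real.pi ^ 2 / t) * ‖Γ.σ s - y‖ ^ 2)) Γ.arcLength :=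
    Continuous.aestronglyMeasurable (by fun_prop)
  have e1 : ∫ r in Set.Ico 0 Γ.L, Real.exp (-(Real.pi ^ 2 / t) * ‖Γ.σ s - Γ.σ r‖ ^ 2)
      = ∫ y, Real.exp (-(Real.pi ^ 2 / t) * ‖Γ.σ s - y‖ ^ 2) ∂Γ.arcLength := by
    have := hmeas
    rw [← Γ.measurePreserving_σ.map_eq] at this ⊢
    rw [integral_map Γ.measurable_σ.aemeasurable this]
  -- The period is recentred at `s`, so that the chord is at least `c |s - r|` on all of it. A
  -- one-dimensional Gaussian integral then gains `t^(1/2)` against the factor `t^(-3/2)`.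
  have e2 : ∫ y, Real.exp (-(Real.pi ^ 2 / t) * ‖Γ.σ s - y‖ ^ 2) ∂Γ.arcLength
      = ∫ r in Set.Ioc (s - Γ.L / 2) (s - Γ.L / 2 + Γ.L),
        Real.exp (-(Real.pi ^ 2 / t) * ‖Γ.σ s - Γ.σ r‖ ^ 2) := by
    have := hmeas
    rw [← (Γ.measurePreserving_σ_Ioc (s - Γ.L / 2)).map_eq] at this ⊢
    rw [integral_map Γ.measurable_σ.aemeasurable this]
  set β : ℝ := Real.pi ^ 2 * c ^ 2 / t with hβ
  have hβ0 : 0 < β := by positivity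
  have hG : Integrable fun r : ℝ => Real.exp (-β * (r - s) ^ 2) :=
    (integrable_exp_neg_mul_sq hβ0).comp_sub_right s
  have e3 : ∫ r in Set.Ioc (s - Γ.L / 2) (s - Γ.L / 2 + Γ.L),
        Real.exp (-(Real.pi ^ 2 / t) * ‖Γ.σ s - Γ.σ r‖ ^ 2)
      ≤ ∫ r in Set.Ioc (s - Γ.L / 2) (s - Γ.L / 2 + Γ.L), Real.exp (-β * (r - s) ^ 2) := by
    refine setIntegral_mono_on ?_ hG.integrableOn measurableSet_Ioc fun r hr => ?_
    · exact ((by fun_prop : Continuous fun r =>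
        Real.exp (-(Real.pi ^ 2 / t) * ‖Γ.σ s - Γ.σ r‖ ^ 2)).continuousOn.integrableOn_compact
          isCompact_Icc).mono_set Set.Ioc_subset_Icc_self
    · refine Real.exp_le_exp.2 ?_
      have h1 := hc s r (abs_le.2 ⟨by linarith [hr.2], by linarith [hr.1]⟩)
      have h2 : (c * |s - r|) ^ 2 ≤ ‖Γ.σ s - Γ.σ r‖ ^ 2 := by gcongr
      rw [mul_pow, sq_abs] at h2
      have h3 : Real.pi ^ 2 / t * (c ^ 2 * (s - r) ^ 2) ≤ Real.pi ^ 2 / t * ‖Γ.σ s - Γ.σ r‖ ^ 2 := by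
        gcongr
      have h4 : β * (r - s) ^ 2 = Real.pi ^ 2 / t * (c ^ 2 * (s - r) ^ 2) := by
        rw [hβ]
        ring
      linarith
  have e4 : ∫ r in Set.Ioc (s - Γ.L / 2) (s - Γ.L / 2 + Γ.L), Real.exp (-β * (r - s) ^ 2)
      ≤ √(Real.pi / β) := by
    rw [← integral_gaussian β]
    refine (setIntegral_le_integral hG (Eventually.of_forall fun r => (Real.exp_pos _).le)).trans ?_
    rw [integral_sub_right_eq_self (fun r : ℝ => Real.exp (-β * r ^ 2)) s]
  rw [e1, e2]
  refine (mul_le_mul_of_nonneg_left (e3.trans e4) (by positivity)).trans (le_of_eq ?_)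
  have e5 : Real.pi / β = (Real.pi / t) * (t / (Real.pi * c)) ^ 2 := by
    rw [hβ]
    field_simp
  have e6 : (Real.pi / t) ^ (3 / 2 : ℝ) * √(Real.pi / t) = (Real.pi / t) ^ 2 := by
    rw [Real.sqrt_eq_rpow, ← Real.rpow_add (by positivity), ← Real.rpow_natCast]
    norm_num
  rw [e5, Real.sqrt_mul (by positivity), Real.sqrt_sq (by positivity), ← mul_assoc, e6]
  field_simp

/-- Gaussian averages of the Fourier transform of a square integrable density on the curve. -/
theorem exists_integral_gaussian_curveFourier_le : ∃ C : ℝ, 0 < C ∧ ∀ t : ℝ, 0 < t →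
    ∀ f : ℝ → ℂ, MemLp f 2 (volume.restrict (Set.Ico 0 Γ.L)) →
    Integrable (fun ξ : E3 => Real.exp (-t * ‖ξ‖ ^ 2) * ‖Γ.curveFourier f ξ‖ ^ 2) ∧
    ∫ ξ : E3, Real.exp (-t * ‖ξ‖ ^ 2) * ‖Γ.curveFourier f ξ‖ ^ 2
      ≤ C / t * ∫ s in Set.Ico 0 Γ.L, ‖f s‖ ^ 2 := by
  obtain ⟨C, hC0, hC⟩ := Γ.exists_integral_gaussian_le
  refine ⟨C, hC0, fun t ht f hf => ?_⟩
  have hpi := Real.pi_pos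
  have hσ := Γ.continuous_σ
  set ν : Measure ℝ := volume.restrict (Set.Ico 0 Γ.L) with hν
  have hf1 : Integrable f ν := hf.integrable (by norm_num)
  have hgauss : Integrable fun ξ : E3 => Real.exp (-t * ‖ξ‖ ^ 2) := by
    have := GaussianFourier.integrable_cexp_neg_mul_sq_norm_add (V := E3) (b := (t : ℂ))
      (by simpa using ht) 0 0
    refine this.norm.congr (Eventually.of_forall fun ξ => ?_)
    simp only
    rw [Complex.norm_exp]
    congr 1
    simp [← Complex.ofReal_pow]
  have hcont := Γ.continuous_curveFourier hf1
  have hbdd : ∀ ξ, ‖Γ.curveFourier f ξ‖ ≤ ∫ s, ‖f s‖ ∂ν := fun ξ => by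
    refine (norm_integral_le_integral_norm _).trans (le_of_eq ?_)
    simp [norm_character, hν]
  have hInt : Integrable (fun ξ : E3 => Real.exp (-t * ‖ξ‖ ^ 2) * ‖Γ.curveFourier f ξ‖ ^ 2) := by
    refine hgauss.mul_bdd (c := (∫ s, ‖f s‖ ∂ν) ^ 2) (by fun_prop) ?_
    refine Eventually.of_forall fun ξ => ?_
    rw [norm_pow, norm_norm]
    gcongr
    exact hbdd ξ
  refine ⟨hInt, ?_⟩
  -- The square of the transform is a double integral over the curve. Integrating in `ξ` first
  -- leaves a Gaussian kernel in `σ s - σ t`, with row integrals `O(1/t)`.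
  set F : E3 → ℝ × ℝ → ℂ := fun ξ p => (Real.exp (-t * ‖ξ‖ ^ 2) : ℂ)
    * ((f p.1 * Γ.character ξ p.1) * starRingEnd ℂ (f p.2 * Γ.character ξ p.2)) with hF
  have hpt : ∀ ξ, ((Real.exp (-t * ‖ξ‖ ^ 2) * ‖Γ.curveFourier f ξ‖ ^ 2 : ℝ) : ℂ)
      = ∫ p, F ξ p ∂(ν.prod ν) := by
    intro ξ
    rw [hF]
    simp only
    rw [integral_const_mul, integral_prod_mul (fun s => f s * Γ.character ξ s)
      (fun s => starRingEnd ℂ (f s * Γ.character ξ s)), integral_conj]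
    rw [Complex.ofReal_mul]
    congr 1
    rw [Complex.mul_conj']
    push_cast
    rfl
  have hFint : Integrable (Function.uncurry F) (volume.prod (ν.prod ν)) := by
    have hf1c : Integrable (fun s => starRingEnd ℂ (f s)) ν :=
      hf1.norm.mono' (Complex.continuous_conj.comp_aestronglyMeasurable hf1.1)
        (Eventually.of_forall fun s => by rw [RCLike.norm_conj])
    have h0 : Integrable (fun z : E3 × (ℝ × ℝ) => ((Real.exp (-t * ‖z.1‖ ^ 2) : ℝ) : ℂ)
        * (f z.2.1 * starRingEnd ℂ (f z.2.2))) (volume.prod (ν.prod ν)) :=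
      (hgauss.ofReal (𝕜 := ℂ)).mul_prod (hf1.mul_prod (ν := ν) hf1c)
    have hc1 : Continuous fun q : E3 × (ℝ × ℝ) => Γ.character q.1 q.2.1 :=
      Γ.continuous_character.comp (by fun_prop : Continuous fun q : E3 × (ℝ × ℝ) => (q.1, q.2.1))
    have hc2 : Continuous fun q : E3 × (ℝ × ℝ) => starRingEnd ℂ (Γ.character q.1 q.2.2) :=
      Complex.continuous_conj.comp (Γ.continuous_character.comp
        (by fun_prop : Continuous fun q : E3 × (ℝ × ℝ) => (q.1, q.2.2)))
    have hc : Continuous fun q : E3 × (ℝ × ℝ) =>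
        Γ.character q.1 q.2.1 * starRingEnd ℂ (Γ.character q.1 q.2.2) := hc1.mul hc2
    refine (h0.mul_bdd (c := 1) hc.aestronglyMeasurable ?_).congr ?_
    · exact Eventually.of_forall fun q => by
        rw [norm_mul, RCLike.norm_conj, norm_character, norm_character, one_mul]
    · refine Eventually.of_forall fun q => ?_
      simp only [hF, Function.uncurry, map_mul]
      ring
  have hswap : ((∫ ξ : E3, Real.exp (-t * ‖ξ‖ ^ 2) * ‖Γ.curveFourier f ξ‖ ^ 2 : ℝ) : ℂ)
      = ∫ p, (∫ ξ, F ξ p) ∂(ν.prod ν) := by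
    rw [← integral_complex_ofReal]
    simp_rw [hpt]
    exact integral_integral_swap hFint
  have hinner : ∀ p : ℝ × ℝ, ‖∫ ξ, F ξ p‖ = ‖f p.1‖ * ‖f p.2‖ *
      ((Real.pi / t) ^ (3 / 2 : ℝ) * Real.exp (-(Real.pi ^ 2 / t) * ‖Γ.σ p.1 - Γ.σ p.2‖ ^ 2)) := by
    intro p
    have : ∀ ξ, F ξ p = f p.1 * starRingEnd ℂ (f p.2) * Complex.exp (-(t : ℂ) * (‖ξ‖ : ℂ) ^ 2
      + 2 * Real.pi * Complex.I * ((inner ℝ (Γ.σ p.1 - Γ.σ p.2) ξ : ℝ) : ℂ)) := by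
      intro ξ
      rw [hF]
      simp only [character]
      have hconj : starRingEnd ℂ (2 * Real.pi * Complex.I * ((inner ℝ ξ (Γ.σ p.2) : ℝ) : ℂ))
          = -(2 * Real.pi * Complex.I * ((inner ℝ ξ (Γ.σ p.2) : ℝ) : ℂ)) := by
        rw [map_mul, map_mul, map_mul, Complex.conj_I, Complex.conj_ofReal, Complex.conj_ofReal,
          map_ofNat]
        ring
      rw [map_mul, ← Complex.exp_conj, hconj, Complex.ofReal_exp, inner_sub_left,
        real_inner_comm ξ (Γ.σ p.1), real_inner_comm ξ (Γ.σ p.2)]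
      have hexp : Complex.exp (-(t : ℂ) * (‖ξ‖ : ℂ) ^ 2 + 2 * Real.pi * Complex.I
          * ((inner ℝ ξ (Γ.σ p.1) - inner ℝ ξ (Γ.σ p.2) : ℝ) : ℂ))
          = Complex.exp ((-t * ‖ξ‖ ^ 2 : ℝ) : ℂ)
            * Complex.exp (2 * Real.pi * Complex.I * ((inner ℝ ξ (Γ.σ p.1) : ℝ) : ℂ))
            * Complex.exp (-(2 * Real.pi * Complex.I * ((inner ℝ ξ (Γ.σ p.2) : ℝ) : ℂ))) := by
        rw [← Complex.exp_add, ← Complex.exp_add]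
        congr 1
        push_cast
        ring
      rw [hexp]
      ring
    simp_rw [this]
    rw [integral_const_mul, norm_mul, norm_mul, RCLike.norm_conj, norm_integral_gaussian_mul ht]
  have hq : Continuous fun p : ℝ × ℝ => (Real.pi / t) ^ (3 / 2 : ℝ)
      * Real.exp (-(Real.pi ^ 2 / t) * ‖Γ.σ p.1 - Γ.σ p.2‖ ^ 2) := by fun_prop
  have hschur := integral_norm_mul_norm_mul_le hf hq (fun p => by positivity)
    (fun s t => by simp only [norm_sub_rev]) (C := C / t) (fun s _ => by
      rw [integral_const_mul]
      exact hC t ht s)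
  have hle : ‖((∫ ξ : E3, Real.exp (-t * ‖ξ‖ ^ 2) * ‖Γ.curveFourier f ξ‖ ^ 2 : ℝ) : ℂ)‖
      ≤ C / t * ∫ s, ‖f s‖ ^ 2 ∂ν := by
    rw [hswap]
    refine (norm_integral_le_integral_norm _).trans ?_
    simp_rw [hinner]
    exact hschur.2
  rw [Complex.norm_real] at hle
  exact (le_abs_self _).trans hle

end ClosedCurve

/-! ### Second primitives of functions with vanishing moments -/

section Primitive

/-- The second primitive of `f` on `[p, q)` that vanishes to second order at `p`. -/
noncomputable def secondPrimitive (f : ℝ → ℂ) (p q s : ℝ) : ℂ :=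
  ∫ r in Set.Ico p q, ((max (s - r) 0 : ℝ) : ℂ) * f r

variable {f : ℝ → ℂ} {p q : ℝ}

theorem norm_secondPrimitive_le (hf : IntegrableOn f (Set.Ico p q)) {s : ℝ}
    (hs : s ∈ Set.Ico p q) :
    ‖secondPrimitive f p q s‖ ≤ (q - p) * ∫ r in Set.Ico p q, ‖f r‖ := by
  rw [← integral_const_mul]
  refine norm_integral_le_of_norm_le (hf.norm.const_mul _) ?_
  filter_upwards [ae_restrict_mem measurableSet_Ico] with r hr
  rw [norm_mul, Complex.norm_real, Real.norm_of_nonneg (le_max_right _ _)]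
  gcongr
  exact max_le (by linarith [hs.2, hr.1]) (by linarith [hs.1, hs.2])

theorem continuous_secondPrimitive (hf : IntegrableOn f (Set.Ico p q)) :
    Continuous (secondPrimitive f p q) := by
  rw [continuous_iff_continuousAt]
  intro s₀
  refine continuousAt_of_dominated (bound := fun r => (|s₀| + 1 + |p| + |q|) * ‖f r‖) ?_ ?_
    (hf.norm.const_mul _) ?_
  · refine Eventually.of_forall fun s => ?_
    exact (Continuous.aestronglyMeasurable (by fun_prop)).mul hf.aestronglyMeasurable
  · filter_upwards [Metric.ball_mem_nhds s₀ one_pos] with s hs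
    filter_upwards [ae_restrict_mem measurableSet_Ico] with r hr
    rw [norm_mul, Complex.norm_real, Real.norm_of_nonneg (le_max_right _ _)]
    gcongr
    rw [Metric.mem_ball, Real.dist_eq] at hs
    have h1 := abs_lt.1 hs
    refine max_le ?_ (by positivity)
    linarith [le_abs_self s₀, neg_abs_le p, abs_nonneg q, hr.1]
  · exact Eventually.of_forall fun r => Continuous.continuousAt (by fun_prop)

/-- The integral of `(‖f‖ - x)²` is nonnegative; taking for `x` the mean of `‖f‖` gives the
Cauchy-Schwarz bound. -/
theorem sq_integral_norm_le (hpq : p ≤ q) (hf : IntegrableOn f (Set.Ico p q))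
    (hf2 : IntegrableOn (fun r => ‖f r‖ ^ 2) (Set.Ico p q)) :
    (∫ r in Set.Ico p q, ‖f r‖) ^ 2 ≤ (q - p) * ∫ r in Set.Ico p q, ‖f r‖ ^ 2 := by
  set I := ∫ r in Set.Ico p q, ‖f r‖ with hI
  set J := ∫ r in Set.Ico p q, ‖f r‖ ^ 2 with hJ
  have key : ∀ x : ℝ, 0 ≤ J - 2 * x * I + x ^ 2 * (q - p) := by
    intro x
    have h0 : 0 ≤ ∫ r in Set.Ico p q, (‖f r‖ - x) ^ 2 := integral_nonneg fun r => sq_nonneg _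
    have h1 : ∫ r in Set.Ico p q, (‖f r‖ - x) ^ 2 = J - 2 * x * I + x ^ 2 * (q - p) := by
      have e : ∀ r, (‖f r‖ - x) ^ 2 = ‖f r‖ ^ 2 - 2 * x * ‖f r‖ + x ^ 2 := fun r => by ring
      have i1 : Integrable (fun r => 2 * x * ‖f r‖) (volume.restrict (Set.Ico p q)) :=
        hf.norm.const_mul _
      have i2 : Integrable (fun r => ‖f r‖ ^ 2 - 2 * x * ‖f r‖) (volume.restrict (Set.Ico p q)) :=
        Integrable.sub hf2 i1
      simp_rw [e]
      rw [integral_add i2 (integrable_const _), integral_sub hf2 i1, integral_const_mul]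
      simp only [integral_const, MeasurableSet.univ, measureReal_restrict_apply, Set.univ_inter,
        Real.volume_real_Ico_of_le hpq, smul_eq_mul]
      ring
    linarith
  rcases eq_or_lt_of_le hpq with h | h
  · subst h
    simp [hI]
  · have hd : 0 < q - p := by linarith
    have := key (I / (q - p))
    have e : J - 2 * (I / (q - p)) * I + (I / (q - p)) ^ 2 * (q - p) = J - I ^ 2 / (q - p) := by
      field_simp
      ring
    rw [e, sub_nonneg, div_le_iff₀ hd] at this
    linarith

/-- Of the four powers of `q - p`, two come from the squared kernel, one from Cauchy-Schwarz and one
from integrating in `s`. -/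
theorem integral_norm_sq_secondPrimitive_le (hpq : p ≤ q) (hf : IntegrableOn f (Set.Ico p q))
    (hf2 : IntegrableOn (fun r => ‖f r‖ ^ 2) (Set.Ico p q)) :
    ∫ s in Set.Ico p q, ‖secondPrimitive f p q s‖ ^ 2
      ≤ (q - p) ^ 4 * ∫ r in Set.Ico p q, ‖f r‖ ^ 2 := by
  have h1 : ∫ s in Set.Ico p q, ‖secondPrimitive f p q s‖ ^ 2
      ≤ ∫ s in Set.Ico p q, (q - p) ^ 2 * ((q - p) * ∫ r in Set.Ico p q, ‖f r‖ ^ 2) := by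
    refine setIntegral_mono_on ?_ (integrable_const _) measurableSet_Ico fun s hs => ?_
    · exact (((continuous_secondPrimitive hf).norm.pow 2).continuousOn.integrableOn_compact
        isCompact_Icc).mono_set Set.Ico_subset_Icc_self
    · have h2 := norm_secondPrimitive_le hf hs
      calc ‖secondPrimitive f p q s‖ ^ 2 ≤ ((q - p) * ∫ r in Set.Ico p q, ‖f r‖) ^ 2 := by gcongr
        _ = (q - p) ^ 2 * (∫ r in Set.Ico p q, ‖f r‖) ^ 2 := by ring
        _ ≤ _ := by
          gcongr
          exact sq_integral_norm_le hpq hf hf2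
  refine h1.trans (le_of_eq ?_)
  rw [integral_const]
  simp [hpq]
  ring

/-- Integration by parts against a function with vanishing moments of order zero and one. -/
theorem integral_mul_eq_integral_secondPrimitive (hpq : p ≤ q) (hf : IntegrableOn f (Set.Ico p q))
    (h0 : ∫ r in Set.Ico p q, f r = 0) (h1 : ∫ r in Set.Ico p q, (r : ℂ) * f r = 0)
    {φ φ' φ'' : ℝ → ℂ} (hφ : ∀ s, HasDerivAt φ (φ' s) s) (hφ' : ∀ s, HasDerivAt φ' (φ'' s) s)
    (hc : Continuous φ'') :
    ∫ r in Set.Ico p q, f r * φ r = ∫ s in Set.Ico p q, secondPrimitive f p q s * φ'' s := by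
  -- Taylor's formula at the right end point `q` with integral remainder. The vanishing moments
  -- annihilate the linear polynomial, and Fubini transfers the kernel `max (s - r) 0` from `φ''` to
  -- `f`.
  have htaylor : ∀ r ∈ Set.Ico p q, φ r = φ q + φ' q * (r - q)
      + ∫ s in Set.Ico p q, ((max (s - r) 0 : ℝ) : ℂ) * φ'' s := by
    intro r hr
    have hcont : Continuous fun s : ℝ => ((max (s - r) 0 : ℝ) : ℂ) * φ'' s := by fun_prop
    have e1 : ∫ s in Set.Ico p q, ((max (s - r) 0 : ℝ) : ℂ) * φ'' s
        = ∫ s in p..q, ((max (s - r) 0 : ℝ) : ℂ) * φ'' s := by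
      rw [intervalIntegral.integral_of_le hpq, integral_Ico_eq_integral_Ioc]
    have e2 : ∫ s in p..r, ((max (s - r) 0 : ℝ) : ℂ) * φ'' s = 0 := by
      refine (intervalIntegral.integral_congr (g := fun _ => 0) fun s hs => ?_).trans (by simp)
      rw [Set.uIcc_of_le hr.1] at hs
      simp [max_eq_right (by linarith [hs.2] : s - r ≤ 0)]
    have e3 : ∫ s in r..q, ((max (s - r) 0 : ℝ) : ℂ) * φ'' s
        = ((q - r : ℂ) * φ' q - φ q) - ((r - r : ℂ) * φ' r - φ r) := by
      refine intervalIntegral.integral_eq_sub_of_hasDerivAt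
        (f := fun s : ℝ => (s - r : ℂ) * φ' s - φ s) (fun s hs => ?_) (hcont.intervalIntegrable _ _)
      rw [Set.uIcc_of_le hr.2.le] at hs
      have hd : HasDerivAt (fun s : ℝ => (s - r : ℂ)) 1 s :=
        (hasDerivAt_id s).ofReal_comp.sub_const _
      refine ((hd.mul (hφ' s)).sub (hφ s)).congr_deriv ?_
      rw [max_eq_left (by linarith [hs.1] : 0 ≤ s - r)]
      push_cast
      ring
    rw [e1, ← intervalIntegral.integral_add_adjacent_intervals (hcont.intervalIntegrable p r)
      (hcont.intervalIntegrable r q), e2, e3]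
    ring
  have hrf : IntegrableOn (fun r : ℝ => (r : ℂ) * f r) (Set.Ico p q) := by
    refine Integrable.bdd_mul (c := |p| + |q|) hf
      (Continuous.aestronglyMeasurable (by fun_prop)) ?_
    filter_upwards [ae_restrict_mem measurableSet_Ico] with r hr
    rw [Complex.norm_real, Real.norm_eq_abs, abs_le]
    constructor
    · linarith [neg_abs_le p, abs_nonneg q, hr.1]
    · linarith [le_abs_self q, abs_nonneg p, hr.2]
  obtain ⟨B, hB⟩ := (isCompact_Icc (a := p) (b := q)).exists_bound_of_continuousOn hc.continuousOn
  have hker : Integrable (Function.uncurry fun r s : ℝ =>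
      f r * (((max (s - r) 0 : ℝ) : ℂ) * φ'' s))
      ((volume.restrict (Set.Ico p q)).prod (volume.restrict (Set.Ico p q))) := by
    have hcont : Continuous fun x : ℝ × ℝ => ((max (x.2 - x.1) 0 : ℝ) : ℂ) * φ'' x.2 := by
      fun_prop
    refine (Integrable.comp_fst hf (volume.restrict (Set.Ico p q))).mul_bdd
      (c := (q - p) * B) hcont.aestronglyMeasurable ?_
    rw [Measure.prod_restrict]
    filter_upwards [ae_restrict_mem (measurableSet_Ico.prod measurableSet_Ico)] with x hx
    rw [norm_mul, Complex.norm_real, Real.norm_of_nonneg (le_max_right _ _)]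
    have hx1 := hx.1.1
    have hx2 := hx.2.2
    refine mul_le_mul (max_le ?_ ?_) (hB _ (Set.Ico_subset_Icc_self hx.2)) (norm_nonneg _) ?_ <;>
      linarith
  have hI : Integrable (fun r => ∫ s in Set.Ico p q, f r * (((max (s - r) 0 : ℝ) : ℂ) * φ'' s))
    (volume.restrict (Set.Ico p q)) := hker.integral_prod_left
  have e1 : ∫ r in Set.Ico p q, f r * φ r = ∫ r in Set.Ico p q,
      ((φ q - φ' q * q) * f r + φ' q * ((r : ℂ) * f r)
        + ∫ s in Set.Ico p q, f r * (((max (s - r) 0 : ℝ) : ℂ) * φ'' s)) := by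
    refine setIntegral_congr_fun measurableSet_Ico fun r hr => ?_
    rw [htaylor r hr, integral_const_mul]
    ring
  have i1 : Integrable (fun r => (φ q - φ' q * q) * f r) (volume.restrict (Set.Ico p q)) :=
    Integrable.const_mul hf _
  have i2 : Integrable (fun r : ℝ => φ' q * ((r : ℂ) * f r)) (volume.restrict (Set.Ico p q)) :=
    Integrable.const_mul hrf _
  have i12 : Integrable (fun r : ℝ => (φ q - φ' q * q) * f r + φ' q * ((r : ℂ) * f r))
    (volume.restrict (Set.Ico p q)) := i1.add i2
  rw [e1, integral_add i12 hI, integral_add i1 i2, integral_const_mul, integral_const_mul, h0, h1,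
    mul_zero, mul_zero, add_zero, zero_add]
  refine (integral_integral_swap hker).trans ?_
  refine integral_congr_ae (Eventually.of_forall fun s => ?_)
  simp only [secondPrimitive]
  rw [← integral_mul_const]
  refine integral_congr_ae (Eventually.of_forall fun r => ?_)
  simp only
  ring

end Primitive

/-! ### Second primitives assembled over the cells -/

section CellPrimitive

/-- The function that is the second primitive of `f` on each of the first `n` cells. -/
noncomputable def cellPrimitive (a : ℝ) (n : ℕ) (f : ℝ → ℂ) (s : ℝ) : ℂ :=
  ∑ i : Fin n, (cell a i).indicator (secondPrimitive f (i * a) ((i + 1) * a)) s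

variable {a L : ℝ} {n : ℕ} {f : ℝ → ℂ}

theorem cellPrimitive_of_mem (ha : 0 < a) {i : Fin n} {s : ℝ} (hs : s ∈ cell a i) :
    cellPrimitive a n f s = secondPrimitive f (i * a) ((i + 1) * a) s := by
  rw [cellPrimitive, Finset.sum_eq_single i]
  · rw [Set.indicator_of_mem hs]
  · intro j _ hji
    exact Set.indicator_of_notMem
      (fun hj => Set.disjoint_left.1 (pairwise_disjoint_cell ha n hji) hj hs) _
  · simp

theorem cell_subset_Ico (ha : 0 < a) (hL : n * a = L) (i : Fin n) : cell a i ⊆ Set.Ico 0 L := by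
  rw [← hL, ← iUnion_cell ha n]
  exact Set.subset_iUnion (fun i : Fin n => cell a i) i

theorem memLp_cellPrimitive (ha : 0 < a) (hL : n * a = L)
    (hf : MemLp f 2 (volume.restrict (Set.Ico 0 L))) :
    MemLp (cellPrimitive a n f) 2 (volume.restrict (Set.Ico 0 L)) := by
  have hf1 : IntegrableOn f (Set.Ico 0 L) := hf.integrable (by norm_num)
  refine memLp_finsetSum Finset.univ fun i _ => ?_
  exact (memLp_Ico_of_continuous (continuous_secondPrimitive
    (hf1.mono_set (cell_subset_Ico ha hL i)))).indicator (measurableSet_cell a i)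

theorem integral_norm_sq_cellPrimitive_le (ha : 0 < a) (hL : n * a = L)
    (hf : MemLp f 2 (volume.restrict (Set.Ico 0 L))) :
    ∫ s in Set.Ico 0 L, ‖cellPrimitive a n f s‖ ^ 2
      ≤ a ^ 4 * ∫ s in Set.Ico 0 L, ‖f s‖ ^ 2 := by
  have hf1 : IntegrableOn f (Set.Ico 0 L) := hf.integrable (by norm_num)
  have hf2 : IntegrableOn (fun s => ‖f s‖ ^ 2) (Set.Ico 0 L) :=
    (memLp_two_iff_integrable_sq_norm hf.aestronglyMeasurable).1 hf
  have hH := memLp_cellPrimitive ha hL hf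
  have hH2 : IntegrableOn (fun s => ‖cellPrimitive a n f s‖ ^ 2) (Set.Ico 0 L) :=
    (memLp_two_iff_integrable_sq_norm hH.aestronglyMeasurable).1 hH
  rw [integral_Ico_eq_sum_cell ha hL hH2, integral_Ico_eq_sum_cell ha hL hf2, Finset.mul_sum]
  refine Finset.sum_le_sum fun i _ => ?_
  have hsub := cell_subset_Ico ha hL i
  have h1 : ∫ s in cell a i, ‖cellPrimitive a n f s‖ ^ 2
      = ∫ s in cell a i, ‖secondPrimitive f (i * a) ((i + 1) * a) s‖ ^ 2 :=
    setIntegral_congr_fun (measurableSet_cell a i) fun s hs => by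
      rw [cellPrimitive_of_mem ha hs]
  rw [h1]
  refine (integral_norm_sq_secondPrimitive_le (by nlinarith) (hf1.mono_set hsub)
    (hf2.mono_set hsub)).trans (le_of_eq ?_)
  have : ((i : ℝ) + 1) * a - i * a = a := by ring
  rw [this]
  rfl

/-- Each cell has its own vanishing moments, so boundary terms disappear cell by cell and the
primitives need not be matched across cells. -/
theorem integral_mul_eq_integral_cellPrimitive (ha : 0 < a) (hL : n * a = L)
    (hf : MemLp f 2 (volume.restrict (Set.Ico 0 L)))
    (h0 : ∀ i : Fin n, ∫ r in cell a i, f r = 0)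
    (h1 : ∀ i : Fin n, ∫ r in cell a i, (r : ℂ) * f r = 0)
    {φ φ' φ'' : ℝ → ℂ} (hφ : ∀ s, HasDerivAt φ (φ' s) s) (hφ' : ∀ s, HasDerivAt φ' (φ'' s) s)
    (hc : Continuous φ'') :
    ∫ r in Set.Ico 0 L, f r * φ r = ∫ s in Set.Ico 0 L, cellPrimitive a n f s * φ'' s := by
  have hf1 : IntegrableOn f (Set.Ico 0 L) := hf.integrable (by norm_num)
  have hH1 : IntegrableOn (cellPrimitive a n f) (Set.Ico 0 L) :=
    (memLp_cellPrimitive ha hL hf).integrable (by norm_num)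
  have hmul : ∀ {g ψ : ℝ → ℂ}, IntegrableOn g (Set.Ico 0 L) → Continuous ψ →
      IntegrableOn (fun s => g s * ψ s) (Set.Ico 0 L) := by
    intro g ψ hg hψ
    obtain ⟨B, hB⟩ := (isCompact_Icc (a := 0) (b := L)).exists_bound_of_continuousOn
      hψ.continuousOn
    refine Integrable.mul_bdd (c := B) hg hψ.aestronglyMeasurable ?_
    filter_upwards [ae_restrict_mem measurableSet_Ico] with s hs
    exact hB s (Set.Ico_subset_Icc_self hs)
  have hφc : Continuous φ := continuous_iff_continuousAt.2 fun s => (hφ s).continuousAt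
  rw [integral_Ico_eq_sum_cell ha hL (hmul hf1 hφc), integral_Ico_eq_sum_cell ha hL (hmul hH1 hc)]
  refine Finset.sum_congr rfl fun i _ => ?_
  have e1 : ∫ s in cell a i, cellPrimitive a n f s * φ'' s
      = ∫ s in cell a i, secondPrimitive f (i * a) ((i + 1) * a) s * φ'' s :=
    setIntegral_congr_fun (measurableSet_cell a i) fun s hs => by
      rw [cellPrimitive_of_mem ha hs]
  rw [e1]
  exact integral_mul_eq_integral_secondPrimitive (by nlinarith)
    (hf1.mono_set (cell_subset_Ico ha hL i)) (h0 i) (h1 i) hφ hφ' hc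

end CellPrimitive

/-! ### Low and high frequencies of densities on the curve -/

namespace ClosedCurve

variable (Γ : ClosedCurve)

theorem hasDerivAt_character (ξ : E3) (s : ℝ) :
    HasDerivAt (Γ.character ξ) (2 * Real.pi * Complex.I * ((inner ℝ ξ (deriv Γ.σ s) : ℝ) : ℂ)
      * Γ.character ξ s) s := by
  have h1 : HasDerivAt (fun s => inner ℝ ξ (Γ.σ s)) (inner ℝ ξ (deriv Γ.σ s)) s := by
    simpa using (hasDerivAt_const s ξ).inner ℝ (Γ.differentiable_σ s).hasDerivAt
  refine ((h1.ofReal_comp.const_mul (2 * Real.pi * Complex.I)).cexp).congr_deriv ?_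
  rw [character]
  ring

theorem hasDerivAt_deriv_character (ξ : E3) (s : ℝ) :
    HasDerivAt (fun s => 2 * Real.pi * Complex.I * ((inner ℝ ξ (deriv Γ.σ s) : ℝ) : ℂ)
      * Γ.character ξ s)
      (((2 * Real.pi * Complex.I * ((inner ℝ ξ (deriv Γ.σ s) : ℝ) : ℂ)) ^ 2
        + 2 * Real.pi * Complex.I * ((inner ℝ ξ (deriv (deriv Γ.σ) s) : ℝ) : ℂ))
        * Γ.character ξ s) s := by
  have h1 : HasDerivAt (fun s => inner ℝ ξ (deriv Γ.σ s)) (inner ℝ ξ (deriv (deriv Γ.σ) s)) s := by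
    simpa using (hasDerivAt_const s ξ).inner ℝ
      ((Γ.contDiff_deriv_σ.differentiable one_ne_zero) s).hasDerivAt
  refine ((h1.ofReal_comp.const_mul (2 * Real.pi * Complex.I)).mul
    (Γ.hasDerivAt_character ξ s)).congr_deriv ?_
  ring

theorem integrable_mul_character {f : ℝ → ℂ}
    (hf : Integrable f (volume.restrict (Set.Ico 0 Γ.L))) (ξ : E3) :
    Integrable (fun s => f s * Γ.character ξ s) (volume.restrict (Set.Ico 0 Γ.L)) :=
  hf.mul_bdd (c := 1) (Γ.continuous_character.comp
    (by fun_prop : Continuous fun s : ℝ => (ξ, s))).aestronglyMeasurable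
    (Eventually.of_forall fun s => (Γ.norm_character ξ s).le)

theorem inner_eq_sum (x y : E3) : inner ℝ x y = ∑ j, x j * y j := by
  rw [PiLp.inner_apply]
  simp [mul_comm]

theorem memLp_mul_continuous {L : ℝ} {H : ℝ → ℂ} (hH : MemLp H 2 (volume.restrict (Set.Ico 0 L)))
    {w : ℝ → ℝ} (hw : Continuous w) {K : ℝ} (hK : ∀ s, |w s| ≤ K) :
    MemLp (fun s => H s * (w s : ℂ)) 2 (volume.restrict (Set.Ico 0 L)) ∧
    ∫ s in Set.Ico 0 L, ‖H s * (w s : ℂ)‖ ^ 2 ≤ K ^ 2 * ∫ s in Set.Ico 0 L, ‖H s‖ ^ 2 := by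
  have hm : AEStronglyMeasurable (fun s => H s * (w s : ℂ)) (volume.restrict (Set.Ico 0 L)) :=
    hH.aestronglyMeasurable.mul (Continuous.aestronglyMeasurable (by fun_prop))
  have hle : ∀ s, ‖H s * (w s : ℂ)‖ ≤ K * ‖H s‖ := fun s => by
    rw [norm_mul, Complex.norm_real, mul_comm]
    gcongr
    exact hK s
  have hmem : MemLp (fun s => H s * (w s : ℂ)) 2 (volume.restrict (Set.Ico 0 L)) :=
    hH.of_le_mul hm (Eventually.of_forall hle)
  refine ⟨hmem, ?_⟩
  rw [← integral_const_mul]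
  refine integral_mono ((memLp_two_iff_integrable_sq_norm hm).1 hmem)
    (((memLp_two_iff_integrable_sq_norm hH.aestronglyMeasurable).1 hH).const_mul _) fun s => ?_
  simp only
  rw [← mul_pow]
  gcongr
  exact hle s

theorem continuous_deriv_σ_apply (j : Fin 3) : Continuous fun s => deriv Γ.σ s j :=
  (EuclideanSpace.proj (𝕜 := ℝ) j).continuous.comp Γ.continuous_deriv_σ

theorem continuous_deriv_deriv_σ_apply (j : Fin 3) : Continuous fun s => deriv (deriv Γ.σ) s j :=
  (EuclideanSpace.proj (𝕜 := ℝ) j).continuous.comp Γ.continuous_deriv_deriv_σ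

theorem abs_deriv_mul_deriv_le (j k : Fin 3) (s : ℝ) : |deriv Γ.σ s j * deriv Γ.σ s k| ≤ 1 := by
  have h : ∀ j, |deriv Γ.σ s j| ≤ 1 := fun j =>
    (PiLp.norm_apply_le (deriv Γ.σ s) j).trans (Γ.unit_speed s).le
  rw [abs_mul]
  exact mul_le_one₀ (h j) (abs_nonneg _) (h k)

/-- Two integrations by parts in the Fourier transform of a density with vanishing moments. -/
theorem norm_curveFourier_le {n : ℕ} (hn : 0 < n) {f : ℝ → ℂ}
    (hf : MemLp f 2 (volume.restrict (Set.Ico 0 Γ.L)))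
    (h0 : ∀ i : Fin n, ∫ r in cell (Γ.L / n) i, f r = 0)
    (h1 : ∀ i : Fin n, ∫ r in cell (Γ.L / n) i, (r : ℂ) * f r = 0) (ξ : E3) :
    ‖Γ.curveFourier f ξ‖ ≤ (2 * Real.pi * ‖ξ‖) ^ 2 * (∑ j : Fin 3, ∑ k : Fin 3,
        ‖Γ.curveFourier (fun s => cellPrimitive (Γ.L / n) n f s
          * ((deriv Γ.σ s j * deriv Γ.σ s k : ℝ) : ℂ)) ξ‖)
      + 2 * Real.pi * ‖ξ‖ * ∑ j : Fin 3, ‖Γ.curveFourier (fun s => cellPrimitive (Γ.L / n) n f s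
          * ((deriv (deriv Γ.σ) s j : ℝ) : ℂ)) ξ‖ := by
  have hL := Γ.L_pos
  have hpi := Real.pi_pos
  have hn0 : (0 : ℝ) < n := by exact_mod_cast hn
  have ha : 0 < Γ.L / n := by positivity
  have hna : n * (Γ.L / n) = Γ.L := by field_simp
  obtain ⟨K, -, hK⟩ := Γ.exists_norm_deriv_deriv_le
  have hH := memLp_cellPrimitive ha hna hf
  set H : ℝ → ℂ := cellPrimitive (Γ.L / n) n f with hHdef
  have hG2 : ∀ j k : Fin 3, Integrable (fun s => H s
      * ((deriv Γ.σ s j * deriv Γ.σ s k : ℝ) : ℂ)) (volume.restrict (Set.Ico 0 Γ.L)) := fun j k =>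
    (memLp_mul_continuous hH ((Γ.continuous_deriv_σ_apply j).mul (Γ.continuous_deriv_σ_apply k))
      (Γ.abs_deriv_mul_deriv_le j k)).1.integrable (by norm_num)
  have hG1 : ∀ j : Fin 3, Integrable (fun s => H s
      * ((deriv (deriv Γ.σ) s j : ℝ) : ℂ)) (volume.restrict (Set.Ico 0 Γ.L)) := fun j =>
    (memLp_mul_continuous hH (Γ.continuous_deriv_deriv_σ_apply j)
      (fun s => (PiLp.norm_apply_le (deriv (deriv Γ.σ) s) j).trans (hK s))).1.integrable
      (by norm_num)
  have hc : Continuous fun s => ((2 * Real.pi * Complex.I * ((inner ℝ ξ (deriv Γ.σ s) : ℝ) : ℂ)) ^ 2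
        + 2 * Real.pi * Complex.I * ((inner ℝ ξ (deriv (deriv Γ.σ) s) : ℝ) : ℂ))
        * Γ.character ξ s := by
    have c1 := Γ.continuous_deriv_σ
    have c2 := Γ.continuous_deriv_deriv_σ
    have c3 : Continuous fun s => Γ.character ξ s :=
      Γ.continuous_character.comp (by fun_prop : Continuous fun s : ℝ => (ξ, s))
    fun_prop
  have hrep := integral_mul_eq_integral_cellPrimitive ha hna hf h0 h1
    (Γ.hasDerivAt_character ξ) (Γ.hasDerivAt_deriv_character ξ) hc
  -- In coordinates, each term is a monomial in `ξ` times the transform of a density independent of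
  -- `ξ`. The Gaussian estimate applies to these densities because `σ'` and `σ''` are continuous and
  -- bounded.
  have hpt : ∀ s, H s * (((2 * Real.pi * Complex.I * ((inner ℝ ξ (deriv Γ.σ s) : ℝ) : ℂ)) ^ 2
        + 2 * Real.pi * Complex.I * ((inner ℝ ξ (deriv (deriv Γ.σ) s) : ℝ) : ℂ))
        * Γ.character ξ s)
      = (∑ j : Fin 3, ∑ k : Fin 3, (2 * Real.pi * Complex.I) ^ 2 * ξ j * ξ k
          * ((H s * ((deriv Γ.σ s j * deriv Γ.σ s k : ℝ) : ℂ)) * Γ.character ξ s))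
        + ∑ j : Fin 3, 2 * Real.pi * Complex.I * ξ j
          * ((H s * ((deriv (deriv Γ.σ) s j : ℝ) : ℂ)) * Γ.character ξ s) := by
    intro s
    rw [inner_eq_sum, inner_eq_sum]
    simp only [Fin.sum_univ_three]
    push_cast
    ring
  have hsum : Γ.curveFourier f ξ
      = (∑ j : Fin 3, ∑ k : Fin 3, (2 * Real.pi * Complex.I) ^ 2 * ξ j * ξ k
          * Γ.curveFourier (fun s => H s * ((deriv Γ.σ s j * deriv Γ.σ s k : ℝ) : ℂ)) ξ)
        + ∑ j : Fin 3, 2 * Real.pi * Complex.I * ξ j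
          * Γ.curveFourier (fun s => H s * ((deriv (deriv Γ.σ) s j : ℝ) : ℂ)) ξ := by
    refine hrep.trans ((integral_congr_ae (Eventually.of_forall hpt)).trans ?_)
    have i2 : ∀ j k : Fin 3, Integrable (fun s => (2 * Real.pi * Complex.I) ^ 2 * ξ j * ξ k
          * ((H s * ((deriv Γ.σ s j * deriv Γ.σ s k : ℝ) : ℂ)) * Γ.character ξ s))
          (volume.restrict (Set.Ico 0 Γ.L)) := fun j k =>
      (Γ.integrable_mul_character (hG2 j k) ξ).const_mul _
    have i1 : ∀ j : Fin 3, Integrable (fun s => 2 * Real.pi * Complex.I * ξ j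
          * ((H s * ((deriv (deriv Γ.σ) s j : ℝ) : ℂ)) * Γ.character ξ s))
          (volume.restrict (Set.Ico 0 Γ.L)) := fun j =>
      (Γ.integrable_mul_character (hG1 j) ξ).const_mul _
    rw [integral_add (integrable_finsetSum _ fun j _ => integrable_finsetSum _ fun k _ => i2 j k)
      (integrable_finsetSum _ fun j _ => i1 j),
      integral_finsetSum _ (fun j _ => integrable_finsetSum _ fun k _ => i2 j k),
      integral_finsetSum _ (fun j _ => i1 j)]
    congr 1
    · refine Finset.sum_congr rfl fun j _ => ?_
      rw [integral_finsetSum _ fun k _ => i2 j k]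
      refine Finset.sum_congr rfl fun k _ => ?_
      rw [integral_const_mul]
      rfl
    · refine Finset.sum_congr rfl fun j _ => ?_
      rw [integral_const_mul]
      rfl
  have hξ : ∀ j : Fin 3, ‖(ξ j : ℂ)‖ ≤ ‖ξ‖ := fun j => by
    rw [Complex.norm_real]
    exact PiLp.norm_apply_le ξ j
  have hnorm : ‖(2 * Real.pi * Complex.I : ℂ)‖ = 2 * Real.pi := by
    simp [abs_of_pos hpi]
  rw [hsum]
  refine (norm_add_le _ _).trans (add_le_add ?_ ?_)
  · rw [Finset.mul_sum]
    refine norm_sum_le_of_le _ fun j _ => ?_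
    rw [Finset.mul_sum]
    refine norm_sum_le_of_le _ fun k _ => ?_
    rw [norm_mul, norm_mul, norm_mul, norm_pow, hnorm]
    have : (2 * Real.pi) ^ 2 * ‖(ξ j : ℂ)‖ * ‖(ξ k : ℂ)‖ ≤ (2 * Real.pi * ‖ξ‖) ^ 2 := by
      calc (2 * Real.pi) ^ 2 * ‖(ξ j : ℂ)‖ * ‖(ξ k : ℂ)‖ ≤ (2 * Real.pi) ^ 2 * ‖ξ‖ * ‖ξ‖ := by
            gcongr
            · exact hξ j
            · exact hξ k
        _ = _ := by ring
    gcongr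
  · rw [Finset.mul_sum]
    refine norm_sum_le_of_le _ fun j _ => ?_
    rw [norm_mul, norm_mul, hnorm]
    gcongr
    exact hξ j

/-- The symbol of `-Δ + m`. -/
noncomputable def symbol (m : ℝ) (ξ : E3) : ℝ := (2 * Real.pi * ‖ξ‖) ^ 2 + m

theorem symbol_pos {m : ℝ} (hm : 0 < m) (ξ : E3) : 0 < symbol m ξ := by
  unfold symbol
  positivity

theorem continuous_symbol (m : ℝ) : Continuous (symbol m) := by
  unfold symbol
  fun_prop

/-- With `x = 2π ‖ξ‖`, both `x²` and `x` are bounded by multiples of the symbol `x² + m`, so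
division removes `ξ`. The constants are `2 · 9` and `2 · 3`, from a square of two terms and sums of
nine and three terms. -/
theorem sq_div_sq_symbol_le {m : ℝ} (hm : 0 < m) (ξ : E3) {y : ℝ} (hy : 0 ≤ y)
    {G : Fin 3 → Fin 3 → ℝ} {G' : Fin 3 → ℝ} (hG : ∀ j k, 0 ≤ G j k) (hG' : ∀ j, 0 ≤ G' j)
    (h : y ≤ (2 * Real.pi * ‖ξ‖) ^ 2 * (∑ j, ∑ k, G j k) + 2 * Real.pi * ‖ξ‖ * ∑ j, G' j) :
    y ^ 2 / symbol m ξ ^ 2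
      ≤ 18 * (∑ j, ∑ k, G j k ^ 2) + 6 * (1 + m⁻¹) ^ 2 * ∑ j, G' j ^ 2 := by
  have hpi := Real.pi_pos
  have hs := symbol_pos hm ξ
  set c₁ : ℝ := 1 + m⁻¹ with hc₁
  have hc₁0 : 0 < c₁ := by positivity
  set x : ℝ := 2 * Real.pi * ‖ξ‖ with hx
  have hx0 : 0 ≤ x := by positivity
  have hsym : symbol m ξ = x ^ 2 + m := rfl
  have hx1 : x ≤ c₁ * symbol m ξ := by
    have e : c₁ * symbol m ξ = x ^ 2 + m + m⁻¹ * x ^ 2 + 1 := by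
      rw [hc₁, hsym]
      field_simp
      ring
    have : 0 ≤ m⁻¹ * x ^ 2 := by positivity
    nlinarith [sq_nonneg (x - 1)]
  have hx2 : x ^ 2 ≤ symbol m ξ := by
    rw [hsym]
    linarith
  set S2 := ∑ j, ∑ k, G j k with hS2
  set S1 := ∑ j, G' j with hS1
  have hS20 : 0 ≤ S2 := Finset.sum_nonneg fun j _ => Finset.sum_nonneg fun k _ => hG j k
  have hS10 : 0 ≤ S1 := Finset.sum_nonneg fun j _ => hG' j
  have h3 : y ≤ symbol m ξ * (S2 + c₁ * S1) := by
    refine h.trans ?_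
    calc x ^ 2 * S2 + x * S1 ≤ symbol m ξ * S2 + c₁ * symbol m ξ * S1 := by gcongr
      _ = _ := by ring
  have h4 : y ^ 2 / symbol m ξ ^ 2 ≤ (S2 + c₁ * S1) ^ 2 := by
    rw [div_le_iff₀ (by positivity), ← mul_pow, mul_comm]
    gcongr
  have h5 : S2 ^ 2 ≤ 9 * ∑ j, ∑ k, G j k ^ 2 := by
    have a1 := sq_sum_le_card_mul_sum_sq (s := Finset.univ) (f := fun j : Fin 3 => ∑ k, G j k)
    have a2 : ∀ j : Fin 3, (∑ k, G j k) ^ 2 ≤ 3 * ∑ k, G j k ^ 2 := fun j => by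
      simpa using sq_sum_le_card_mul_sum_sq (s := Finset.univ) (f := fun k : Fin 3 => G j k)
    simp only [Finset.card_univ, Fintype.card_fin, Nat.cast_ofNat] at a1
    calc S2 ^ 2 ≤ 3 * ∑ j, (∑ k, G j k) ^ 2 := a1
      _ ≤ 3 * ∑ j, 3 * ∑ k, G j k ^ 2 := by
        gcongr with j
        exact a2 j
      _ = _ := by
        rw [← Finset.mul_sum]
        ring
  have h6 : S1 ^ 2 ≤ 3 * ∑ j, G' j ^ 2 := by
    simpa using sq_sum_le_card_mul_sum_sq (s := Finset.univ) (f := fun j : Fin 3 => G' j)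
  have b1 : (S2 + c₁ * S1) ^ 2 ≤ 2 * S2 ^ 2 + 2 * c₁ ^ 2 * S1 ^ 2 := by
    nlinarith [sq_nonneg (S2 - c₁ * S1)]
  have b2 : c₁ ^ 2 * S1 ^ 2 ≤ c₁ ^ 2 * (3 * ∑ j, G' j ^ 2) := by gcongr
  linarith

/-- Low frequencies of a density with vanishing moments. -/
theorem exists_lintegral_low_le {m : ℝ} (hm : 0 < m) : ∃ C : ℝ, 0 < C ∧ ∀ n : ℕ, 0 < n →
    ∀ f : ℝ → ℂ, MemLp f 2 (volume.restrict (Set.Ico 0 Γ.L)) →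
    (∀ i : Fin n, ∫ r in cell (Γ.L / n) i, f r = 0) →
    (∀ i : Fin n, ∫ r in cell (Γ.L / n) i, (r : ℂ) * f r = 0) →
    ∫⁻ ξ in {ξ : E3 | ‖ξ‖ ≤ n}, ENNReal.ofReal (‖Γ.curveFourier f ξ‖ ^ 2 / symbol m ξ ^ 2)
      ≤ ENNReal.ofReal (C / (n : ℝ) ^ 2 * ∫ s in Set.Ico 0 Γ.L, ‖f s‖ ^ 2) := by
  obtain ⟨C, hC0, hC⟩ := Γ.exists_integral_gaussian_curveFourier_le
  obtain ⟨K, hK1, hK⟩ := Γ.exists_norm_deriv_deriv_le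
  have hL := Γ.L_pos
  have hpi := Real.pi_pos
  set c₁ : ℝ := 1 + m⁻¹ with hc₁
  have hc₁0 : 0 < c₁ := by positivity
  refine ⟨Real.exp 1 * (18 * 9 + 6 * c₁ ^ 2 * 3 * K ^ 2) * C * Γ.L ^ 4, by positivity,
    fun n hn f hf h0 h1 => ?_⟩
  have hn0 : (0 : ℝ) < n := by exact_mod_cast hn
  have ha : 0 < Γ.L / n := by positivity
  have hna : n * (Γ.L / n) = Γ.L := by field_simp
  have hbound := Γ.norm_curveFourier_le hn hf h0 h1
  have hH := memLp_cellPrimitive ha hna hf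
  have hHle := integral_norm_sq_cellPrimitive_le ha hna hf
  set H : ℝ → ℂ := cellPrimitive (Γ.L / n) n f with hHdef
  set G2 : Fin 3 → Fin 3 → E3 → ℝ := fun j k ξ =>
    ‖Γ.curveFourier (fun s => H s * ((deriv Γ.σ s j * deriv Γ.σ s k : ℝ) : ℂ)) ξ‖ with hG2
  set G1 : Fin 3 → E3 → ℝ := fun j ξ =>
    ‖Γ.curveFourier (fun s => H s * ((deriv (deriv Γ.σ) s j : ℝ) : ℂ)) ξ‖ with hG1
  have hm2 := fun j k : Fin 3 => memLp_mul_continuous hH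
    ((Γ.continuous_deriv_σ_apply j).mul (Γ.continuous_deriv_σ_apply k))
      (Γ.abs_deriv_mul_deriv_le j k)
  have hm1 := fun j : Fin 3 => memLp_mul_continuous hH (Γ.continuous_deriv_deriv_σ_apply j)
      (fun s => (PiLp.norm_apply_le (deriv (deriv Γ.σ) s) j).trans (hK s))
  -- At this scale `e · exp (-t ‖ξ‖²) ≥ 1` for `‖ξ‖ ≤ n`, so the Gaussian average dominates the low
  -- frequencies. Its bound `C n²` meets the factor `(L/n)⁴` of the second primitive, leaving `n⁻²`.
  set t : ℝ := ((n : ℝ) ^ 2)⁻¹ with ht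
  have ht0 : 0 < t := by positivity
  set J : ℝ := ∫ s in Set.Ico 0 Γ.L, ‖H s‖ ^ 2 with hJ
  have hJ0 : 0 ≤ J := integral_nonneg fun s => sq_nonneg _
  have hI2 : ∀ j k, Integrable (fun ξ => Real.exp (-t * ‖ξ‖ ^ 2) * G2 j k ξ ^ 2) ∧
      ∫ ξ, Real.exp (-t * ‖ξ‖ ^ 2) * G2 j k ξ ^ 2 ≤ C / t * J := fun j k => by
    obtain ⟨h2, h3⟩ := hC t ht0 _ (hm2 j k).1
    refine ⟨h2, h3.trans ?_⟩
    gcongr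
    simpa using (hm2 j k).2
  have hI1 : ∀ j, Integrable (fun ξ => Real.exp (-t * ‖ξ‖ ^ 2) * G1 j ξ ^ 2) ∧
      ∫ ξ, Real.exp (-t * ‖ξ‖ ^ 2) * G1 j ξ ^ 2 ≤ C / t * (K ^ 2 * J) := fun j => by
    obtain ⟨h2, h3⟩ := hC t ht0 _ (hm1 j).1
    refine ⟨h2, h3.trans ?_⟩
    gcongr
    exact (hm1 j).2
  set W : E3 → ℝ := fun ξ => Real.exp 1 * (18 * (∑ j, ∑ k, Real.exp (-t * ‖ξ‖ ^ 2) * G2 j k ξ ^ 2)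
    + 6 * c₁ ^ 2 * ∑ j, Real.exp (-t * ‖ξ‖ ^ 2) * G1 j ξ ^ 2) with hW
  have iS2 : Integrable fun ξ => ∑ j, ∑ k, Real.exp (-t * ‖ξ‖ ^ 2) * G2 j k ξ ^ 2 :=
    integrable_finsetSum _ fun j _ => integrable_finsetSum _ fun k _ => (hI2 j k).1
  have iS1 : Integrable fun ξ => ∑ j, Real.exp (-t * ‖ξ‖ ^ 2) * G1 j ξ ^ 2 :=
    integrable_finsetSum _ fun j _ => (hI1 j).1
  have hWint : Integrable W := ((iS2.const_mul _).add (iS1.const_mul _)).const_mul _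
  have hW0 : ∀ ξ, 0 ≤ W ξ := fun ξ => by
    rw [hW]
    positivity
  have hWle : ∫ ξ, W ξ ≤ Real.exp 1 * (18 * 9 + 6 * c₁ ^ 2 * 3 * K ^ 2) * (C / t) * J := by
    have e2 : ∫ ξ, ∑ j, ∑ k, Real.exp (-t * ‖ξ‖ ^ 2) * G2 j k ξ ^ 2 ≤ 9 * (C / t * J) := by
      rw [integral_finsetSum _ fun j _ => integrable_finsetSum _ fun k _ => (hI2 j k).1]
      calc _ ≤ ∑ j : Fin 3, 3 * (C / t * J) := by
            refine Finset.sum_le_sum fun j _ => ?_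
            rw [integral_finsetSum _ fun k _ => (hI2 j k).1]
            calc _ ≤ ∑ k : Fin 3, C / t * J := Finset.sum_le_sum fun k _ => (hI2 j k).2
              _ = _ := by simp
        _ = _ := by
            simp
            ring
    have e1 : ∫ ξ, ∑ j, Real.exp (-t * ‖ξ‖ ^ 2) * G1 j ξ ^ 2 ≤ 3 * (C / t * (K ^ 2 * J)) := by
      rw [integral_finsetSum _ fun j _ => (hI1 j).1]
      calc _ ≤ ∑ k : Fin 3, C / t * (K ^ 2 * J) := Finset.sum_le_sum fun k _ => (hI1 k).2
        _ = _ := by simp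
    rw [hW, integral_const_mul, integral_add (iS2.const_mul _) (iS1.const_mul _),
      integral_const_mul, integral_const_mul]
    calc _ ≤ Real.exp 1 * (18 * (9 * (C / t * J)) + 6 * c₁ ^ 2 * (3 * (C / t * (K ^ 2 * J)))) := by
          gcongr
      _ = _ := by ring
  have hpt : ∀ ξ : E3, ‖ξ‖ ≤ n → ‖Γ.curveFourier f ξ‖ ^ 2 / symbol m ξ ^ 2 ≤ W ξ := by
    intro ξ hξ
    have h7 : 1 ≤ Real.exp 1 * Real.exp (-t * ‖ξ‖ ^ 2) := by
      rw [← Real.exp_add]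
      refine Real.one_le_exp ?_
      have : t * ‖ξ‖ ^ 2 ≤ 1 := by
        rw [ht, inv_mul_le_iff₀ (by positivity), mul_one]
        gcongr
      linarith
    have h8 := sq_div_sq_symbol_le hm ξ (norm_nonneg _) (fun j k => norm_nonneg _)
      (fun j => norm_nonneg _) (hbound ξ)
    have hWξ : W ξ = (Real.exp 1 * Real.exp (-t * ‖ξ‖ ^ 2))
        * (18 * (∑ j, ∑ k, G2 j k ξ ^ 2) + 6 * c₁ ^ 2 * ∑ j, G1 j ξ ^ 2) := by
      rw [hW]
      simp only [← Finset.mul_sum]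
      ring
    rw [hWξ]
    exact h8.trans (le_mul_of_one_le_left (by positivity) h7)
  calc ∫⁻ ξ in {ξ : E3 | ‖ξ‖ ≤ n}, ENNReal.ofReal (‖Γ.curveFourier f ξ‖ ^ 2 / symbol m ξ ^ 2)
      ≤ ∫⁻ ξ in {ξ : E3 | ‖ξ‖ ≤ n}, ENNReal.ofReal (W ξ) := by
        refine setLIntegral_mono' (measurableSet_le (by fun_prop) (by fun_prop)) fun ξ hξ => ?_
        exact ENNReal.ofReal_le_ofReal (hpt ξ hξ)
    _ ≤ ∫⁻ ξ, ENNReal.ofReal (W ξ) := setLIntegral_le_lintegral _ _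
    _ = ENNReal.ofReal (∫ ξ, W ξ) :=
        (ofReal_integral_eq_lintegral_ofReal hWint (Eventually.of_forall hW0)).symm
    _ ≤ _ := by
        refine ENNReal.ofReal_le_ofReal (hWle.trans ?_)
        calc Real.exp 1 * (18 * 9 + 6 * c₁ ^ 2 * 3 * K ^ 2) * (C / t) * J
            ≤ Real.exp 1 * (18 * 9 + 6 * c₁ ^ 2 * 3 * K ^ 2) * (C / t)
              * ((Γ.L / n) ^ 4 * ∫ s in Set.Ico 0 Γ.L, ‖f s‖ ^ 2) := by gcongr
          _ = _ := by
            rw [ht]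
            field_simp

/-- High frequencies of a density. -/
theorem exists_lintegral_high_le {m : ℝ} (hm : 0 < m) : ∃ C : ℝ, 0 < C ∧ ∀ n : ℕ, 0 < n →
    ∀ f : ℝ → ℂ, MemLp f 2 (volume.restrict (Set.Ico 0 Γ.L)) →
    ∫⁻ ξ in {ξ : E3 | ‖ξ‖ ≤ n}ᶜ, ENNReal.ofReal (‖Γ.curveFourier f ξ‖ ^ 2 / symbol m ξ ^ 2)
      ≤ ENNReal.ofReal (C / (n : ℝ) ^ 2 * ∫ s in Set.Ico 0 Γ.L, ‖f s‖ ^ 2) := by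
  obtain ⟨C, hC0, hC⟩ := Γ.exists_integral_gaussian_curveFourier_le
  have hpi := Real.pi_pos
  refine ⟨2 * Real.exp 1 * C, by positivity, fun n hn f hf => ?_⟩
  have hn0 : (0 : ℝ) < n := by exact_mod_cast hn
  set I : ℝ := ∫ s in Set.Ico 0 Γ.L, ‖f s‖ ^ 2 with hI
  have hI0 : 0 ≤ I := integral_nonneg fun s => sq_nonneg _
  have hcont := Γ.continuous_curveFourier (hf.integrable (by norm_num))
  set a : ℝ := ((n : ℝ) ^ 2)⁻¹ with ha
  have ha0 : 0 < a := by positivity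
  -- The squared inverse symbol is at most `‖ξ‖⁻⁴`, the integral of `2t` over `0 < t ≤ ‖ξ‖⁻²`. There
  -- `e · exp (-t ‖ξ‖²) ≥ 1`, and `‖ξ‖ > n` places the range inside `(0, n⁻²]`. After Tonelli, the
  -- Gaussian bound `C / t` cancels the weight `t`, and the length `n⁻²` of the range remains.
  have hpt : ∀ ξ ∈ {ξ : E3 | ‖ξ‖ ≤ n}ᶜ,
      ENNReal.ofReal (‖Γ.curveFourier f ξ‖ ^ 2 / symbol m ξ ^ 2)
      ≤ ∫⁻ t in Set.Ioc 0 a, ENNReal.ofReal (2 * Real.exp 1 * t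
        * (Real.exp (-t * ‖ξ‖ ^ 2) * ‖Γ.curveFourier f ξ‖ ^ 2)) := by
    intro ξ hξ
    have hξn : (n : ℝ) < ‖ξ‖ := not_le.1 hξ
    have hξ0 : 0 < ‖ξ‖ := hn0.trans hξn
    set b : ℝ := (‖ξ‖ ^ 2)⁻¹ with hb
    have hb0 : 0 < b := by positivity
    have hba : b ≤ a := by
      rw [hb, ha]
      gcongr
    set N : ℝ := ‖Γ.curveFourier f ξ‖ ^ 2 with hN
    have hN0 : 0 ≤ N := sq_nonneg _
    have e1 : N / symbol m ξ ^ 2 ≤ ∫ t in (0 : ℝ)..b, 2 * t * N := by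
      have h1 : ∫ t in (0 : ℝ)..b, 2 * t * N = b ^ 2 * N := by
        rw [intervalIntegral.integral_mul_const, intervalIntegral.integral_const_mul, integral_id]
        ring
      rw [h1, mul_comm, div_eq_mul_inv, ← inv_pow, hb]
      have hs : ‖ξ‖ ^ 2 ≤ symbol m ξ := by
        rw [symbol, mul_pow]
        have : 1 ≤ (2 * Real.pi) ^ 2 := by nlinarith [Real.two_le_pi]
        nlinarith [sq_nonneg ‖ξ‖]
      have := inv_anti₀ (by positivity) hs
      have h3 := (inv_pos.2 (symbol_pos hm ξ)).le
      exact mul_le_mul_of_nonneg_left (pow_le_pow_left₀ h3 this 2) hN0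
    calc ENNReal.ofReal (N / symbol m ξ ^ 2)
        ≤ ENNReal.ofReal (∫ t in Set.Ioc 0 b, 2 * t * N) := by
          rw [← intervalIntegral.integral_of_le hb0.le]
          exact ENNReal.ofReal_le_ofReal e1
      _ = ∫⁻ t in Set.Ioc 0 b, ENNReal.ofReal (2 * t * N) := by
          refine ofReal_integral_eq_lintegral_ofReal ?_ ?_
          · exact ((by fun_prop : Continuous fun t : ℝ => 2 * t * N).continuousOn.integrableOn_compact
              isCompact_Icc).mono_set Set.Ioc_subset_Icc_self
          · filter_upwards [ae_restrict_mem measurableSet_Ioc] with t ht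
            have := ht.1
            simp only [Pi.zero_apply]
            positivity
      _ ≤ ∫⁻ t in Set.Ioc 0 b, ENNReal.ofReal (2 * Real.exp 1 * t
            * (Real.exp (-t * ‖ξ‖ ^ 2) * N)) := by
          refine setLIntegral_mono' measurableSet_Ioc fun t ht => ?_
          refine ENNReal.ofReal_le_ofReal ?_
          have h7 : 1 ≤ Real.exp 1 * Real.exp (-t * ‖ξ‖ ^ 2) := by
            rw [← Real.exp_add]
            refine Real.one_le_exp ?_
            have : t * ‖ξ‖ ^ 2 ≤ 1 := by
              have := mul_le_mul_of_nonneg_right ht.2 (sq_nonneg ‖ξ‖)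
              rwa [hb, inv_mul_cancel₀ (by positivity)] at this
            linarith
          have ht0 := ht.1
          calc 2 * t * N ≤ (2 * t * N) * (Real.exp 1 * Real.exp (-t * ‖ξ‖ ^ 2)) :=
                le_mul_of_one_le_right (by positivity) h7
            _ = _ := by ring
      _ ≤ _ := lintegral_mono_set (Set.Ioc_subset_Ioc_right hba)
  have hmeas : Measurable (Function.uncurry fun (ξ : E3) (t : ℝ) =>
      ENNReal.ofReal (2 * Real.exp 1 * t
        * (Real.exp (-t * ‖ξ‖ ^ 2) * ‖Γ.curveFourier f ξ‖ ^ 2))) := by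
    refine ENNReal.measurable_ofReal.comp (Continuous.measurable ?_)
    change Continuous fun p : E3 × ℝ => 2 * Real.exp 1 * p.2
        * (Real.exp (-p.2 * ‖p.1‖ ^ 2) * ‖Γ.curveFourier f p.1‖ ^ 2)
    fun_prop
  calc ∫⁻ ξ in {ξ : E3 | ‖ξ‖ ≤ n}ᶜ, ENNReal.ofReal (‖Γ.curveFourier f ξ‖ ^ 2 / symbol m ξ ^ 2)
      ≤ ∫⁻ ξ in {ξ : E3 | ‖ξ‖ ≤ n}ᶜ, ∫⁻ t in Set.Ioc 0 a, ENNReal.ofReal (2 * Real.exp 1 * t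
        * (Real.exp (-t * ‖ξ‖ ^ 2) * ‖Γ.curveFourier f ξ‖ ^ 2)) :=
        setLIntegral_mono' (measurableSet_le (by fun_prop) (by fun_prop)).compl hpt
    _ ≤ ∫⁻ ξ, ∫⁻ t in Set.Ioc 0 a, ENNReal.ofReal (2 * Real.exp 1 * t
        * (Real.exp (-t * ‖ξ‖ ^ 2) * ‖Γ.curveFourier f ξ‖ ^ 2)) := setLIntegral_le_lintegral _ _
    _ = ∫⁻ t in Set.Ioc 0 a, ∫⁻ ξ, ENNReal.ofReal (2 * Real.exp 1 * t
        * (Real.exp (-t * ‖ξ‖ ^ 2) * ‖Γ.curveFourier f ξ‖ ^ 2)) :=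
        lintegral_lintegral_swap hmeas.aemeasurable
    _ ≤ ∫⁻ t in Set.Ioc 0 a, ENNReal.ofReal (2 * Real.exp 1 * C * I) := by
        refine setLIntegral_mono' measurableSet_Ioc fun t ht => ?_
        have ht0 := ht.1
        obtain ⟨h1, h2⟩ := hC t ht0 f hf
        rw [← ofReal_integral_eq_lintegral_ofReal (h1.const_mul _)
          (Eventually.of_forall fun ξ => by
            simp only [Pi.zero_apply]
            positivity), integral_const_mul]
        refine ENNReal.ofReal_le_ofReal ?_
        calc 2 * Real.exp 1 * t * ∫ ξ : E3, Real.exp (-t * ‖ξ‖ ^ 2) * ‖Γ.curveFourier f ξ‖ ^ 2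
            ≤ 2 * Real.exp 1 * t * (C / t * I) := by gcongr
          _ = _ := by field_simp
    _ = _ := by
        rw [setLIntegral_const, Real.volume_Ioc, ← ENNReal.ofReal_mul (by positivity), sub_zero,
          ha]
        congr 1
        field_simp

/-- Densities with vanishing moments over `n` cells have norm `O(1/n)` in the Sobolev space of
order `-2`. -/
theorem exists_integral_curveFourier_div_symbol_le {m : ℝ} (hm : 0 < m) :
    ∃ C : ℝ, 0 < C ∧ ∀ n : ℕ, 0 < n →
    ∀ f : ℝ → ℂ, MemLp f 2 (volume.restrict (Set.Ico 0 Γ.L)) →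
    (∀ i : Fin n, ∫ r in cell (Γ.L / n) i, f r = 0) →
    (∀ i : Fin n, ∫ r in cell (Γ.L / n) i, (r : ℂ) * f r = 0) →
    Integrable (fun ξ => (‖Γ.curveFourier f ξ‖ / symbol m ξ) ^ 2) ∧
    ∫ ξ, (‖Γ.curveFourier f ξ‖ / symbol m ξ) ^ 2
      ≤ (C / n) ^ 2 * ∫ s in Set.Ico 0 Γ.L, ‖f s‖ ^ 2 := by
  obtain ⟨C₁, hC₁, h₁⟩ := Γ.exists_lintegral_low_le hm
  obtain ⟨C₂, hC₂, h₂⟩ := Γ.exists_lintegral_high_le hm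
  refine ⟨√(C₁ + C₂), by positivity, fun n hn f hf h0 h1 => ?_⟩
  have hn0 : (0 : ℝ) < n := by exact_mod_cast hn
  set I : ℝ := ∫ s in Set.Ico 0 Γ.L, ‖f s‖ ^ 2 with hI
  have hI0 : 0 ≤ I := integral_nonneg fun s => sq_nonneg _
  have hcont := Γ.continuous_curveFourier (hf.integrable (by norm_num))
  have hsc := continuous_symbol m
  have hB : (√(C₁ + C₂) / n) ^ 2 * I = C₁ / (n : ℝ) ^ 2 * I + C₂ / (n : ℝ) ^ 2 * I := by
    rw [div_pow, Real.sq_sqrt (by positivity)]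
    ring
  have hlint : ∫⁻ ξ, ENNReal.ofReal ((‖Γ.curveFourier f ξ‖ / symbol m ξ) ^ 2)
      ≤ ENNReal.ofReal ((√(C₁ + C₂) / n) ^ 2 * I) := by
    rw [hB]
    simp_rw [div_pow]
    rw [ENNReal.ofReal_add (by positivity) (by positivity),
      ← lintegral_add_compl _ (measurableSet_le (f := fun ξ : E3 => ‖ξ‖) (g := fun _ => (n : ℝ))
        (by fun_prop) (by fun_prop))]
    exact add_le_add (h₁ n hn f hf h0 h1) (h₂ n hn f hf)
  have hm' : Continuous fun ξ => (‖Γ.curveFourier f ξ‖ / symbol m ξ) ^ 2 :=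
    (hcont.norm.div hsc fun ξ => (symbol_pos hm ξ).ne').pow 2
  have hInt : Integrable (fun ξ => (‖Γ.curveFourier f ξ‖ / symbol m ξ) ^ 2) := by
    refine ⟨hm'.aestronglyMeasurable, ?_⟩
    rw [hasFiniteIntegral_iff_ofReal (Eventually.of_forall fun ξ => sq_nonneg _)]
    exact hlint.trans_lt ENNReal.ofReal_lt_top
  refine ⟨hInt, ?_⟩
  rw [← ENNReal.ofReal_le_ofReal_iff (by positivity),
    ofReal_integral_eq_lintegral_ofReal hInt (Eventually.of_forall fun ξ => sq_nonneg _)]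
  exact hlint

end ClosedCurve

open ClosedCurve FourierTransform

/-! ### The operator `-Δ + m` on Schwartz functions -/

/-- The operator `-Δ + m` on Schwartz functions. -/
noncomputable def helmholtz (m : ℝ) (φ : 𝓢(E3, ℂ)) : 𝓢(E3, ℂ) := -Δ φ + (m : ℂ) • φ

theorem fourier_laplacian_apply (φ : 𝓢(E3, ℂ)) (ξ : E3) :
    𝓕 (Δ φ) ξ = -(((2 * Real.pi * ‖ξ‖) ^ 2 : ℝ) : ℂ) * 𝓕 φ ξ := by
  have hg : (fun ξ : E3 => ‖ξ‖ ^ 2).HasTemperateGrowth :=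
    Function.hasTemperateGrowth_norm_sq E3
  rw [SchwartzMap.laplacian_eq_fourierMultiplierCLM, SchwartzMap.fourierMultiplierCLM_apply,
    FourierTransform.fourier_smul, FourierTransform.fourier_fourierInv_eq, smul_apply]
  have h := SchwartzMap.smulLeftCLM_apply_apply hg (𝓕 φ) ξ
  erw [h]
  simp only [Complex.real_smul]
  push_cast
  ring

theorem fourier_helmholtz_apply (m : ℝ) (φ : 𝓢(E3, ℂ)) (ξ : E3) :
    𝓕 (helmholtz m φ) ξ = (symbol m ξ : ℂ) * 𝓕 φ ξ := by
  rw [helmholtz, FourierTransform.fourier_add, FourierTransform.fourier_neg,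
    FourierTransform.fourier_smul, add_apply, neg_apply,
    smul_apply, fourier_laplacian_apply, symbol]
  push_cast
  simp only [smul_eq_mul]
  ring

theorem hasTemperateGrowth_inv_symbol {m : ℝ} (hm : 0 < m) :
    (fun ξ : E3 => (symbol m ξ)⁻¹).HasTemperateGrowth := by
  have h1 := Function.hasTemperateGrowth_one_add_norm_sq_rpow E3 (-1)
  have h2 : (fun ξ : E3 => (2 * Real.pi / √m) • ξ).HasTemperateGrowth :=
    ((2 * Real.pi / √m) • ContinuousLinearMap.id ℝ E3).hasTemperateGrowth
  -- The inverse symbol is `m⁻¹ (1 + ‖c ξ‖²)⁻¹` with `c = 2π / √m`.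
  have h3 := (Function.HasTemperateGrowth.const (E := E3) (m⁻¹ : ℝ)).mul (h1.comp h2)
  suffices h : (fun ξ : E3 => (symbol m ξ)⁻¹) = (fun _ => m⁻¹) *
      ((fun x : E3 => (1 + ‖x‖ ^ 2) ^ (-1 : ℝ)) ∘ fun ξ => (2 * Real.pi / √m) • ξ) by
    rw [h]
    exact h3
  funext ξ
  have hs := Real.sq_sqrt hm.le
  have hpos : 0 < √m := Real.sqrt_pos.2 hm
  simp only [Pi.mul_apply, Function.comp_apply]
  rw [Real.rpow_neg_one, ← mul_inv, symbol, norm_smul, Real.norm_eq_abs, mul_pow _ ‖ξ‖, mul_pow _ ‖ξ‖,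
    sq_abs, div_pow, hs]
  field_simp
  ring_nf

/-- Division by the symbol preserves the Schwartz space. Consequently every test function may be
written as `helmholtz m φ`, on which all the duality arguments below rest. -/
theorem exists_helmholtz_eq {m : ℝ} (hm : 0 < m) (ψ : 𝓢(E3, ℂ)) : ∃ φ, helmholtz m φ = ψ := by
  refine ⟨𝓕⁻ (SchwartzMap.smulLeftCLM ℂ (fun ξ : E3 => (symbol m ξ)⁻¹) (𝓕 ψ)), ?_⟩
  have hinj : Function.Injective (𝓕 : 𝓢(E3, ℂ) → 𝓢(E3, ℂ)) := fun a b hab => by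
    have := congrArg (𝓕⁻ : 𝓢(E3, ℂ) → 𝓢(E3, ℂ)) hab
    rwa [FourierTransform.fourierInv_fourier_eq, FourierTransform.fourierInv_fourier_eq] at this
  refine hinj (SchwartzMap.ext fun ξ => ?_)
  rw [fourier_helmholtz_apply, FourierTransform.fourier_fourierInv_eq,
    SchwartzMap.smulLeftCLM_apply_apply (hasTemperateGrowth_inv_symbol hm), Complex.real_smul,
    ← mul_assoc, ← Complex.ofReal_mul, mul_inv_cancel₀ (symbol_pos hm ξ).ne']
  simp

theorem norm_toLp_sq (φ : 𝓢(E3, ℂ)) :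
    Integrable (fun x => ‖φ x‖ ^ 2) ∧ ‖φ.toLp 2‖ ^ 2 = ∫ x, ‖φ x‖ ^ 2 := by
  refine ⟨(memLp_two_iff_integrable_sq_norm (φ.continuous.aestronglyMeasurable)).1 (φ.memLp 2), ?_⟩
  rw [norm_sq_eq_integral]
  refine integral_congr_ae ?_
  filter_upwards [φ.coeFn_toLp 2] with x hx
  rw [hx]

theorem integral_mul_le_sqrt_mul_sqrt {X : Type*} [MeasurableSpace X] {μ : Measure X}
    {A B : X → ℝ} (hA : AEStronglyMeasurable A μ) (hB : AEStronglyMeasurable B μ)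
    (hA0 : ∀ x, 0 ≤ A x) (hB0 : ∀ x, 0 ≤ B x) (hA2 : Integrable (fun x => A x ^ 2) μ)
    (hB2 : Integrable (fun x => B x ^ 2) μ) :
    ∫ x, A x * B x ∂μ ≤ √(∫ x, A x ^ 2 ∂μ) * √(∫ x, B x ^ 2 ∂μ) := by
  have hA2 : MemLp A (ENNReal.ofReal 2) μ := by
    rw [ENNReal.ofReal_ofNat]
    exact (memLp_two_iff_integrable_sq hA).2 hA2
  have hB2 : MemLp B (ENNReal.ofReal 2) μ := by
    rw [ENNReal.ofReal_ofNat]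
    exact (memLp_two_iff_integrable_sq hB).2 hB2
  have hcs := integral_mul_le_Lp_mul_Lq_of_nonneg (Real.HolderConjugate.two_two)
    (Eventually.of_forall hA0) (Eventually.of_forall hB0) hA2 hB2
  simpa only [Real.rpow_two, ← Real.sqrt_eq_rpow] using hcs

theorem norm_integral_mul_le_of_symbol_mul {m : ℝ} (hm : 0 < m) {g P Q : E3 → ℂ}
    (hg : Continuous g) {M N : ℝ} (hM : 0 ≤ M) (hN : 0 ≤ N)
    (hInt : Integrable fun ξ => (‖g ξ‖ / symbol m ξ) ^ 2)
    (hle : ∫ ξ, (‖g ξ‖ / symbol m ξ) ^ 2 ≤ M ^ 2) (hQ : Continuous Q)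
    (hQi : Integrable fun ξ => ‖Q ξ‖ ^ 2) (hQN : N ^ 2 = ∫ ξ, ‖Q ξ‖ ^ 2)
    (hPQ : ∀ ξ, Q ξ = (symbol m ξ : ℂ) * P ξ) :
    ‖∫ ξ, P ξ * g ξ‖ ≤ M * N := by
  have hAB : ∀ ξ, ‖P ξ * g ξ‖ = ‖Q ξ‖ * (‖g ξ‖ / symbol m ξ) := fun ξ => by
    have hs := symbol_pos hm ξ
    rw [hPQ, norm_mul, norm_mul, Complex.norm_real, Real.norm_eq_abs, abs_of_pos hs]
    field_simp
  have hBc : Continuous fun ξ => ‖g ξ‖ / symbol m ξ :=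
    hg.norm.div (continuous_symbol m) fun ξ => (symbol_pos hm ξ).ne'
  have hcs := integral_mul_le_sqrt_mul_sqrt (hQ.norm.aestronglyMeasurable (μ := volume))
    hBc.aestronglyMeasurable (fun ξ => norm_nonneg _)
    (fun ξ => div_nonneg (norm_nonneg _) (symbol_pos hm ξ).le) hQi hInt
  calc ‖∫ ξ, P ξ * g ξ‖ ≤ ∫ ξ, ‖P ξ * g ξ‖ := norm_integral_le_integral_norm _
    _ = ∫ ξ, ‖Q ξ‖ * (‖g ξ‖ / symbol m ξ) := integral_congr_ae (Eventually.of_forall hAB)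
    _ ≤ √(∫ ξ, ‖Q ξ‖ ^ 2) * √(∫ ξ, (‖g ξ‖ / symbol m ξ) ^ 2) := hcs
    _ ≤ N * M := by
        gcongr
        · rw [← hQN, Real.sqrt_sq hN]
        · exact Real.sqrt_le_iff.2 ⟨hM, hle⟩
    _ = M * N := mul_comm _ _

/-- The Cauchy-Schwarz inequality on the Fourier side. -/
theorem norm_integral_fourier_mul_le {m : ℝ} (hm : 0 < m) {g : E3 → ℂ} (hg : Continuous g)
    {M : ℝ} (hM : 0 ≤ M) (hInt : Integrable fun ξ => (‖g ξ‖ / symbol m ξ) ^ 2)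
    (hle : ∫ ξ, (‖g ξ‖ / symbol m ξ) ^ 2 ≤ M ^ 2) (φ : 𝓢(E3, ℂ)) :
    ‖∫ ξ, 𝓕 φ ξ * g ξ‖ ≤ M * ‖(helmholtz m φ).toLp 2‖ := by
  obtain ⟨hψi, hψ⟩ := norm_toLp_sq (𝓕 (helmholtz m φ))
  rw [SchwartzMap.norm_fourier_toL2_eq] at hψ
  exact norm_integral_mul_le_of_symbol_mul hm hg hM (norm_nonneg _) hInt hle
    (𝓕 (helmholtz m φ)).continuous hψi hψ (fourier_helmholtz_apply m φ)

/-- The decay is of order four, more than the dimension three; `min 1 m` compares the symbol with `1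
+ ‖ξ‖²`. -/
theorem integrable_inv_symbol_sq {m : ℝ} (hm : 0 < m) :
    Integrable fun ξ : E3 => ((symbol m ξ)⁻¹) ^ 2 := by
  have h := integrable_rpow_neg_one_add_norm_sq (E := E3) (μ := volume) (r := 4)
    (by simp; norm_num)
  have hpi := Real.pi_pos
  set c := min 1 m with hc
  have hc0 : 0 < c := lt_min one_pos hm
  refine (h.const_mul ((c⁻¹) ^ 2)).mono'
    (((continuous_symbol m).inv₀ fun ξ => (symbol_pos hm ξ).ne').pow 2).aestronglyMeasurable
    (Eventually.of_forall fun ξ => ?_)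
  have e : ((1 : ℝ) + ‖ξ‖ ^ 2) ^ (-4 / 2 : ℝ) = ((1 + ‖ξ‖ ^ 2)⁻¹) ^ 2 := by
    rw [show (-4 / 2 : ℝ) = -(2 : ℕ) by norm_num, Real.rpow_neg (by positivity),
      Real.rpow_natCast, inv_pow]
  rw [e, ← mul_pow, ← mul_inv, Real.norm_eq_abs, abs_of_nonneg (sq_nonneg _)]
  have h1 : c * (1 + ‖ξ‖ ^ 2) ≤ symbol m ξ := by
    rw [symbol, mul_pow]
    have a1 : c ≤ 1 := min_le_left _ _
    have a2 : c ≤ m := min_le_right _ _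
    have a3 : 1 ≤ (2 * Real.pi) ^ 2 := by nlinarith [Real.two_le_pi]
    nlinarith [sq_nonneg ‖ξ‖, mul_le_mul_of_nonneg_right (a1.trans a3) (sq_nonneg ‖ξ‖)]
  exact pow_le_pow_left₀ (inv_pos.2 (symbol_pos hm ξ)).le (inv_anti₀ (by positivity) h1) 2

/-- The resolvent maps `L¹` to `L²`. -/
theorem exists_norm_toLp_le_integral_norm_helmholtz {m : ℝ} (hm : 0 < m) :
    ∃ C : ℝ, 0 ≤ C ∧ ∀ φ : 𝓢(E3, ℂ), ‖φ.toLp 2‖ ≤ C * ∫ x, ‖helmholtz m φ x‖ := by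
  refine ⟨√(∫ ξ : E3, ((symbol m ξ)⁻¹) ^ 2), Real.sqrt_nonneg _, fun φ => ?_⟩
  obtain ⟨hφi, hφ⟩ := norm_toLp_sq (𝓕 φ)
  rw [SchwartzMap.norm_fourier_toL2_eq] at hφ
  set I := ∫ x, ‖helmholtz m φ x‖ with hI
  have hI0 : 0 ≤ I := integral_nonneg fun x => norm_nonneg _
  -- The transform of `helmholtz m φ` is bounded by its `L¹` norm, and the inverse symbol is square
  -- integrable.
  have hpt : ∀ ξ, ‖𝓕 φ ξ‖ ≤ (symbol m ξ)⁻¹ * I := fun ξ => by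
    have hs := symbol_pos hm ξ
    have h1 : ‖𝓕 (helmholtz m φ) ξ‖ ≤ I := by
      rw [SchwartzMap.fourier_coe]
      exact VectorFourier.norm_fourierIntegral_le_integral_norm _ _ _ _ _
    rw [fourier_helmholtz_apply, norm_mul, Complex.norm_real, Real.norm_eq_abs,
      abs_of_pos hs] at h1
    rwa [inv_mul_eq_div, le_div_iff₀ hs, mul_comm]
  refine abs_le_of_sq_le_sq' ?_ (by positivity) |>.2
  rw [hφ, mul_pow, Real.sq_sqrt (integral_nonneg fun ξ => sq_nonneg _), ← integral_mul_const]
  refine integral_mono hφi ((integrable_inv_symbol_sq hm).mul_const _) fun ξ => ?_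
  simp only
  rw [← mul_pow]
  exact pow_le_pow_left₀ (norm_nonneg _) (hpt ξ) 2

/-! ### Solutions of `(-Δ + m) u = F` in the sense of distributions -/

theorem helmholtz_toDist_apply {m : ℝ} (T : 𝓢'(E3, ℂ)) (φ : 𝓢(E3, ℂ)) :
    (-Δ T + (m : ℂ) • T) φ = T (helmholtz m φ) := by
  rw [helmholtz, map_add, map_neg, map_smul, ← TemperedDistribution.laplacian_apply_apply]
  rfl

theorem norm_star_Lp {X : Type*} [MeasurableSpace X] {μ : Measure X} (v : Lp ℂ 2 μ) :
    ‖star v‖ = ‖v‖ := by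
  rw [Lp.norm_def, Lp.norm_def]
  congr 1
  refine eLpNorm_congr_norm_ae ?_
  filter_upwards [Lp.coeFn_star v] with x h
  rw [h, Pi.star_apply, norm_star]

/-- The distributional pairing is bilinear while the inner product is conjugate-linear in its first
entry; hence the `star`. -/
theorem toDist_apply_eq_inner (F : L2R3) (φ : 𝓢(E3, ℂ)) :
    toDist F φ = inner ℂ (star F) (φ.toLp 2) := by
  rw [toDist_apply, L2.inner_def]
  refine integral_congr_ae ?_
  filter_upwards [φ.coeFn_toLp 2, Lp.coeFn_star F] with x h1 h2
  rw [h2, Pi.star_apply, h1]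
  simp

theorem norm_toDist_apply_le (F : L2R3) (φ : 𝓢(E3, ℂ)) : ‖toDist F φ‖ ≤ ‖F‖ * ‖φ.toLp 2‖ := by
  rw [toDist_apply_eq_inner]
  exact (norm_inner_le_norm _ _).trans (by rw [norm_star_Lp])

/-- An element of `L²` is bounded by its action on Schwartz functions. -/
theorem norm_le_of_norm_toDist_apply_le {v : L2R3} {M : ℝ} (hM : 0 ≤ M)
    (h : ∀ ψ : 𝓢(E3, ℂ), ‖toDist v ψ‖ ≤ M * ‖ψ.toLp 2‖) : ‖v‖ ≤ M := by
  have hd := SchwartzMap.denseRange_toLpCLM (E := E3) (F := ℂ) (p := 2) (μ := volume) (by simp)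
  have key : ∀ w : L2R3, ‖inner ℂ (star v) w‖ ≤ M * ‖w‖ := fun w => by
    refine hd.induction_on (p := fun w : L2R3 => ‖inner ℂ (star v) w‖ ≤ M * ‖w‖) w ?_ fun ψ => ?_
    · exact isClosed_le (by fun_prop) (by fun_prop)
    · have := h ψ
      rwa [toDist_apply_eq_inner] at this
  have h1 := key (star v)
  rw [inner_self_eq_norm_sq_to_K, norm_star_Lp] at h1
  by_contra hlt
  push Not at hlt
  have h2 : ‖v‖ ^ 2 ≤ M * ‖v‖ := by simpa using h1
  nlinarith

theorem toDist_sub (u v : L2R3) : toDist (u - v) = toDist u - toDist v :=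
  map_sub (Lp.toTemperedDistributionCLM ℂ volume 2) u v

theorem toDist_add (u v : L2R3) : toDist (u + v) = toDist u + toDist v :=
  map_add (Lp.toTemperedDistributionCLM ℂ volume 2) u v

theorem toDist_smul (c : ℂ) (u : L2R3) : toDist (c • u) = c • toDist u :=
  map_smul (Lp.toTemperedDistributionCLM ℂ volume 2) c u

theorem toDist_toLp (φ : 𝓢(E3, ℂ)) :
    toDist (φ.toLp 2) = SchwartzMap.toTemperedDistributionCLM E3 ℂ volume φ :=
  Lp.toTemperedDistribution_toLp_eq φ

theorem helmholtz_toDist_toLp (m : ℝ) (φ : 𝓢(E3, ℂ)) :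
    -Δ (toDist (φ.toLp 2)) + (m : ℂ) • toDist (φ.toLp 2) = toDist ((helmholtz m φ).toLp 2) := by
  rw [toDist_toLp, toDist_toLp, TemperedDistribution.laplacian_toTemperedDistributionCLM_eq,
    helmholtz, map_add, map_neg, map_smul]

/-- A continuous function is bounded by its averages. -/
theorem norm_le_of_norm_integral_smul_le {w : E3 → ℂ} (hw : Continuous w) {B : ℝ}
    (h : ∀ ρ : 𝓢(E3, ℂ), ‖∫ y, ρ y • w y‖ ≤ B * ∫ y, ‖ρ y‖) (x : E3) : ‖w x‖ ≤ B := by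
  refine le_of_forall_pos_le_add fun ε hε => ?_
  obtain ⟨r, hr, hball⟩ := Metric.continuous_iff.1 hw x ε hε
  -- Normalized bumps have `L¹` norm one and are supported where `w` differs from `w x` by less than
  -- `ε`.
  let b : ContDiffBump x := ⟨r / 2, r, by positivity, by linarith⟩
  have hsupp : HasCompactSupport (b.normed volume) := b.hasCompactSupport_normed
  have hcs : HasCompactSupport fun y => ((b.normed volume y : ℝ) : ℂ) :=
    hsupp.comp_left (g := Complex.ofReal) Complex.ofReal_zero
  have hcd : ContDiff ℝ (↑(⊤ : ℕ∞)) fun y => ((b.normed volume y : ℝ) : ℂ) :=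
    Complex.ofRealCLM.contDiff.comp b.contDiff_normed
  have h1 := h (hcs.toSchwartzMap hcd)
  have hnn : ∀ y, 0 ≤ b.normed volume y := b.nonneg_normed
  have e1 : ∫ y, ‖(hcs.toSchwartzMap hcd) y‖ = 1 := by
    rw [← b.integral_normed (μ := volume)]
    refine integral_congr_ae (Eventually.of_forall fun y => ?_)
    change ‖((b.normed volume y : ℝ) : ℂ)‖ = _
    rw [Complex.norm_real, Real.norm_eq_abs, abs_of_nonneg (hnn y)]
  rw [e1, mul_one] at h1
  have h2 : ‖∫ y, b.normed volume y • w y‖ ≤ B := h1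
  have hc : Continuous fun y => b.normed volume y := b.continuous_normed
  have i1 : Integrable fun y => b.normed volume y • w y :=
    (hc.smul hw).integrable_of_hasCompactSupport hsupp.smul_right
  have i2 : Integrable fun y => b.normed volume y • w x :=
    (b.integrable_normed (μ := volume)).smul_const _
  have h3 : ‖(∫ y, b.normed volume y • w y) - w x‖ ≤ ε := by
    have : w x = ∫ y, b.normed volume y • w x := by
      rw [integral_smul_const, b.integral_normed, one_smul]
    rw [this, ← integral_sub i1 i2]
    refine (norm_integral_le_of_norm_le ((b.integrable_normed (μ := volume)).mul_const ε)
      (Eventually.of_forall fun y => ?_)).trans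
      (by rw [integral_mul_const, b.integral_normed, one_mul])
    rw [← smul_sub, norm_smul, Real.norm_eq_abs, abs_of_nonneg (hnn y)]
    by_cases hy : y ∈ Metric.ball x r
    · have := (hball y hy).le
      rw [dist_eq_norm] at this
      exact mul_le_mul_of_nonneg_left this (hnn y)
    · have : b.normed volume y = 0 := by
        by_contra hne
        have hm : y ∈ Function.support (b.normed volume) := hne
        rw [b.support_normed_eq] at hm
        exact hy hm
      simp [this]
  calc ‖w x‖ = ‖(∫ y, b.normed volume y • w y) - ((∫ y, b.normed volume y • w y) - w x)‖ := by
        rw [sub_sub_cancel]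
    _ ≤ B + ε := (norm_sub_le _ _).trans (add_le_add h2 h3)

/-- The supremum norm of a solution of `(-Δ + m) u = F` is bounded by the norm of `F`. -/
theorem exists_norm_le_of_helmholtz_eq {m : ℝ} (hm : 0 < m) : ∃ C : ℝ, 0 ≤ C ∧
    ∀ (u F : L2R3) (w : E3 → ℂ), -Δ (toDist u) + (m : ℂ) • toDist u = toDist F →
      Continuous w → u =ᵐ[volume] w → ∀ x, ‖w x‖ ≤ C * ‖F‖ := by
  obtain ⟨C, hC0, hC⟩ := exists_norm_toLp_le_integral_norm_helmholtz hm
  refine ⟨C, hC0, fun u F w hu hw huw => norm_le_of_norm_integral_smul_le hw fun ρ => ?_⟩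
  -- Transposition: the average of `w` against `ρ` is `F` tested on the solution `φ`, so the bound
  -- from `L¹` to `L²` for `φ` becomes one from `L²` to the supremum norm for `u`.
  obtain ⟨φ, hφ⟩ := exists_helmholtz_eq hm ρ
  have h1 : ∫ y, ρ y • w y = toDist F φ := by
    rw [← hu, helmholtz_toDist_apply, hφ, toDist_apply]
    refine integral_congr_ae ?_
    filter_upwards [huw] with y hy
    rw [hy]
  have h2 := hC φ
  rw [hφ] at h2
  rw [h1, mul_comm C, mul_assoc]
  exact (norm_toDist_apply_le F φ).trans (mul_le_mul_of_nonneg_left h2 (norm_nonneg F))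

/-! ### Duality between densities and solutions -/

namespace ClosedCurve

variable (Γ : ClosedCurve)

theorem eq_integral_character_mul_fourier (φ : 𝓢(E3, ℂ)) (s : ℝ) :
    φ (Γ.σ s) = ∫ ξ, Γ.character ξ s * 𝓕 φ ξ := by
  have h1 : φ (Γ.σ s) = 𝓕⁻ (𝓕 φ) (Γ.σ s) := by rw [FourierTransform.fourierInv_fourier_eq]
  rw [h1, SchwartzMap.fourierInv_coe, Real.fourierInv_eq']
  refine integral_congr_ae (Eventually.of_forall fun ξ => ?_)
  simp only [character, smul_eq_mul]
  congr 2
  push_cast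
  ring

theorem integral_mul_eq_integral_fourier_mul_curveFourier {f : ℝ → ℂ}
    (hf : Integrable f (volume.restrict (Set.Ico 0 Γ.L))) (φ : 𝓢(E3, ℂ)) :
    ∫ s in Set.Ico 0 Γ.L, f s * φ (Γ.σ s) = ∫ ξ, 𝓕 φ ξ * Γ.curveFourier f ξ := by
  have hc : Continuous fun p : ℝ × E3 => Γ.character p.2 p.1 :=
    Γ.continuous_character.comp (by fun_prop : Continuous fun p : ℝ × E3 => (p.2, p.1))
  have hi : Integrable (fun p : ℝ × E3 => f p.1 * 𝓕 φ p.2 * Γ.character p.2 p.1)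
      ((volume.restrict (Set.Ico 0 Γ.L)).prod volume) :=
    (hf.mul_prod (𝓕 φ).integrable).mul_bdd (c := 1) hc.aestronglyMeasurable
      (Eventually.of_forall fun p => (Γ.norm_character p.2 p.1).le)
  calc ∫ s in Set.Ico 0 Γ.L, f s * φ (Γ.σ s)
      = ∫ s in Set.Ico 0 Γ.L, ∫ ξ, f s * 𝓕 φ ξ * Γ.character ξ s := by
        refine integral_congr_ae (Eventually.of_forall fun s => ?_)
        simp only
        rw [eq_integral_character_mul_fourier, ← integral_const_mul]
        refine integral_congr_ae (Eventually.of_forall fun ξ => ?_)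
        simp only
        ring
    _ = ∫ ξ, ∫ s in Set.Ico 0 Γ.L, f s * 𝓕 φ ξ * Γ.character ξ s := integral_integral_swap hi
    _ = ∫ ξ, 𝓕 φ ξ * Γ.curveFourier f ξ := by
        refine integral_congr_ae (Eventually.of_forall fun ξ => ?_)
        simp only
        rw [curveFourier, ← integral_const_mul]
        refine integral_congr_ae (Eventually.of_forall fun s => ?_)
        simp only
        ring

/-- The pairing of a density with vanishing moments over `n` cells and a Schwartz function. -/
theorem exists_norm_integral_mul_schwartz_le {m : ℝ} (hm : 0 < m) :
    ∃ C : ℝ, 0 < C ∧ ∀ n : ℕ, 0 < n →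
    ∀ f : ℝ → ℂ, MemLp f 2 (volume.restrict (Set.Ico 0 Γ.L)) →
    (∀ i : Fin n, ∫ r in cell (Γ.L / n) i, f r = 0) →
    (∀ i : Fin n, ∫ r in cell (Γ.L / n) i, (r : ℂ) * f r = 0) → ∀ φ : 𝓢(E3, ℂ),
    ‖∫ s in Set.Ico 0 Γ.L, f s * φ (Γ.σ s)‖
      ≤ C / n * √(∫ s in Set.Ico 0 Γ.L, ‖f s‖ ^ 2) * ‖(helmholtz m φ).toLp 2‖ := by
  obtain ⟨C, hC0, hC⟩ := Γ.exists_integral_curveFourier_div_symbol_le hm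
  refine ⟨C, hC0, fun n hn f hf h0 h1 φ => ?_⟩
  obtain ⟨hi, hle⟩ := hC n hn f hf h0 h1
  have hf1 := hf.integrable (q := 2) (by norm_num)
  rw [Γ.integral_mul_eq_integral_fourier_mul_curveFourier hf1]
  refine norm_integral_fourier_mul_le hm (Γ.continuous_curveFourier hf1) (by positivity) hi ?_ φ
  rw [mul_pow, Real.sq_sqrt (integral_nonneg fun s => sq_nonneg _)]
  exact hle

end ClosedCurve

theorem laplacian_sub (S T : 𝓢'(E3, ℂ)) : Δ (S - T) = Δ S - Δ T :=
  map_sub (LineDeriv.laplacianCLM ℝ E3 𝓢'(E3, ℂ)) S T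

theorem laplacian_add (S T : 𝓢'(E3, ℂ)) : Δ (S + T) = Δ S + Δ T :=
  map_add (LineDeriv.laplacianCLM ℝ E3 𝓢'(E3, ℂ)) S T

theorem laplacian_smul (c : ℂ) (T : 𝓢'(E3, ℂ)) : Δ (c • T) = c • Δ T := by
  rw [← TemperedDistribution.laplacianCLM_apply, ← TemperedDistribution.laplacianCLM_apply,
    map_smul]

namespace ClosedCurve

variable (Γ : ClosedCurve)

theorem memLp_comp_σ (h : Γ.L2) :
    MemLp (fun s => h (Γ.σ s)) 2 (volume.restrict (Set.Ico 0 Γ.L)) :=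
  (Lp.memLp h).comp_measurePreserving Γ.measurePreserving_σ

theorem sqrt_integral_norm_sq_comp_σ (h : Γ.L2) :
    √(∫ s in Set.Ico 0 Γ.L, ‖h (Γ.σ s)‖ ^ 2) = ‖h‖ := by
  rw [← Γ.norm_sq_eq_integral_Ico h (f := fun s => h (Γ.σ s)) EventuallyEq.rfl,
    Real.sqrt_sq (norm_nonneg _)]

theorem integral_arcLength {f : E3 → ℂ} (hf : AEStronglyMeasurable f Γ.arcLength) :
    ∫ x, f x ∂Γ.arcLength = ∫ s in Set.Ico 0 Γ.L, f (Γ.σ s) :=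
  integral_map Γ.measurable_σ.aemeasurable hf

theorem deltaDist_apply_eq_integral (h : Γ.L2) (φ : 𝓢(E3, ℂ)) :
    Γ.deltaDist h φ = ∫ s in Set.Ico 0 Γ.L, h (Γ.σ s) * φ (Γ.σ s) := by
  rw [deltaDist_apply]
  refine (Γ.integral_arcLength
    (φ.continuous.aestronglyMeasurable.smul (Lp.aestronglyMeasurable h))).trans ?_
  simp only [Pi.smul_apply', smul_eq_mul, mul_comm]

theorem integral_cell_eq_zero {n : ℕ} {h : Γ.L2} {i : Fin n}
    (h0 : Γ.cellMoment (Γ.L / n) 0 i h = 0) : ∫ r in cell (Γ.L / n) i, h (Γ.σ r) = 0 := by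
  rw [Γ.cellMoment_apply 0 i h (f := fun s => h (Γ.σ s)) EventuallyEq.rfl] at h0
  simpa using h0

theorem integral_cell_mul_eq_zero {n : ℕ} {h : Γ.L2} {i : Fin n}
    (h1 : Γ.cellMoment (Γ.L / n) 1 i h = 0) :
    ∫ r in cell (Γ.L / n) i, (r : ℂ) * h (Γ.σ r) = 0 := by
  rw [Γ.cellMoment_apply 1 i h (f := fun s => h (Γ.σ s)) EventuallyEq.rfl] at h1
  simpa using h1

theorem IsGamma.helmholtz_eq {Γ : ClosedCurve} {lam : ℝ} {h : Γ.L2} {v : L2R3}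
    (hv : Γ.IsGamma lam h v) :
    -Δ (toDist v) + ((-lam : ℝ) : ℂ) • toDist v = Γ.deltaDist h := by
  rw [← hv, Complex.ofReal_neg]
  module

/-- `γ h` has norm `O(1/n)` if `h` has vanishing moments over `n` cells. -/
theorem exists_norm_le_of_isGamma {lam : ℝ} (hlam : lam < 0) : ∃ C : ℝ, 0 < C ∧ ∀ n : ℕ, 0 < n →
    ∀ (h : Γ.L2) (v : L2R3), Γ.IsGamma lam h v →
    (∀ i : Fin n, Γ.cellMoment (Γ.L / n) 0 i h = 0) →
    (∀ i : Fin n, Γ.cellMoment (Γ.L / n) 1 i h = 0) → ‖v‖ ≤ C / n * ‖h‖ := by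
  have hm : 0 < -lam := by linarith
  obtain ⟨C, hC0, hC⟩ := Γ.exists_norm_integral_mul_schwartz_le hm
  refine ⟨C, hC0, fun n hn h v hv h0 h1 => norm_le_of_norm_toDist_apply_le (by positivity)
    fun ψ => ?_⟩
  obtain ⟨φ, hφ⟩ := exists_helmholtz_eq hm ψ
  have h2 := hC n hn _ (Γ.memLp_comp_σ h) (fun i => Γ.integral_cell_eq_zero (h0 i))
    (fun i => Γ.integral_cell_mul_eq_zero (h1 i)) φ
  rwa [sqrt_integral_norm_sq_comp_σ, ← deltaDist_apply_eq_integral, ← hv.helmholtz_eq,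
    helmholtz_toDist_apply, hφ] at h2

theorem integral_cell_conj_eq_zero {S : Set ℝ} {f : ℝ → ℂ} (hf : ∫ r in S, f r = 0) :
    ∫ r in S, starRingEnd ℂ (f r) = 0 := by
  rw [integral_conj, hf, map_zero]

/-- The pairing of a density with vanishing moments over `n` cells and the restriction to the curve
of a solution of `(-Δ - lam) u = F`. -/
theorem exists_norm_inner_le_of_isRestriction {lam : ℝ} (hlam : lam < 0) :
    ∃ C : ℝ, 0 < C ∧ ∀ n : ℕ, 0 < n →
    ∀ (h g : Γ.L2) (u F : L2R3), -Δ (toDist u) + ((-lam : ℝ) : ℂ) • toDist u = toDist F →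
    Γ.IsRestriction u g →
    (∀ i : Fin n, Γ.cellMoment (Γ.L / n) 0 i h = 0) →
    (∀ i : Fin n, Γ.cellMoment (Γ.L / n) 1 i h = 0) →
    ‖(inner ℂ h g : ℂ)‖ ≤ C / n * ‖h‖ * ‖F‖ := by
  have hm : 0 < -lam := by linarith
  obtain ⟨C, hC0, hC⟩ := Γ.exists_norm_integral_mul_schwartz_le hm
  obtain ⟨B, hB0, hB⟩ := exists_norm_le_of_helmholtz_eq hm
  refine ⟨C, hC0, fun n hn h g u F hu ⟨w, hw, huw, hgw⟩ h0 h1 => ?_⟩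
  -- The inner product conjugates `h`. The moments are taken against real polynomials, so those of
  -- the conjugate vanish too.
  set f : ℝ → ℂ := fun s => starRingEnd ℂ (h (Γ.σ s)) with hfdef
  have hf : MemLp f 2 (volume.restrict (Set.Ico 0 Γ.L)) := (Γ.memLp_comp_σ h).star
  have hf1 := hf.integrable (q := 2) (by norm_num)
  have hfn : √(∫ s in Set.Ico 0 Γ.L, ‖f s‖ ^ 2) = ‖h‖ := by
    rw [← Γ.sqrt_integral_norm_sq_comp_σ h]
    simp only [hfdef, RCLike.norm_conj]
  have hinner : (inner ℂ h g : ℂ) = ∫ s in Set.Ico 0 Γ.L, f s * w (Γ.σ s) := by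
    rw [L2.inner_def]
    have e : ∫ x, inner ℂ (h x) (g x) ∂Γ.arcLength
        = ∫ x, starRingEnd ℂ (h x) * w x ∂Γ.arcLength := by
      refine integral_congr_ae ?_
      filter_upwards [hgw] with x hx
      rw [hx, RCLike.inner_apply, mul_comm]
    rw [e, Γ.integral_arcLength]
    exact (Complex.continuous_conj.comp_aestronglyMeasurable (Lp.aestronglyMeasurable h)).mul
      hw.aestronglyMeasurable
  have hmom0 : ∀ i : Fin n, ∫ r in cell (Γ.L / n) i, f r = 0 := fun i =>
    integral_cell_conj_eq_zero (Γ.integral_cell_eq_zero (h0 i))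
  have hmom1 : ∀ i : Fin n, ∫ r in cell (Γ.L / n) i, (r : ℂ) * f r = 0 := fun i => by
    have := integral_cell_conj_eq_zero (Γ.integral_cell_mul_eq_zero (h1 i))
    simpa only [map_mul, Complex.conj_ofReal] using this
  have hpair := hC n hn f hf hmom0 hmom1
  rw [hfn] at hpair
  set I : ℝ := ∫ s in Set.Ico 0 Γ.L, ‖f s‖ with hI
  have hI0 : 0 ≤ I := integral_nonneg fun s => norm_nonneg _
  -- The pairing estimate is available only for Schwartz functions, so `u` is compared with such a
  -- `φ`. The difference solves the same equation with right-hand side `F - (-Δ - lam) φ` and is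
  -- controlled in supremum norm. By density the right-hand side of `φ` can be replaced by any `G`,
  -- finally by `F`.
  have hsplit : ∀ φ : 𝓢(E3, ℂ), ‖(inner ℂ h g : ℂ)‖
      ≤ C / n * ‖h‖ * ‖(helmholtz (-lam) φ).toLp 2‖
        + I * (B * ‖F - (helmholtz (-lam) φ).toLp 2 volume‖) := fun φ => by
    have hsup := hB (u - φ.toLp 2 volume) (F - (helmholtz (-lam) φ).toLp 2 volume) (fun x => w x - φ x)
      (by
        rw [toDist_sub, toDist_sub, ← hu, ← helmholtz_toDist_toLp]
        rw [laplacian_sub]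
        module)
      (hw.sub φ.continuous)
      (by
        filter_upwards [huw, φ.coeFn_toLp 2, Lp.coeFn_sub u (φ.toLp 2 volume)] with x e1 e2 e3
        rw [e3, Pi.sub_apply, e1, e2])
    have i1 : Integrable (fun s => f s * φ (Γ.σ s)) (volume.restrict (Set.Ico 0 Γ.L)) :=
      hf.integrable_mul (q := 2)
        (memLp_Ico_of_continuous (φ.continuous.comp Γ.continuous_σ))
    have i2 : Integrable (fun s => f s * (w (Γ.σ s) - φ (Γ.σ s)))
        (volume.restrict (Set.Ico 0 Γ.L)) :=
      hf.integrable_mul (q := 2)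
        (memLp_Ico_of_continuous ((hw.sub φ.continuous).comp Γ.continuous_σ))
    have e1 : (inner ℂ h g : ℂ) = (∫ s in Set.Ico 0 Γ.L, f s * φ (Γ.σ s))
        + ∫ s in Set.Ico 0 Γ.L, f s * (w (Γ.σ s) - φ (Γ.σ s)) := by
      rw [hinner, ← integral_add i1 i2]
      refine integral_congr_ae (Eventually.of_forall fun s => ?_)
      simp only
      ring
    rw [e1]
    refine (norm_add_le _ _).trans (add_le_add (hpair φ) ?_)
    rw [hI, ← integral_mul_const]
    refine norm_integral_le_of_norm_le (hf1.norm.mul_const _) (Eventually.of_forall fun s => ?_)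
    rw [norm_mul]
    exact mul_le_mul_of_nonneg_left (hsup (Γ.σ s)) (norm_nonneg _)
  have hd := SchwartzMap.denseRange_toLpCLM (E := E3) (F := ℂ) (p := 2) (μ := volume) (by simp)
  have key : ∀ G : L2R3, ‖(inner ℂ h g : ℂ)‖ ≤ C / n * ‖h‖ * ‖G‖ + I * (B * ‖F - G‖) := fun G => by
    refine hd.induction_on (p := fun G : L2R3 =>
      ‖(inner ℂ h g : ℂ)‖ ≤ C / n * ‖h‖ * ‖G‖ + I * (B * ‖F - G‖)) G ?_ fun ψ => ?_
    · exact isClosed_le (by fun_prop) (by fun_prop)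
    · obtain ⟨φ, hφ⟩ := exists_helmholtz_eq hm ψ
      have := hsplit φ
      rwa [hφ] at this
  simpa using key F

end ClosedCurve

/-! ### The resolvent difference and its density on the curve -/

theorem MemH2.exists_laplacian_eq {u : L2R3} (hu : MemH2 u) :
    ∃ W : L2R3, Δ (toDist u) = toDist W := by
  have h := TemperedDistribution.MemSobolev.laplacian hu
  rw [sub_self, TemperedDistribution.memSobolev_zero_iff] at h
  exact h

namespace ClosedCurve

variable (Γ : ClosedCurve)

theorem deltaDist_add (h g : Γ.L2) : Γ.deltaDist (h + g) = Γ.deltaDist h + Γ.deltaDist g :=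
  map_add (Lp.toTemperedDistributionCLM ℂ Γ.arcLength 2) h g

theorem deltaDist_sub (h g : Γ.L2) : Γ.deltaDist (h - g) = Γ.deltaDist h - Γ.deltaDist g :=
  map_sub (Lp.toTemperedDistributionCLM ℂ Γ.arcLength 2) h g

theorem deltaDist_smul (c : ℂ) (h : Γ.L2) : Γ.deltaDist (c • h) = c • Γ.deltaDist h :=
  map_smul (Lp.toTemperedDistributionCLM ℂ Γ.arcLength 2) c h

theorem deltaDist_injective : Function.Injective Γ.deltaDist := fun h g hg => by
  refine sub_eq_zero.1 (Γ.eq_zero_of_deltaDist_eq_toDist (F := 0) ?_)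
  rw [deltaDist_sub, hg, sub_self]
  exact (map_zero (Lp.toTemperedDistributionCLM ℂ volume 2)).symm

variable {Γ} {α lam : ℝ} {z : ℂ} {R R₀ : L2R3 →L[ℂ] L2R3}

/-- The decomposition of `R f` into its regular and singular parts. -/
theorem exists_decomposition (hα : α ≠ 0)
    (hR : IsResolventAt (Γ.schrodingerGraph lam α) z R) (hR₀ : IsResolventAt freeGraph z R₀)
    (f : L2R3) : ∃ (uc v : L2R3) (h g b : Γ.L2), Γ.IsGamma lam h v ∧
      (h, b) ∈ Γ.graphBClosure lam ∧ Γ.IsRestriction uc g ∧ (α : ℂ) • h = g + b ∧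
      -Δ (toDist uc) + ((-lam : ℝ) : ℂ) • toDist uc = toDist (f + (z - lam) • R f) ∧
      (R - R₀) f = v + (z - lam) • R₀ v ∧
      -Δ (toDist ((R - R₀) f)) - z • toDist ((R - R₀) f) = Γ.deltaDist h := by
  obtain ⟨τ, ⟨uc, v, h, g, b, huc, hv, hu, hb, hg, hτ⟩, heq⟩ := (hR (R f) f).2 rfl
  simp only at hu heq
  obtain ⟨W, hW⟩ := huc.exists_laplacian_eq
  have hα' : ((1 / α : ℝ) : ℂ) * (α : ℂ) = 1 := by
    rw [← Complex.ofReal_mul, one_div_mul_cancel hα, Complex.ofReal_one]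
  have hΔv : Δ (toDist v) = -((lam : ℂ) • toDist v) - Γ.deltaDist h := by
    rw [← hv]
    abel
  have hΔu : Δ (toDist (R f)) = toDist W - (lam : ℂ) • toDist v - Γ.deltaDist h := by
    rw [hu, toDist_add, laplacian_add, hW, hΔv]
    abel
  -- In the equation for `R f`, every term other than `h δ_Σ` and `α⁻¹ τ δ_Σ` is an `L²` function.
  -- The density `h - α⁻¹ τ` thus defines an `L²` function and vanishes.
  have hτh : τ = (α : ℂ) • h := by
    have h0 : h - ((1 / α : ℝ) : ℂ) • τ = 0 := by
      refine Γ.eq_zero_of_deltaDist_eq_toDist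
        (F := f + z • R f + W - (lam : ℂ) • v) ?_
      rw [deltaDist_sub, deltaDist_smul, toDist_sub, toDist_add, toDist_smul, ← heq, hΔu]
      abel
    rw [sub_eq_zero.1 h0, smul_smul, mul_comm, hα', one_smul]
  have hδτ : ((1 / α : ℝ) : ℂ) • Γ.deltaDist τ = Γ.deltaDist h := by
    rw [hτh, deltaDist_smul, smul_smul, hα', one_smul]
  rw [hδτ] at heq
  -- This says `(-Δ - z) u_c = f + (z - lam) v` with `u_c` in `H²`, so `u_c` is the free resolvent
  -- of the right-hand side, and subtracting `R₀ f` leaves `v + (z - lam) R₀ v`.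
  have hΔuc : -Δ (toDist uc) = toDist (f + (z - lam) • v) + z • toDist uc := by
    have e1 : -Δ (toDist uc) = (-Δ (toDist (R f)) - Γ.deltaDist h) - (lam : ℂ) • toDist v := by
      rw [hΔu, hW]
      abel
    rw [e1, heq, hu]
    simp only [toDist_add, toDist_smul]
    module
  have huc0 : uc = R₀ (f + (z - lam) • v) :=
    (hR₀ uc _).1 ⟨huc, by simpa only [toDist_add, toDist_smul] using hΔuc⟩
  have hR₀f : -Δ (toDist (R₀ f)) = toDist (f + z • R₀ f) := ((hR₀ (R₀ f) f).2 rfl).2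
  refine ⟨uc, v, h, g, b, hv, hb, hg, by rw [← hτh, hτ], ?_, ?_, ?_⟩
  · rw [hΔuc, hu, Complex.ofReal_neg]
    simp only [toDist_add, toDist_smul]
    module
  · rw [sub_apply, hu, huc0, map_add, map_smul]
    abel
  · have e1 : -Δ (toDist (R f)) = toDist (f + z • R f) + Γ.deltaDist h := by
      rw [← heq]
      abel
    rw [sub_apply, toDist_sub, laplacian_sub]
    have e2 : -(Δ (toDist (R f)) - Δ (toDist (R₀ f)))
        = -Δ (toDist (R f)) - -Δ (toDist (R₀ f)) := by abel
    rw [e2, e1, hR₀f]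
    simp only [toDist_add, toDist_smul]
    module

/-- The singular part of `R f` depends linearly on `f`. -/
theorem exists_linearMap (hα : α ≠ 0)
    (hR : IsResolventAt (Γ.schrodingerGraph lam α) z R) (hR₀ : IsResolventAt freeGraph z R₀) :
    ∃ T : L2R3 →ₗ[ℂ] Γ.L2, ∀ f, ∃ (uc v : L2R3) (g b : Γ.L2), Γ.IsGamma lam (T f) v ∧
      (T f, b) ∈ Γ.graphBClosure lam ∧ Γ.IsRestriction uc g ∧ (α : ℂ) • T f = g + b ∧
      -Δ (toDist uc) + ((-lam : ℝ) : ℂ) • toDist uc = toDist (f + (z - lam) • R f) ∧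
      (R - R₀) f = v + (z - lam) • R₀ v := by
  -- The choice is arbitrary for each `f`, but `h` is determined: its density is `(-Δ - z)(R - R₀)
  -- f`, which is linear in `f`, and a density determines its function. Linearity of the other parts
  -- is not required.
  choose uc v h g b h1 h2 h3 h4 h5 h6 h7 using exists_decomposition (Γ := Γ) hα hR hR₀
  refine ⟨{ toFun := h, map_add' := fun f f' => ?_, map_smul' := fun c f => ?_ },
    fun f => ⟨uc f, v f, g f, b f, h1 f, h2 f, h3 f, h4 f, h5 f, h6 f⟩⟩
  · refine Γ.deltaDist_injective ?_
    rw [deltaDist_add, ← h7, ← h7, ← h7, map_add, toDist_add, laplacian_add]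
    module
  · refine Γ.deltaDist_injective ?_
    rw [RingHom.id_apply, deltaDist_smul, ← h7, ← h7, map_smul, toDist_smul, laplacian_smul]
    module

/-- On a subspace of codimension at most `2 n`, the resolvent difference is `O(1/(n² log n))`. -/
theorem exists_norm_resolvent_sub_le (hα : α ≠ 0) (hlam : lam < 0)
    (hR : IsResolventAt (Γ.schrodingerGraph lam α) z R) (hR₀ : IsResolventAt freeGraph z R₀) :
    ∃ (C : ℝ) (N : ℕ), 0 ≤ C ∧ ∀ n : ℕ, N ≤ n → ∃ Φ : L2R3 →ₗ[ℂ] (Fin (2 * n) → ℂ),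
      ∀ f, Φ f = 0 → ‖(R - R₀) f‖ ≤ C / ((n : ℝ) ^ 2 * Real.log n) * ‖f‖ := by
  obtain ⟨T, hT⟩ := exists_linearMap (Γ := Γ) hα hR hR₀
  obtain ⟨c, C, hc, hB⟩ := Γ.exists_re_inner_le lam
  obtain ⟨C₁, hC₁, hγ⟩ := Γ.exists_norm_le_of_isGamma hlam
  obtain ⟨C₂, hC₂, htr⟩ := Γ.exists_norm_inner_le_of_isRestriction hlam
  set K : ℝ := 1 + ‖z - lam‖ * ‖R‖ with hK
  set K₀ : ℝ := 1 + ‖z - lam‖ * ‖R₀‖ with hK₀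
  have hK0 : 0 < K := by positivity
  have hK₀0 : 0 < K₀ := by positivity
  have hlog : Tendsto (fun n : ℕ => Real.log n) atTop atTop :=
    Real.tendsto_log_atTop.comp tendsto_natCast_atTop_atTop
  -- From `N` on, `C - α ≤ (c/2) log n`, so half of the logarithmic gain absorbs the constants
  -- whatever the sign of `α`; `n ≥ 2` keeps `log n` positive.
  obtain ⟨N, hN⟩ := eventually_atTop.1
    ((hlog.eventually_ge_atTop (2 * (C - α) / c)).and (eventually_ge_atTop 2))
  refine ⟨K₀ * C₁ * (2 * C₂ * K / c), N, by positivity, fun n hn => ?_⟩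
  obtain ⟨hNlog, hn2⟩ := hN n hn
  have hn0 : (0 : ℝ) < n := by positivity
  have hlog0 : 0 < Real.log n := Real.log_pos (by exact_mod_cast hn2)
  -- The `2n` conditions are the moments of order zero and one of `T f` over the `n` cells, with the
  -- pairs (order, cell) numbered by `finProdFinEquiv`.
  refine ⟨LinearMap.pi fun k : Fin (2 * n) =>
    (Γ.cellMoment (Γ.L / n) (finProdFinEquiv.symm k).1 (finProdFinEquiv.symm k).2).toLinearMap ∘ₗ T,
    fun f hf => ?_⟩
  have hmom : ∀ (j : Fin 2) (i : Fin n), Γ.cellMoment (Γ.L / n) j i (T f) = 0 := fun j i => by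
    have := congrFun hf (finProdFinEquiv (j, i))
    rw [LinearMap.pi_apply, Equiv.symm_apply_apply] at this
    exact this
  have h0 : ∀ i : Fin n, Γ.cellMoment (Γ.L / n) 0 i (T f) = 0 := hmom 0
  have h1 : ∀ i : Fin n, Γ.cellMoment (Γ.L / n) 1 i (T f) = 0 := hmom 1
  obtain ⟨uc, v, g, b, hv, hb, hg, hgb, huc, hD⟩ := hT f
  set h := T f with hh
  set F : L2R3 := f + (z - lam) • R f with hF
  have hFle : ‖F‖ ≤ K * ‖f‖ := by
    calc ‖F‖ ≤ ‖f‖ + ‖z - lam‖ * ‖R f‖ := (norm_add_le _ _).trans (by rw [norm_smul])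
      _ ≤ ‖f‖ + ‖z - lam‖ * (‖R‖ * ‖f‖) := by
          gcongr
          exact R.le_opNorm f
      _ = K * ‖f‖ := by
          rw [hK]
          ring
  have hDle : ‖(R - R₀) f‖ ≤ K₀ * ‖v‖ := by
    rw [hD]
    calc ‖v + (z - lam) • R₀ v‖ ≤ ‖v‖ + ‖z - lam‖ * ‖R₀ v‖ :=
          (norm_add_le _ _).trans (by rw [norm_smul])
      _ ≤ ‖v‖ + ‖z - lam‖ * (‖R₀‖ * ‖v‖) := by
          gcongr
          exact R₀.le_opNorm v
      _ = K₀ * ‖v‖ := by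
          rw [hK₀]
          ring
  have hvle := hγ n (by omega) h v hv h0 h1
  have hin := htr n (by omega) h g uc F huc hg h0 h1
  have hre := hB n (by omega) h b hb h0
  -- The boundary condition paired with `h`. The form of `B` is very negative on such `h`, so only
  -- the small pairing with `g` can balance it.
  have hsum : α * ‖h‖ ^ 2 = (inner ℂ h g).re + (inner ℂ h b).re := by
    rw [← Complex.add_re, ← inner_add_right, ← hgb, inner_smul_right, inner_self_eq_norm_sq_to_K]
    simp [← Complex.ofReal_pow]
  have hle : (inner ℂ h g).re ≤ C₂ / n * ‖h‖ * ‖F‖ := (Complex.re_le_norm _).trans hin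
  have hcl : C - α ≤ c / 2 * Real.log n := by
    rw [div_le_iff₀ hc] at hNlog
    linarith
  have hhle : ‖h‖ ≤ 2 * C₂ * K / c / (n * Real.log n) * ‖f‖ := by
    rcases (norm_nonneg h).eq_or_lt with h0' | hpos
    · rw [← h0']
      positivity
    · have e1 : c / 2 * Real.log n * ‖h‖ ^ 2 ≤ C₂ / n * ‖h‖ * ‖F‖ := by
        have := mul_le_mul_of_nonneg_right hcl (sq_nonneg ‖h‖)
        linarith
      have e2 : c / 2 * Real.log n * ‖h‖ ≤ C₂ / n * (K * ‖f‖) := by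
        refine le_trans ?_ (mul_le_mul_of_nonneg_left hFle (by positivity))
        refine le_of_mul_le_mul_right ?_ hpos
        calc c / 2 * Real.log n * ‖h‖ * ‖h‖ = c / 2 * Real.log n * ‖h‖ ^ 2 := by ring
          _ ≤ C₂ / n * ‖h‖ * ‖F‖ := e1
          _ = C₂ / n * ‖F‖ * ‖h‖ := by ring
      have e3 : ‖h‖ ≤ C₂ / n * (K * ‖f‖) / (c / 2 * Real.log n) := by
        rw [le_div_iff₀ (by positivity), mul_comm]
        exact e2
      refine e3.trans (le_of_eq ?_)
      field_simp
  -- One factor `1/n` comes from `γ`, the other factor `1 / (n log n)` from the size of the density.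
  calc ‖(R - R₀) f‖ ≤ K₀ * ‖v‖ := hDle
    _ ≤ K₀ * (C₁ / n * ‖h‖) := by gcongr
    _ ≤ K₀ * (C₁ / n * (2 * C₂ * K / c / (n * Real.log n) * ‖f‖)) := by gcongr
    _ = K₀ * C₁ * (2 * C₂ * K / c) / ((n : ℝ) ^ 2 * Real.log n) * ‖f‖ := by
        field_simp

end ClosedCurve

end DeltaCurve

theorem theorem3p2 (Γ : DeltaCurve.ClosedCurve) (α : ℝ) (hα : α ≠ 0) (lam : ℝ) (hlam : lam < 0)
    (z : ℂ) (R R₀ : DeltaCurve.L2R3 →L[ℂ] DeltaCurve.L2R3)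
    (hR : DeltaCurve.IsResolventAt (Γ.schrodingerGraph lam α) z R)
    (hR₀ : DeltaCurve.IsResolventAt DeltaCurve.freeGraph z R₀) :
    IsCompactOperator (R - R₀) ∧
    (fun k : ℕ => DeltaCurve.singularValue (R - R₀) k)
      =O[atTop] (fun k : ℕ => 1 / ((k : ℝ) ^ 2 * Real.log k)) ∧
    ∀ p : ℝ, 1 / 2 < p → DeltaCurve.MemSchatten p (R - R₀) := by
  obtain ⟨C, N, hC, h⟩ := DeltaCurve.ClosedCurve.exists_norm_resolvent_sub_le hα hlam hR hR₀
  exact DeltaCurve.isCompactOperator_and_isBigO_and_memSchatten (R - R₀) hC h
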